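/- **Proposition.** Let $K$ be a compact quantum group, given by its Hopf $*$-algebra $\mathfrak C^\infty(K)$ of matrix coefficients together with its faithful bi-invariant Haar state $\varphi$. Let $\Lambda:\mathfrak C^\infty(K)\to L^2(K)$ be the GNS map of $\varphi$, on which $\mathfrak C^\infty(K)$ acts by left multiplication, and let $(u^\mu_{ij})_{1\le i,j\le n_\mu}$, $\mu\in\operatorname{Irr}(K)$, be representatives of the equivalence classes of irreducible unitary corepresentation matrices of $\mathfrak C^\infty(K)$. Let $\mathrm W$ be the Kac–Takesaki operator on $L^2(K)\otimes L^2(K)$, determined by $\mathrm W^*(\Lambda(a)\otimes\Lambda(f))=(\Lambda\otimes\Lambda)(\Delta(f)(a\otimes 1))$, let $VN(K)$ be the von Neumann algebra generated by the slices $(\omega\otimes\mathrm{id})(\mathrm W)$, with predual $VN(K)_*$ and with comultiplication $\widehat\Delta(x)=\widehat{\mathrm W}^*(1\otimes x)\widehat{\mathrm W}$, where $\widehat{\mathrm W}=\Sigma \mathrm W^*\Sigma$ and $\Sigma$ is the tensor flip. Recall that $VN(K)=\ell^\infty\text{-}\prod_\mu\operatorname{End}(V(\mu))$, with matrix units $\omega^\mu_{ij}$,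 such that $\mathrm W=\sum_\mu\sum_{i,j}u^\mu_{ij}\otimes\omega^\mu_{ij}$. A *weight on the dual of $K$* is a densely defined, strictly positive, self-adjoint operator $w$ on $L^2(K)$ such that $w^{-1}\in VN(K)$ and $w^{-2}\otimes w^{-2}\le\widehat\Delta(w^{-2})$. It is *central* if $w^{-1}$ lies in the center of $VN(K)$; then $w^{-1}$ acts on $V(\mu)$ as a scalar $w(\mu)^{-1}$ with $w(\mu)>0$, and one writes $w=(w(\mu))_{\mu\in\operatorname{Irr}(K)}$. Its Beurling–Fourier algebra is $$A(K,w)=\{(\mathrm{id}\otimes w^{-1}\omega)(\mathrm W)\mid \omega\in VN(K)_*\}\subseteq L^\infty(K),\qquad (w^{-1}\omega)(x)=\omega(xw^{-1}),$$ with the product of $L^\infty(K)$ and with the operator space structure for which $\omega\mapsto(\mathrm{id}\otimes w^{-1}\omega)(\mathrm W)$ is a complete isometry from $VN(K)_*$ onto $A(K,w)$; it contains $\mathfrak C^\infty(K)$. Let $w=(w(\mu))_\mu$ be a central weight on the dual of $K$ (in particular, $w$ may be any symmetric central weight), let $\mathcal H$ be a Hilbert space and let $\theta:\mathfrak C^\infty(K)\to\mathbb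 L(\mathcal H)$ be an algebra representation, not assumed to be unital or $*$-preserving. Put $$v_\theta=(\theta\otimes\mathrm{id})(\mathrm W)=(v_\theta^\mu)_\mu,\qquad v_\theta^\mu=\sum_{1\le i,j\le n_\mu}\theta(u^\mu_{ij})\otimes\omega^\mu_{ij}\in\mathbb L(\mathcal H)\otimes\operatorname{End}(V(\mu)).$$ Then the following are equivalent: 1. $\theta$ extends to a completely bounded algebra representation $\tilde\theta:A(K,w)\to\mathbb L(\mathcal H)$; 2. $v_\theta(1\otimes w^{-1})\in\mathbb L(\mathcal H)\,\overline\otimes\,VN(K)$, that is, some element of $\mathbb L(\mathcal H)\,\overline\otimes\,VN(K)$ has components $w(\mu)^{-1}v_\theta^\mu$, $\mu\in\operatorname{Irr}(K)$; 3. $\displaystyle\sup_{\mu\in\operatorname{Irr}(K)}\frac{\|v_\theta^\mu\|}{w(\mu)}<\infty$. -/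

import Mathlib

open scoped TensorProduct InnerProductSpace ComplexOrder

noncomputable section

/-! ### Hilbert space tensor products and von Neumann algebras -/

/-- The Hilbert space tensor product `E ⊗ F`: the completion of the algebraic tensor product. -/
abbrev HilbertTensor (E F : Type*) [NormedAddCommGroup E] [InnerProductSpace ℂ E]
    [NormedAddCommGroup F] [InnerProductSpace ℂ F] : Type _ :=
  UniformSpace.Completion (E ⊗[ℂ] F)

namespace HilbertTensor

variable {E F E' F' : Type*} [NormedAddCommGroup E] [InnerProductSpace ℂ E]
  [NormedAddCommGroup F] [InnerProductSpace ℂ F]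
  [NormedAddCommGroup E'] [InnerProductSpace ℂ E']
  [NormedAddCommGroup F'] [InnerProductSpace ℂ F']

/-- The elementary tensor `ξ ⊗ η` in the Hilbert space tensor product. -/
def tmul (ξ : E) (η : F) : HilbertTensor E F := ((ξ ⊗ₜ[ℂ] η : E ⊗[ℂ] F) : HilbertTensor E F)

/-- The bounded operator `η ↦ ξ ⊗ η`. -/
def ket (ξ : E) : F →L[ℂ] HilbertTensor E F :=
  (UniformSpace.Completion.toComplL (𝕜 := ℂ)).comp (TensorProduct.mkL ℂ E F ξ)

/-- Extension of a bounded operator on algebraic tensor products to the completions. -/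
def lift (f : E ⊗[ℂ] F →L[ℂ] E' ⊗[ℂ] F') : HilbertTensor E F →L[ℂ] HilbertTensor E' F' :=
  ContinuousLinearMap.extend ((UniformSpace.Completion.toComplL (𝕜 := ℂ)).comp f)
    (UniformSpace.Completion.toComplL (𝕜 := ℂ) (E := E ⊗[ℂ] F))

theorem lift_coe (f : E ⊗[ℂ] F →L[ℂ] E' ⊗[ℂ] F') (t : E ⊗[ℂ] F) :
    lift f (t : HilbertTensor E F) = (f t : HilbertTensor E' F') :=
  ContinuousLinearMap.extend_eq _ UniformSpace.Completion.denseRange_coe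
    (UniformSpace.Completion.isUniformInducing_coe _) t

/-- The operator `a ⊗ b` on the Hilbert space tensor product. -/
def map (a : E →L[ℂ] E') (b : F →L[ℂ] F') : HilbertTensor E F →L[ℂ] HilbertTensor E' F' :=
  lift (TensorProduct.mapL a b)

theorem map_tmul (a : E →L[ℂ] E') (b : F →L[ℂ] F') (ξ : E) (η : F) :
    map a b (tmul ξ η) = tmul (a ξ) (b η) := by
  simp [map, tmul, lift_coe]

variable (E F) in
/-- The tensor flip `Σ : E ⊗ F → F ⊗ E`. -/
def swap : HilbertTensor E F →L[ℂ] HilbertTensor F E :=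
  lift (TensorProduct.commIsometry ℂ E F).toContinuousLinearEquiv.toContinuousLinearMap

theorem swap_tmul (ξ : E) (η : F) : swap E F (tmul ξ η) = tmul η ξ := by
  simp [swap, tmul, lift_coe]

/-- The slice `(ω_{ξ,η} ⊗ id)(T)`, where `ω_{ξ,η}(x) = ⟪ξ, x η⟫`. -/
def slice [CompleteSpace E] [CompleteSpace F]
    (T : HilbertTensor E F →L[ℂ] HilbertTensor E F) (ξ η : E) : F →L[ℂ] F :=
  (ket ξ).adjoint ∘L T ∘L ket η

theorem inner_slice [CompleteSpace E] [CompleteSpace F]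
    (T : HilbertTensor E F →L[ℂ] HilbertTensor E F) (ξ η : E) (x y : F) :
    ⟪x, slice T ξ η y⟫_ℂ = ⟪tmul ξ x, T (tmul η y)⟫_ℂ := by
  simp only [slice, ContinuousLinearMap.comp_apply, ContinuousLinearMap.adjoint_inner_right]
  rfl

section Slices

theorem ket_add (ξ ξ' : E) : (ket (ξ + ξ') : F →L[ℂ] HilbertTensor E F) = ket ξ + ket ξ' := by
  ext x; simp [ket]

theorem ket_smul (c : ℂ) (ξ : E) : (ket (c • ξ) : F →L[ℂ] HilbertTensor E F) = c • ket ξ := by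
  ext x; simp [ket]

theorem norm_ket_le (ξ : E) : ‖(ket ξ : F →L[ℂ] HilbertTensor E F)‖ ≤ ‖ξ‖ :=
  ContinuousLinearMap.opNorm_le_bound _ (norm_nonneg _) fun x => by simp [ket]

variable [CompleteSpace E] [CompleteSpace F] (T : HilbertTensor E F →L[ℂ] HilbertTensor E F)

theorem slice_add_left (ξ ξ' η : E) : slice T (ξ + ξ') η = slice T ξ η + slice T ξ' η := by
  simp only [slice, ket_add, map_add, ContinuousLinearMap.add_comp]

theorem slice_add_right (ξ η η' : E) : slice T ξ (η + η') = slice T ξ η + slice T ξ η' := by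
  simp only [slice, ket_add, ContinuousLinearMap.comp_add]

theorem slice_smul_left (c : ℂ) (ξ η : E) :
    slice T (c • ξ) η = (starRingEnd ℂ c) • slice T ξ η := by
  simp only [slice, ket_smul, map_smulₛₗ, ContinuousLinearMap.smul_comp]

theorem slice_smul_right (c : ℂ) (ξ η : E) : slice T ξ (c • η) = c • slice T ξ η := by
  simp only [slice, ket_smul, ContinuousLinearMap.comp_smul]

theorem norm_slice_le (ξ η : E) : ‖slice T ξ η‖ ≤ ‖T‖ * ‖ξ‖ * ‖η‖ := by
  have h1 : ‖(ket ξ : F →L[ℂ] HilbertTensor E F).adjoint‖ ≤ ‖ξ‖ := by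
    rw [LinearIsometryEquiv.norm_map]; exact norm_ket_le ξ
  calc ‖slice T ξ η‖
      ≤ ‖(ket ξ : F →L[ℂ] HilbertTensor E F).adjoint‖ *
        ‖T ∘L (ket η : F →L[ℂ] HilbertTensor E F)‖ := ContinuousLinearMap.opNorm_comp_le _ _
    _ ≤ ‖ξ‖ * (‖T‖ * ‖η‖) := by
        gcongr
        exact (ContinuousLinearMap.opNorm_comp_le _ _).trans (by gcongr; exact norm_ket_le η)
    _ = ‖T‖ * ‖ξ‖ * ‖η‖ := by ring

end Slices

end HilbertTensor

/-- The von Neumann algebra generated by a set `S` of bounded operators: the double commutant of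
`S ∪ S*`. -/
def vonNeumannClosure {H : Type*} [NormedAddCommGroup H] [InnerProductSpace ℂ H] [CompleteSpace H]
    (S : Set (H →L[ℂ] H)) : VonNeumannAlgebra H where
  toStarSubalgebra :=
    StarSubalgebra.centralizer ℂ (StarSubalgebra.centralizer ℂ S : Set (H →L[ℂ] H))
  centralizer_centralizer' := by
    change Set.centralizer (Set.centralizer
      ((StarSubalgebra.centralizer ℂ (StarSubalgebra.centralizer ℂ S : Set (H →L[ℂ] H)) :
        StarSubalgebra ℂ (H →L[ℂ] H)) : Set (H →L[ℂ] H))) =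
      ((StarSubalgebra.centralizer ℂ (StarSubalgebra.centralizer ℂ S : Set (H →L[ℂ] H)) :
        StarSubalgebra ℂ (H →L[ℂ] H)) : Set (H →L[ℂ] H))
    rw [StarSubalgebra.coe_centralizer, Set.centralizer_centralizer_centralizer]

theorem subset_vonNeumannClosure {H : Type*} [NormedAddCommGroup H] [InnerProductSpace ℂ H]
    [CompleteSpace H] (S : Set (H →L[ℂ] H)) {x : H →L[ℂ] H} (hx : x ∈ S) :
    x ∈ (vonNeumannClosure S).toStarSubalgebra := by
  change x ∈ StarSubalgebra.centralizer ℂ (StarSubalgebra.centralizer ℂ S : Set (H →L[ℂ] H))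
  rw [StarSubalgebra.mem_centralizer_iff]
  intro g hg
  have hg' : star g ∈ StarSubalgebra.centralizer ℂ S := star_mem hg
  exact ⟨((StarSubalgebra.mem_centralizer_iff ℂ).mp hg x hx).1.symm,
    ((StarSubalgebra.mem_centralizer_iff ℂ).mp hg' x hx).1.symm⟩

/-- The predual `M_*` of a von Neumann algebra `M`: the norm closed linear span, inside the Banach
space dual of `M`, of the vector functionals `x ↦ ⟪ξ, x η⟫`. -/
def VonNeumannAlgebra.predual {H : Type*} [NormedAddCommGroup H] [InnerProductSpace ℂ H]
    [CompleteSpace H] (M : VonNeumannAlgebra H) :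
    Submodule ℂ (StrongDual ℂ M.toStarSubalgebra) :=
  (Submodule.span ℂ {ω : StrongDual ℂ M.toStarSubalgebra |
    ∃ ξ η : H, ∀ x : M.toStarSubalgebra, ω x = ⟪ξ, (x : H →L[ℂ] H) η⟫_ℂ}).topologicalClosure

/-- The norm of `M_n(M_*)` in the operator space structure of the predual `M_*`, which comes from
`M_n(M_*) ⊆ CB(M, M_n(ℂ))`. -/
def VonNeumannAlgebra.predualMatrixNorm {H : Type*} [NormedAddCommGroup H]
    [InnerProductSpace ℂ H] [CompleteSpace H] (M : VonNeumannAlgebra H) {n : ℕ}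
    (ω : Fin n → Fin n → M.predual) : ℝ :=
  sSup {r : ℝ | ∃ (m : ℕ) (x : Fin m → Fin m → M.toStarSubalgebra),
    ‖CStarMatrix.ofMatrix (fun k l => (x k l : H →L[ℂ] H))‖ ≤ 1 ∧
    r = ‖(CStarMatrix.ofMatrix fun p q => (ω p.1 q.1 : StrongDual ℂ M.toStarSubalgebra)
        (x p.2 q.2) : CStarMatrix (Fin n × Fin m) (Fin n × Fin m) ℂ)‖}

/-! ### Irreducible unitary corepresentation matrices of a Hopf `*`-algebra -/

section Irr

variable (A : Type*) [Ring A] [StarRing A] [HopfAlgebra ℂ A]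

/-- An irreducible unitary corepresentation matrix `u ∈ M_n(A)`, `n ≥ 1`. -/
structure IrrMatrix where
  /-- the dimension -/
  dim : ℕ
  /-- the matrix -/
  mat : Matrix (Fin dim) (Fin dim) A
  dim_pos : 0 < dim
  comul_mat : ∀ i j, Coalgebra.comul (R := ℂ) (mat i j) = ∑ k, mat i k ⊗ₜ[ℂ] mat k j
  mat_unitary : mat ∈ unitary (Matrix (Fin dim) (Fin dim) A)
  irreducible : ∀ T : Matrix (Fin dim) (Fin dim) ℂ,
    T.map (algebraMap ℂ A) * mat = mat * T.map (algebraMap ℂ A) →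
      ∃ c : ℂ, T = c • (1 : Matrix (Fin dim) (Fin dim) ℂ)

/-- Unitary equivalence of corepresentation matrices. -/
def IrrMatrix.Equivalent {A : Type*} [Ring A] [StarRing A] [HopfAlgebra ℂ A]
    (u v : IrrMatrix A) : Prop :=
  ∃ T : Matrix (Fin v.dim) (Fin u.dim) ℂ, T.conjTranspose * T = 1 ∧ T * T.conjTranspose = 1 ∧
    T.map (algebraMap ℂ A) * u.mat = v.mat * T.map (algebraMap ℂ A)

theorem IrrMatrix.equivalent_equivalence : Equivalence (IrrMatrix.Equivalent (A := A)) where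
  refl u := ⟨1, by simp, by simp, by
    rw [Matrix.map_one _ (map_zero _) (map_one _)]; simp⟩
  symm := by
    rintro u v ⟨T, h1, h2, h3⟩
    refine ⟨T.conjTranspose, by simpa using h2, by simpa using h1, ?_⟩
    have e1 : T.conjTranspose.map (algebraMap ℂ A) * T.map (algebraMap ℂ A) = 1 := by
      rw [← Matrix.map_mul, h1, Matrix.map_one _ (map_zero _) (map_one _)]
    have e2 : T.map (algebraMap ℂ A) * T.conjTranspose.map (algebraMap ℂ A) = 1 := by
      rw [← Matrix.map_mul, h2, Matrix.map_one _ (map_zero _) (map_one _)]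
    calc T.conjTranspose.map (algebraMap ℂ A) * v.mat
        = T.conjTranspose.map (algebraMap ℂ A) * (v.mat * T.map (algebraMap ℂ A)) *
            T.conjTranspose.map (algebraMap ℂ A) := by
          rw [Matrix.mul_assoc, Matrix.mul_assoc, e2, Matrix.mul_one]
      _ = u.mat * T.conjTranspose.map (algebraMap ℂ A) := by
          rw [← h3, ← Matrix.mul_assoc, e1, Matrix.one_mul]
  trans := by
    rintro u v x ⟨T, h1, h2, h3⟩ ⟨S, k1, k2, k3⟩
    refine ⟨S * T, ?_, ?_, ?_⟩
    · rw [Matrix.conjTranspose_mul, Matrix.mul_assoc, ← Matrix.mul_assoc _ S, k1,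
        Matrix.one_mul, h1]
    · rw [Matrix.conjTranspose_mul, Matrix.mul_assoc, ← Matrix.mul_assoc T, h2,
        Matrix.one_mul, k2]
    · rw [Matrix.map_mul, Matrix.mul_assoc, h3, ← Matrix.mul_assoc, k3, Matrix.mul_assoc]

/-- `Irr(K)`: equivalence classes of irreducible unitary corepresentation matrices. -/
def Irr : Type _ :=
  Quotient (⟨IrrMatrix.Equivalent, IrrMatrix.equivalent_equivalence A⟩ : Setoid (IrrMatrix A))

/-- The chosen corepresentation matrix `u^μ = (u^μ_{ij})` in the class `μ`. -/
def Irr.rep {A : Type*} [Ring A] [StarRing A] [HopfAlgebra ℂ A] (μ : Irr A) : IrrMatrix A :=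
  Quotient.out μ

end Irr

/-- The component `v_θ^μ = ∑_{ij} θ(u^μ_{ij}) ⊗ ω^μ_{ij}` of `v_θ = (θ ⊗ id)(W)`, as a matrix in
`M_{n_μ}(B(H)) = B(H) ⊗ End(V(μ))`, with its C*-norm. -/
def vTheta {A : Type*} [Ring A] [StarRing A] [HopfAlgebra ℂ A]
    {H : Type*} [NormedAddCommGroup H] [InnerProductSpace ℂ H] [CompleteSpace H]
    (θ : A →ₙₐ[ℂ] (H →L[ℂ] H)) (μ : Irr A) :
    CStarMatrix (Fin μ.rep.dim) (Fin μ.rep.dim) (H →L[ℂ] H) :=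
  CStarMatrix.ofMatrix fun i j => θ (μ.rep.mat i j)

/-! ### Compact quantum groups -/

/-- A compact quantum group `K`, given by its Hopf `*`-algebra `A = C^∞(K)` of matrix coefficients
and its Haar state. -/
structure CompactQuantumGroup (A : Type*) [Ring A] [StarRing A] [HopfAlgebra ℂ A]
    [StarModule ℂ A] where
  /-- the comultiplication is `*`-preserving -/
  comul_star : ∀ a : A, Coalgebra.comul (R := ℂ) (star a) = star (Coalgebra.comul (R := ℂ) a)
  /-- the Haar state `φ` -/
  haar : A →ₗ[ℂ] ℂ
  haar_one : haar 1 = 1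
  haar_nonneg : ∀ a : A, 0 ≤ haar (star a * a)
  haar_faithful : ∀ a : A, haar (star a * a) = 0 → a = 0
  /-- `(id ⊗ φ) Δ(a) = φ(a) 1` -/
  haar_left : ∀ a : A,
    TensorProduct.rid ℂ A (haar.lTensor A (Coalgebra.comul (R := ℂ) a)) = haar a • (1 : A)
  /-- `(φ ⊗ id) Δ(a) = φ(a) 1` -/
  haar_right : ∀ a : A,
    TensorProduct.lid ℂ A (haar.rTensor A (Coalgebra.comul (R := ℂ) a)) = haar a • (1 : A)

namespace CompactQuantumGroup

variable {A : Type*} [Ring A] [StarRing A] [HopfAlgebra ℂ A] [StarModule ℂ A]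

theorem haar_star (K : CompactQuantumGroup A) (a : A) :
    K.haar (star a) = star (K.haar a) := by
  have h1 := K.haar_nonneg (1 + a)
  have h2 := K.haar_nonneg (1 + Complex.I • a)
  have h3 := K.haar_nonneg a
  simp only [star_add, star_one, star_smul, add_mul, mul_add, one_mul, mul_one, map_add,
    K.haar_one, map_smul, smul_mul_assoc, mul_smul_comm, smul_eq_mul] at h1 h2
  rw [Complex.nonneg_iff] at h1 h2 h3
  obtain ⟨-, h1⟩ := h1
  obtain ⟨-, h2⟩ := h2
  obtain ⟨-, h3⟩ := h3
  apply Complex.ext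
  · simp at h2 h3 ⊢
    linarith
  · simp at h1 h3 ⊢
    linarith

/-- The space `A` with the pre-Hilbert space structure `⟪a, b⟫ = φ(a* b)`. -/
def Pre (_K : CompactQuantumGroup A) : Type _ := A

variable (K : CompactQuantumGroup A)

instance : AddCommGroup K.Pre := inferInstanceAs (AddCommGroup A)

instance : Module ℂ K.Pre := inferInstanceAs (Module ℂ A)

/-- The identity map, seen as a map from `A` to the pre-Hilbert space. -/
def toPre : A ≃ₗ[ℂ] K.Pre := LinearEquiv.refl ℂ A

instance preCore : InnerProductSpace.Core ℂ K.Pre where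
  inner a b := K.haar (star (K.toPre.symm a) * K.toPre.symm b)
  conj_inner_symm a b := by
    rw [starRingEnd_apply, ← K.haar_star]
    simp
  re_inner_nonneg a := (Complex.nonneg_iff.mp (K.haar_nonneg _)).1
  add_left a b c := by simp [add_mul]
  smul_left a b r := by simp
  definite a h := by simpa using K.haar_faithful _ h

instance : NormedAddCommGroup K.Pre := K.preCore.toNormedAddCommGroup

instance : InnerProductSpace ℂ K.Pre := InnerProductSpace.ofCore K.preCore.toCore

theorem inner_toPre (a b : A) : ⟪K.toPre a, K.toPre b⟫_ℂ = K.haar (star a * b) := rfl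

/-- `L²(K)`: the GNS Hilbert space of the Haar state. -/
abbrev L2 : Type _ := UniformSpace.Completion K.Pre

/-- The GNS map `Λ : C^∞(K) → L²(K)`. -/
def Λ : A →ₗ[ℂ] K.L2 :=
  (UniformSpace.Completion.toComplL (𝕜 := ℂ) (E := K.Pre)).toLinearMap ∘ₗ K.toPre.toLinearMap

theorem inner_Λ (a b : A) : ⟪K.Λ a, K.Λ b⟫_ℂ = K.haar (star a * b) := by
  simp [Λ, inner_toPre]

/-- `Λ ⊗ Λ : C^∞(K) ⊗ C^∞(K) → L²(K) ⊗ L²(K)`. -/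
def ΛΛ : A ⊗[ℂ] A →ₗ[ℂ] HilbertTensor K.L2 K.L2 :=
  (UniformSpace.Completion.toComplL (𝕜 := ℂ) (E := K.L2 ⊗[ℂ] K.L2)).toLinearMap ∘ₗ
    TensorProduct.map K.Λ K.Λ

theorem ΛΛ_tmul (a b : A) : K.ΛΛ (a ⊗ₜ b) = HilbertTensor.tmul (K.Λ a) (K.Λ b) := by
  simp [ΛΛ, HilbertTensor.tmul]

/-- The linear map `a ⊗ f ↦ Δ(f) (a ⊗ 1)` on `C^∞(K) ⊗ C^∞(K)`. -/
def galois (A : Type*) [Ring A] [HopfAlgebra ℂ A] : A ⊗[ℂ] A →ₗ[ℂ] A ⊗[ℂ] A :=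
  TensorProduct.lift <| LinearMap.mk₂ ℂ
    (fun a f => Coalgebra.comul (R := ℂ) f * (a ⊗ₜ[ℂ] (1 : A)))
    (fun a b f => by rw [TensorProduct.add_tmul, mul_add])
    (fun c a f => by rw [← TensorProduct.smul_tmul', mul_smul_comm])
    (fun a f g => by rw [map_add, add_mul])
    (fun c a f => by rw [map_smul, smul_mul_assoc])

theorem galois_tmul {A : Type*} [Ring A] [HopfAlgebra ℂ A] (a f : A) :
    galois A (a ⊗ₜ[ℂ] f) = Coalgebra.comul (R := ℂ) f * (a ⊗ₜ[ℂ] (1 : A)) := by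
  simp [galois]

/-- `φ ⊗ φ` on `C^∞(K) ⊗ C^∞(K)`. -/
def haarTensor : A ⊗[ℂ] A →ₗ[ℂ] ℂ :=
  (TensorProduct.lid ℂ ℂ).toLinearMap ∘ₗ TensorProduct.map K.haar K.haar

theorem inner_ΛΛ (s t : A ⊗[ℂ] A) :
    ⟪K.ΛΛ s, K.ΛΛ t⟫_ℂ = K.haarTensor (star s * t) := by
  induction s with
  | zero => simp
  | add x y hx hy => rw [map_add, inner_add_left, hx, hy, star_add, add_mul, map_add]
  | tmul a f =>
    induction t with
    | zero => simp
    | add x y hx hy => rw [map_add, inner_add_right, hx, hy, mul_add, map_add]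
    | tmul b g => simp [ΛΛ, haarTensor, inner_Λ]

theorem haarTensor_mul_mul (p q : A) (X : A ⊗[ℂ] A) :
    K.haarTensor ((p ⊗ₜ[ℂ] (1 : A)) * X * (q ⊗ₜ[ℂ] (1 : A))) =
      K.haar (p * TensorProduct.rid ℂ A (K.haar.lTensor A X) * q) := by
  induction X with
  | zero => simp
  | add x y hx hy => simp only [mul_add, add_mul, map_add, hx, hy]
  | tmul b g => simp [haarTensor, mul_comm]

theorem star_mul_tmul_one (X : A ⊗[ℂ] A) (a : A) :
    star (X * (a ⊗ₜ[ℂ] (1 : A))) = (star a ⊗ₜ[ℂ] (1 : A)) * star X := by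
  induction X with
  | zero => simp
  | add x y hx hy => simp only [add_mul, star_add, mul_add, hx, hy]
  | tmul b g => simp

theorem inner_galois (s t : A ⊗[ℂ] A) :
    ⟪K.ΛΛ (galois A s), K.ΛΛ (galois A t)⟫_ℂ = ⟪K.ΛΛ s, K.ΛΛ t⟫_ℂ := by
  induction s with
  | zero => simp
  | add x y hx hy => rw [map_add, map_add, inner_add_left, hx, hy, map_add, inner_add_left]
  | tmul a f =>
    induction t with
    | zero => simp
    | add x y hx hy => rw [map_add, map_add, inner_add_right, hx, hy, map_add, inner_add_right]
    | tmul b g =>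
      have e : star (Coalgebra.comul (R := ℂ) f * (a ⊗ₜ[ℂ] (1 : A))) *
          (Coalgebra.comul (R := ℂ) g * (b ⊗ₜ[ℂ] (1 : A))) =
          (star a ⊗ₜ[ℂ] (1 : A)) * Coalgebra.comul (R := ℂ) (star f * g) *
            (b ⊗ₜ[ℂ] (1 : A)) := by
        rw [star_mul_tmul_one, ← K.comul_star, Bialgebra.comul_mul]
        simp only [mul_assoc]
      rw [inner_ΛΛ, galois_tmul, galois_tmul, e, haarTensor_mul_mul, K.haar_left, inner_ΛΛ]
      simp [haarTensor, mul_comm]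

theorem denseRange_Λ : DenseRange K.Λ := by
  have h : DenseRange ((↑) : K.Pre → K.L2) := UniformSpace.Completion.denseRange_coe
  exact h.comp K.toPre.surjective.denseRange (UniformSpace.Completion.continuous_coe _)

theorem denseRange_ΛΛ : DenseRange K.ΛΛ := by
  have key : ∀ ξ η : K.L2,
      HilbertTensor.tmul ξ η ∈ (LinearMap.range K.ΛΛ).topologicalClosure := by
    intro ξ η
    have hc : Continuous fun p : K.L2 × K.L2 => HilbertTensor.tmul p.1 p.2 :=
      (UniformSpace.Completion.continuous_coe _).comp (TensorProduct.continuous_tmul)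
    have hd : DenseRange (Prod.map K.Λ K.Λ) := K.denseRange_Λ.prodMap K.denseRange_Λ
    refine hd.induction_on (p := fun p : K.L2 × K.L2 => HilbertTensor.tmul p.1 p.2 ∈
      (LinearMap.range K.ΛΛ).topologicalClosure) (ξ, η) ?_ ?_
    · exact (Submodule.isClosed_topologicalClosure _).preimage hc
    · rintro ⟨a, b⟩
      exact Submodule.le_topologicalClosure _ ⟨a ⊗ₜ b, K.ΛΛ_tmul a b⟩
  have h2 : (LinearMap.range K.ΛΛ).topologicalClosure = ⊤ := by
    rw [Submodule.eq_top_iff']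
    intro x
    refine UniformSpace.Completion.induction_on x
      (Submodule.isClosed_topologicalClosure _) fun t => ?_
    induction t with
    | zero => exact Submodule.zero_mem _
    | add x y hx hy =>
      rw [UniformSpace.Completion.coe_add]
      exact Submodule.add_mem _ hx hy
    | tmul ξ η => exact key ξ η
  have h3 := (Submodule.dense_iff_topologicalClosure_eq_top).mpr h2
  rwa [LinearMap.coe_range] at h3

/-- The Kac-Takesaki operator `W` on `L²(K) ⊗ L²(K)`, whose adjoint is determined by
`W*(Λ(a) ⊗ Λ(f)) = (Λ ⊗ Λ)(Δ(f) (a ⊗ 1))`, that is, by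
`((ω ⊗ id) W*) Λ(f) = Λ((ω ⊗ id) Δ(f))`. -/
def W : HilbertTensor K.L2 K.L2 →L[ℂ] HilbertTensor K.L2 K.L2 :=
  ((K.ΛΛ ∘ₗ galois A).extendOfNorm K.ΛΛ).adjoint

theorem W_adjoint_ΛΛ (t : A ⊗[ℂ] A) : K.W.adjoint (K.ΛΛ t) = K.ΛΛ (galois A t) := by
  rw [W, ContinuousLinearMap.adjoint_adjoint]
  refine LinearMap.extendOfNorm_eq (f := K.ΛΛ ∘ₗ galois A) K.denseRange_ΛΛ ⟨1, fun x => ?_⟩ t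
  have h := K.inner_galois x x
  rw [inner_self_eq_norm_sq_to_K, inner_self_eq_norm_sq_to_K] at h
  have h' : ‖K.ΛΛ (galois A x)‖ ^ 2 = ‖K.ΛΛ x‖ ^ 2 := by exact_mod_cast h
  rw [one_mul]
  exact le_of_eq ((sq_eq_sq₀ (norm_nonneg _) (norm_nonneg _)).mp h')

/-- The group von Neumann algebra `VN(K) = L^∞(K̂)`, generated by the slices `(ω ⊗ id)(W)`. -/
def VN : VonNeumannAlgebra K.L2 :=
  vonNeumannClosure {x | ∃ ξ η : K.L2, x = HilbertTensor.slice K.W ξ η}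

/-- The slice `(ω_{ξ,η} ⊗ id)(W)`, as an element of `VN(K)`. -/
def sliceW (ξ η : K.L2) : K.VN.toStarSubalgebra :=
  ⟨HilbertTensor.slice K.W ξ η, subset_vonNeumannClosure _ ⟨ξ, η, rfl⟩⟩

/-- The bounded sesquilinear form `(ξ, η) ↦ ω((ω_{ξ,η} ⊗ id)(W))`. -/
def fourierForm (ω : StrongDual ℂ K.VN.toStarSubalgebra) : K.L2 →L⋆[ℂ] K.L2 →L[ℂ] ℂ :=
  LinearMap.mkContinuous₂
    (LinearMap.mk₂'ₛₗ (starRingEnd ℂ) (RingHom.id ℂ) (fun ξ η => ω (K.sliceW ξ η))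
      (fun ξ₁ ξ₂ η => by
        rw [← map_add]; congr 1; ext1
        exact HilbertTensor.slice_add_left _ _ _ _)
      (fun c ξ η => by
        rw [← map_smul]; congr 1; ext1
        exact HilbertTensor.slice_smul_left _ _ _ _)
      (fun ξ η₁ η₂ => by
        rw [← map_add]; congr 1; ext1
        exact HilbertTensor.slice_add_right _ _ _ _)
      (fun c ξ η => by
        rw [RingHom.id_apply, ← map_smul]; congr 1; ext1
        exact HilbertTensor.slice_smul_right _ _ _ _))
    (‖ω‖ * ‖K.W‖) (fun ξ η => by
      refine (ω.le_opNorm _).trans ?_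
      have h : ‖K.sliceW ξ η‖ ≤ ‖K.W‖ * ‖ξ‖ * ‖η‖ := HilbertTensor.norm_slice_le K.W ξ η
      calc ‖ω‖ * ‖K.sliceW ξ η‖ ≤ ‖ω‖ * (‖K.W‖ * ‖ξ‖ * ‖η‖) := by gcongr
        _ = ‖ω‖ * ‖K.W‖ * ‖ξ‖ * ‖η‖ := by ring)

theorem fourierForm_apply (ω : StrongDual ℂ K.VN.toStarSubalgebra) (ξ η : K.L2) :
    K.fourierForm ω ξ η = ω (K.sliceW ξ η) := rfl

/-- `(id ⊗ ω)(W) ∈ B(L²(K))` for a bounded functional `ω` on `VN(K)`; it is characterised by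
`⟪ξ, (id ⊗ ω)(W) η⟫ = ω((ω_{ξ,η} ⊗ id)(W))`. -/
def fourier : StrongDual ℂ K.VN.toStarSubalgebra →ₗ[ℂ] (K.L2 →L[ℂ] K.L2) where
  toFun ω := (InnerProductSpace.continuousLinearMapOfBilin (K.fourierForm ω)).adjoint
  map_add' ω₁ ω₂ := by
    refine ContinuousLinearMap.ext fun η => ext_inner_left ℂ fun ξ => ?_
    simp [ContinuousLinearMap.adjoint_inner_right, inner_add_right, fourierForm_apply]
  map_smul' c ω := by
    refine ContinuousLinearMap.ext fun η => ext_inner_left ℂ fun ξ => ?_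
    simp [ContinuousLinearMap.adjoint_inner_right, inner_smul_right, fourierForm_apply]

theorem inner_fourier (ω : StrongDual ℂ K.VN.toStarSubalgebra) (ξ η : K.L2) :
    ⟪ξ, K.fourier ω η⟫_ℂ = ω (K.sliceW ξ η) := by
  simp [fourier, ContinuousLinearMap.adjoint_inner_right, fourierForm_apply]

/-- The comultiplication of `VN(K)`, `Δ̂(x) = Ŵ* (1 ⊗ x) Ŵ` with `Ŵ = Σ W* Σ`. -/
def dualComul (x : K.L2 →L[ℂ] K.L2) :
    HilbertTensor K.L2 K.L2 →L[ℂ] HilbertTensor K.L2 K.L2 :=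
  let What := HilbertTensor.swap K.L2 K.L2 ∘L K.W.adjoint ∘L HilbertTensor.swap K.L2 K.L2
  What.adjoint ∘L HilbertTensor.map (ContinuousLinearMap.id ℂ K.L2) x ∘L What

/-- A weight on the dual of `K`: a strictly positive self-adjoint, densely defined operator `w` on
`L²(K)` with `w⁻¹ ∈ VN(K)` and `w⁻² ⊗ w⁻² ≤ Δ̂(w⁻²)`. -/
structure DualWeight where
  /-- the operator `w` -/
  op : K.L2 →ₗ.[ℂ] K.L2
  dense_domain : Dense (op.domain : Set K.L2)
  isSelfAdjoint : IsSelfAdjoint op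
  strictly_positive : ∀ x : op.domain, (x : K.L2) ≠ 0 → 0 < ⟪(x : K.L2), op x⟫_ℂ
  /-- the bounded inverse `w⁻¹` -/
  inv : K.VN.toStarSubalgebra
  inv_op : ∀ x : op.domain, (inv : K.L2 →L[ℂ] K.L2) (op x) = x
  op_inv : ∀ y : K.L2, ∃ h : (inv : K.L2 →L[ℂ] K.L2) y ∈ op.domain,
    op ⟨(inv : K.L2 →L[ℂ] K.L2) y, h⟩ = y
  comul_le : HilbertTensor.map ((inv : K.L2 →L[ℂ] K.L2) ^ 2) ((inv : K.L2 →L[ℂ] K.L2) ^ 2) ≤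
    K.dualComul ((inv : K.L2 →L[ℂ] K.L2) ^ 2)

namespace DualWeight

variable {K} (w : K.DualWeight)

/-- `w` is central if `w⁻¹` lies in the center of `VN(K)`. -/
def IsCentral : Prop := ∀ x : K.VN.toStarSubalgebra, w.inv * x = x * w.inv

/-- The subspace of `L²(K)` on which the block `End(V(μ))` of `VN(K)` acts. In terms of the matrix
units, `ω^μ_{ij} Λ((u^μ_{kl})*) = δ_{jk} Λ((u^μ_{il})*)`. -/
def _root_.CompactQuantumGroup.block (K : CompactQuantumGroup A) (μ : Irr A) :
    Submodule ℂ K.L2 :=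
  Submodule.span ℂ {ξ | ∃ k l, ξ = K.Λ (star (μ.rep.mat k l))}

/-- The number `w(μ) > 0` for a central weight `w = (w(μ))_μ`: the `μ`-component of `w⁻¹` in
`VN(K) = ℓ^∞-∏ End(V(μ))` is a positive scalar, `w(μ)⁻¹`, which is therefore its norm. -/
def component (μ : Irr A) : ℝ :=
  ‖(w.inv : K.L2 →L[ℂ] K.L2) ∘L (K.block μ).subtypeL‖⁻¹

/-- `w⁻¹ ω`, that is the functional `x ↦ ω(x w⁻¹)` on `VN(K)`. -/
def smulInv : StrongDual ℂ K.VN.toStarSubalgebra →ₗ[ℂ] StrongDual ℂ K.VN.toStarSubalgebra where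
  toFun ω := ω ∘L (ContinuousLinearMap.mul ℂ K.VN.toStarSubalgebra).flip w.inv
  map_add' _ _ := ContinuousLinearMap.add_comp _ _ _
  map_smul' _ _ := ContinuousLinearMap.smul_comp _ _ _

/-- The bijection `ω ↦ (id ⊗ w⁻¹ω)(W)` from the predual `VN(K)_*` onto `A(K,w)`. -/
def fourier : K.VN.predual →ₗ[ℂ] (K.L2 →L[ℂ] K.L2) :=
  K.fourier ∘ₗ w.smulInv ∘ₗ K.VN.predual.subtype

/-- The Beurling-Fourier algebra `A(K,w) = {(id ⊗ w⁻¹ω)(W) | ω ∈ VN(K)_*}`, inside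
`L^∞(K) ⊆ B(L²(K))`. -/
def beurlingFourier : Submodule ℂ (K.L2 →L[ℂ] K.L2) := LinearMap.range w.fourier

/-- The element `(id ⊗ w⁻¹ω)(W)` of `A(K,w)`. -/
def toBeurlingFourier (ω : K.VN.predual) : w.beurlingFourier := ⟨w.fourier ω, ω, rfl⟩

variable {H : Type*} [NormedAddCommGroup H] [InnerProductSpace ℂ H] [CompleteSpace H]

/-- `T : A(K,w) → B(H)` is multiplicative. (That `A(K,w)` is closed under products is part of the
assertion.) -/
def IsMultiplicative (T : w.beurlingFourier →ₗ[ℂ] (H →L[ℂ] H)) : Prop :=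
  ∀ f g : w.beurlingFourier, ∃ h : w.beurlingFourier,
    (h : K.L2 →L[ℂ] K.L2) = (f : K.L2 →L[ℂ] K.L2) * (g : K.L2 →L[ℂ] K.L2) ∧ T h = T f * T g

/-- `T : A(K,w) → B(H)` is completely bounded, for the operator space structure of `A(K,w)` in
which `ω ↦ (id ⊗ w⁻¹ω)(W)` is a complete isometry from the predual `VN(K)_*`. -/
def IsCompletelyBounded (T : w.beurlingFourier →ₗ[ℂ] (H →L[ℂ] H)) : Prop :=
  ∃ C : ℝ, ∀ (n : ℕ) (ω : Fin n → Fin n → K.VN.predual),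
    ‖CStarMatrix.ofMatrix (fun i j => T (w.toBeurlingFourier (ω i j)))‖ ≤
      C * K.VN.predualMatrixNorm ω

/-- `T` extends `θ`: every `a ∈ C^∞(K)`, acting on `L²(K)` by left multiplication, belongs to
`A(K,w)`, and `T` maps it to `θ(a)`. -/
def Extends (T : w.beurlingFourier →ₗ[ℂ] (H →L[ℂ] H)) (θ : A →ₙₐ[ℂ] (H →L[ℂ] H)) : Prop :=
  ∀ a : A, ∃ f : w.beurlingFourier,
    (∀ b : A, (f : K.L2 →L[ℂ] K.L2) (K.Λ b) = K.Λ (a * b)) ∧ T f = θ a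

end DualWeight

section Representations

variable {H : Type*} [NormedAddCommGroup H] [InnerProductSpace ℂ H] [CompleteSpace H]

variable (H) in
/-- The von Neumann algebra tensor product `B(H) ⊗ VN(K)` on `H ⊗ L²(K)`. -/
def boundedTensorVN : VonNeumannAlgebra (HilbertTensor H K.L2) :=
  vonNeumannClosure {T | ∃ (a : H →L[ℂ] H) (x : K.L2 →L[ℂ] K.L2), x ∈ K.VN ∧
    T = HilbertTensor.map a x}

/-- `T` has `μ`-component `X = ∑_{ij} X_{ij} ⊗ ω^μ_{ij} ∈ B(H) ⊗ End(V(μ))`, where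
`ω^μ_{ij} Λ((u^μ_{kl})*) = δ_{jk} Λ((u^μ_{il})*)`. -/
def HasComponent (T : HilbertTensor H K.L2 →L[ℂ] HilbertTensor H K.L2) (μ : Irr A)
    (X : CStarMatrix (Fin μ.rep.dim) (Fin μ.rep.dim) (H →L[ℂ] H)) : Prop :=
  ∀ (h : H) (k l : Fin μ.rep.dim),
    T (HilbertTensor.tmul h (K.Λ (star (μ.rep.mat k l)))) =
      ∑ i, HilbertTensor.tmul (X i k h) (K.Λ (star (μ.rep.mat i l)))

end Representations

end CompactQuantumGroup
end

/-! By Peter–Weyl the coefficients u^μ_{ij} form a basis of C^∞(K), so the vectors Λ((u^μ_{kl})*)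
are total in L²(K), and on them everything is explicit. W sends Λ(a) ⊗ Λ((u_{kl})*) to ∑_m Λ(u_{mk}
a) ⊗ Λ((u_{ml})*), so the slices of W act on the index k alone. Operators acting on l alone lie in
the commutant, and a double commutant argument identifies VN(K) with the bounded operators that act
on every block by a matrix in the index k (`mem_VN_iff_hasBlocks`). A central w⁻¹ is the scalar
w(μ)⁻¹ on the block μ. The predual is the closed span of the coordinate functionals `entry μ i j`,
and ω ↦ (id ⊗ w⁻¹ω)(W) sends w(μ) • `entry μ i j` to u^μ_{ij}. Hence C^∞(K) sits densely in A(K,w)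
through a ↦ ω_a (`DualWeight.toPredual`), and the parametrisation of A(K,w) by the predual is
injective.

From 1 to 3: the matrix (`entry μ i j`)_{ij} has norm at most 1 in M_n(VN(K)_*), because taking the
μ-component is a complete contraction. A completely bounded extension of θ maps this matrix to
w(μ)⁻¹ v_θ^μ, whose norm is therefore bounded uniformly in μ (`bddAbove_of_extends`).

Between 3 and 2: a uniformly bounded family of components assembles to an operator because the
blocks are mutually orthogonal (`exists_hasComponent`), and the double commutant criterion places it
in the von Neumann tensor product. Conversely, each component is dominated in norm by the operator
(`norm_le_of_hasComponent`).

From 2 to 1: if S has the components w(μ)⁻¹ v_θ^μ, then ω ↦ (id ⊗ ω)(S) is completely bounded on the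
predual and sends ω_a to θ(a). It remains to see that A(K,w) is an algebra and that this map is
multiplicative. Both follow from the density of C^∞(K) once ‖ω_{ab}‖ ≤ ‖ω_a‖ ‖ω_b‖ is known
(`norm_toPredual_mul_le`). That is where the weight inequality enters: w⁻² ⊗ w⁻² ≤ Δ̂(w⁻²) gives
‖Δ̂(x)(w⁻¹ ⊗ w⁻¹)‖ ≤ ‖x w⁻¹‖ (`norm_weightedComul_le`), and Δ̂ is dual to the product of C^∞(K). -/

set_option linter.unusedSectionVars false

/-! ### Unitary corepresentations and Schur's lemma -/

noncomputable section UnitaryCorep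

variable {A : Type*} [Ring A] [StarRing A] [HopfAlgebra ℂ A]

/-- A unitary corepresentation matrix. -/
structure IsUnitaryCorep {ι : Type*} [Fintype ι] [DecidableEq ι] (u : Matrix ι ι A) : Prop where
  comul : ∀ i j, Coalgebra.comul (R := ℂ) (u i j) = ∑ k, u i k ⊗ₜ[ℂ] u k j
  unitary : u ∈ unitary (Matrix ι ι A)

theorem IrrMatrix.isUnitaryCorep (u : IrrMatrix A) : IsUnitaryCorep u.mat :=
  ⟨u.comul_mat, u.mat_unitary⟩

namespace IsUnitaryCorep

variable {ι κ : Type*} [Fintype ι] [DecidableEq ι] [Fintype κ] [DecidableEq κ]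
  {u : Matrix ι ι A} {v : Matrix κ κ A}

theorem conjTranspose_mul_self (hu : IsUnitaryCorep u) : u.conjTranspose * u = 1 :=
  Unitary.star_mul_self_of_mem hu.unitary

theorem mul_conjTranspose_self (hu : IsUnitaryCorep u) : u * u.conjTranspose = 1 :=
  Unitary.mul_star_self_of_mem hu.unitary

theorem sum_star_mul (hu : IsUnitaryCorep u) (i j : ι) :
    ∑ k, star (u k i) * u k j = if i = j then 1 else 0 := by
  have := congrFun (congrFun hu.conjTranspose_mul_self i) j
  simpa [Matrix.mul_apply, Matrix.one_apply] using this

theorem sum_mul_star (hu : IsUnitaryCorep u) (i j : ι) :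
    ∑ k, u i k * star (u j k) = if i = j then 1 else 0 := by
  have := congrFun (congrFun hu.mul_conjTranspose_self i) j
  simpa [Matrix.mul_apply, Matrix.one_apply] using this

/-- The counit axiom says that the scalar matrix E = (ε(u_{ij})) satisfies E u = u. As u is
invertible, E = 1 over A, and applying ε again brings this back to ℂ. -/
theorem counit (hu : IsUnitaryCorep u) (i j : ι) :
    Coalgebra.counit (R := ℂ) (u i j) = if i = j then 1 else 0 := by
  have hu' := hu.mul_conjTranspose_self
  set E : Matrix ι ι ℂ := Matrix.of fun i j => Coalgebra.counit (R := ℂ) (u i j) with hE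
  have h : E.map (algebraMap ℂ A) * u = u := by
    ext i j
    have := congrArg (TensorProduct.lid ℂ A) (Coalgebra.rTensor_counit_comul (R := ℂ) (u i j))
    rw [hu.comul] at this
    simpa [Matrix.mul_apply, hE, Algebra.smul_def] using this
  have h2 : E.map (algebraMap ℂ A) = 1 := by
    calc E.map (algebraMap ℂ A) = E.map (algebraMap ℂ A) * u * u.conjTranspose := by
          rw [Matrix.mul_assoc, hu', Matrix.mul_one]
      _ = 1 := by rw [h, hu']
  have h3 := congrArg (Coalgebra.counit (R := ℂ)) (congrFun (congrFun h2 i) j)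
  rw [Matrix.one_apply] at h3
  have h4 : Coalgebra.counit (R := ℂ) (algebraMap ℂ A (E i j)) = E i j := by
    rw [Bialgebra.counit_algebraMap]
  rw [Matrix.map_apply, h4] at h3
  rw [← show E i j = Coalgebra.counit (R := ℂ) (u i j) from rfl, h3]
  split_ifs <;> simp

/-- The antipode axiom makes (S(u_{ij})) a left inverse of u, and u* is the inverse of u. -/
theorem antipode (hu : IsUnitaryCorep u) (i j : ι) :
    HopfAlgebra.antipode ℂ (u i j) = star (u j i) := by
  set E : Matrix ι ι A := Matrix.of fun i j => HopfAlgebra.antipode ℂ (u i j) with hE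
  have h : E * u = 1 := by
    ext i j
    have := HopfAlgebra.mul_antipode_rTensor_comul_apply (R := ℂ) (u i j)
    rw [hu.comul, hu.counit] at this
    simp only [map_sum, LinearMap.rTensor_tmul, LinearMap.mul'_apply] at this
    rw [Matrix.mul_apply, Matrix.one_apply]
    simp only [hE, Matrix.of_apply, this]
    split_ifs <;> simp
  have h2 : E = u.conjTranspose := by
    calc E = E * (u * u.conjTranspose) := by rw [hu.mul_conjTranspose_self, Matrix.mul_one]
      _ = u.conjTranspose := by rw [← Matrix.mul_assoc, h, Matrix.one_mul]
  exact congrFun (congrFun h2 i) j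

/-- Invariance of the Haar state produces matrices fixed by M ↦ u M v* or by M ↦ u* M v; by
unitarity both kinds are intertwiners. -/
theorem intertwiner_of_conj (hv : IsUnitaryCorep v) {M : Matrix ι κ A}
    (h : u * M * v.conjTranspose = M) : u * M = M * v := by
  calc u * M = u * M * (v.conjTranspose * v) := by
        rw [hv.conjTranspose_mul_self, Matrix.mul_one]
    _ = M * v := by rw [← Matrix.mul_assoc, h]

theorem intertwiner_of_conj' (hu : IsUnitaryCorep u) {M : Matrix ι κ A}
    (h : u.conjTranspose * M * v = M) : u * M = M * v := by
  calc u * M = u * (u.conjTranspose * M * v) := by rw [h]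
    _ = (u * u.conjTranspose) * (M * v) := by simp only [Matrix.mul_assoc]
    _ = M * v := by rw [hu.mul_conjTranspose_self, Matrix.one_mul]

variable [StarModule ℂ A]

theorem map_conjTranspose (M : Matrix ι κ ℂ) :
    (M.map (algebraMap ℂ A)).conjTranspose = M.conjTranspose.map (algebraMap ℂ A) := by
  ext i j
  simp only [Matrix.conjTranspose_apply, Matrix.map_apply]
  exact (algebraMap_star_comm (M j i)).symm

/-- Take adjoints of u M = M v and cancel u* and v* by unitarity. In Schur's lemma this makes M*M
and MM* self-intertwiners. -/
theorem intertwiner_conjTranspose (hu : IsUnitaryCorep u) (hv : IsUnitaryCorep v)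
    {M : Matrix ι κ ℂ} (h : u * M.map (algebraMap ℂ A) = M.map (algebraMap ℂ A) * v) :
    v * M.conjTranspose.map (algebraMap ℂ A) = M.conjTranspose.map (algebraMap ℂ A) * u := by
  have h' := congrArg Matrix.conjTranspose h
  rw [Matrix.conjTranspose_mul, Matrix.conjTranspose_mul, map_conjTranspose] at h'
  refine hu.intertwiner_of_conj ?_
  rw [Matrix.mul_assoc, h', ← Matrix.mul_assoc, hv.mul_conjTranspose_self, Matrix.one_mul]

end IsUnitaryCorep

theorem Irr.isUnitaryCorep (μ : Irr A) : IsUnitaryCorep μ.rep.mat := μ.rep.isUnitaryCorep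

theorem Irr.not_equivalent {μ ν : Irr A} (h : μ ≠ ν) : ¬ IrrMatrix.Equivalent μ.rep ν.rep := by
  intro h'
  apply h
  have := Quotient.sound
    (s := (⟨IrrMatrix.Equivalent, IrrMatrix.equivalent_equivalence A⟩ : Setoid (IrrMatrix A))) h'
  exact (Quotient.out_eq μ).symm.trans (this.trans (Quotient.out_eq ν))

variable [StarModule ℂ A]

/-- Schur's lemma for inequivalent irreducible unitary corepresentations. -/
theorem IrrMatrix.intertwiner_eq_zero {u v : IrrMatrix A} (h : ¬ IrrMatrix.Equivalent u v)
    (M : Matrix (Fin v.dim) (Fin u.dim) ℂ)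
    (hM : v.mat * M.map (algebraMap ℂ A) = M.map (algebraMap ℂ A) * u.mat) : M = 0 := by
  have hM' := v.isUnitaryCorep.intertwiner_conjTranspose u.isUnitaryCorep hM
  obtain ⟨c, hc⟩ := u.irreducible (M.conjTranspose * M) (by
    rw [Matrix.map_mul, Matrix.mul_assoc, ← hM, ← Matrix.mul_assoc, ← hM', Matrix.mul_assoc])
  obtain ⟨d, hd⟩ := v.irreducible (M * M.conjTranspose) (by
    rw [Matrix.map_mul, Matrix.mul_assoc, ← hM', ← Matrix.mul_assoc, ← hM, Matrix.mul_assoc])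
  by_contra hne
  -- Both M*M = c and MM* = d are scalar, and M M*M computed in two ways gives c = d because M ≠ 0.
  -- As c > 0, dividing M by √c would make it a unitary equivalence.
  have hcd : c = d := by
    have h1 : c • M = d • M := by
      calc c • M = M * (M.conjTranspose * M) := by rw [hc]; simp
        _ = d • M := by rw [← Matrix.mul_assoc, hd]; simp
    have : (c - d) • M = 0 := by rw [sub_smul, h1, sub_self]
    rcases smul_eq_zero.mp this with h | h
    · exact sub_eq_zero.mp h
    · exact absurd h hne
  have hc0 : c ≠ 0 := by
    rintro rfl
    exact hne (Matrix.conjTranspose_mul_self_eq_zero.mp (by rw [hc, zero_smul]))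
  have hpos : 0 ≤ c := by
    have h1 := (Matrix.posSemidef_conjTranspose_mul_self M).diag_nonneg (i := ⟨0, u.dim_pos⟩)
    rw [hc] at h1
    simpa using h1
  set r : ℝ := Real.sqrt c.re
  have hr : ((r : ℂ)) * r = c := by
    rw [← Complex.ofReal_mul, Real.mul_self_sqrt (Complex.nonneg_iff.mp hpos).1]
    exact (Complex.eq_re_of_ofReal_le (r := 0) (by simpa using hpos)).symm
  have hr0 : (r : ℂ) ≠ 0 := by
    rintro h0; rw [h0] at hr; exact hc0 (by rw [← hr]; simp)
  refine h ⟨(r : ℂ)⁻¹ • M, ?_, ?_, ?_⟩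
  · rw [Matrix.conjTranspose_smul, Matrix.smul_mul, Matrix.mul_smul, hc, ← hr]
    rw [smul_smul, smul_smul]
    convert one_smul ℂ _ using 2
    simp
    field_simp
  · rw [Matrix.conjTranspose_smul, Matrix.smul_mul, Matrix.mul_smul, hd, ← hcd, ← hr]
    rw [smul_smul, smul_smul]
    convert one_smul ℂ _ using 2
    simp
    field_simp
  · have e : ((r : ℂ)⁻¹ • M).map (algebraMap ℂ A) = (r : ℂ)⁻¹ • M.map (algebraMap ℂ A) := by
      ext i j; simp [Algebra.smul_def]
    rw [e, Matrix.smul_mul, Matrix.mul_smul, hM]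

/-! ### Schur orthogonality for the Haar state -/

namespace CompactQuantumGroup

variable (K : CompactQuantumGroup A)

section Corep

variable {ι κ : Type*} [Fintype ι] [DecidableEq ι] [Fintype κ] [DecidableEq κ]
  {u : Matrix ι ι A} {v : Matrix κ κ A}

theorem comul_star_corep (K : CompactQuantumGroup A) (hu : IsUnitaryCorep u) (i j : ι) :
    Coalgebra.comul (R := ℂ) (star (u i j)) = ∑ k, star (u i k) ⊗ₜ[ℂ] star (u k j) := by
  rw [K.comul_star, hu.comul, star_sum]
  simp

/-- Expand Δ(u_{ij} v_{kl}*) in the left invariance (id ⊗ φ)Δ = φ(·)1: for fixed j, l this reads u M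
v* = M. -/
theorem haar_mul_star_intertwiner (hu : IsUnitaryCorep u) (hv : IsUnitaryCorep v) (j : ι) (l : κ) :
    u * (Matrix.of fun i k => K.haar (u i j * star (v k l))).map (algebraMap ℂ A) =
      (Matrix.of fun i k => K.haar (u i j * star (v k l))).map (algebraMap ℂ A) * v := by
  refine hv.intertwiner_of_conj ?_
  ext i k
  have h := K.haar_left (u i j * star (v k l))
  rw [Bialgebra.comul_mul, hu.comul, K.comul_star_corep hv, Finset.sum_mul_sum] at h
  simp only [Algebra.TensorProduct.tmul_mul_tmul, map_sum, LinearMap.lTensor_tmul,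
    TensorProduct.rid_tmul] at h
  simp only [Matrix.mul_apply, Matrix.map_apply, Matrix.of_apply, Matrix.conjTranspose_apply]
  rw [Algebra.algebraMap_eq_smul_one (K.haar _), ← h, Finset.sum_comm]
  refine Finset.sum_congr rfl fun r _ => ?_
  rw [Finset.sum_mul]
  refine Finset.sum_congr rfl fun p _ => ?_
  rw [mul_assoc, Algebra.commutes, ← mul_assoc, ← Algebra.commutes, Algebra.smul_def]

/-- The counterpart for right invariance: with i and k fixed, it reads u* M v = M. -/
theorem haar_star_mul_intertwiner (hu : IsUnitaryCorep u) (hv : IsUnitaryCorep v) (i : ι) (k : κ) :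
    u * (Matrix.of fun j l => K.haar (star (u i j) * v k l)).map (algebraMap ℂ A) =
      (Matrix.of fun j l => K.haar (star (u i j) * v k l)).map (algebraMap ℂ A) * v := by
  refine hu.intertwiner_of_conj' ?_
  ext j l
  have h := K.haar_right (star (u i j) * v k l)
  rw [Bialgebra.comul_mul, hv.comul, K.comul_star_corep hu, Finset.sum_mul_sum] at h
  simp only [Algebra.TensorProduct.tmul_mul_tmul, map_sum, LinearMap.rTensor_tmul,
    TensorProduct.lid_tmul] at h
  simp only [Matrix.mul_apply, Matrix.map_apply, Matrix.of_apply, Matrix.conjTranspose_apply]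
  rw [Algebra.algebraMap_eq_smul_one (K.haar _), ← h, Finset.sum_comm]
  refine Finset.sum_congr rfl fun r _ => ?_
  rw [Finset.sum_mul]
  refine Finset.sum_congr rfl fun p _ => ?_
  rw [← Algebra.commutes, Algebra.smul_def, mul_assoc]

end Corep

theorem haar_mul_star_of_ne {μ ν : Irr A} (h : μ ≠ ν) (i j k l) :
    K.haar (μ.rep.mat i j * star (ν.rep.mat k l)) = 0 :=
  congrFun (congrFun (IrrMatrix.intertwiner_eq_zero (Irr.not_equivalent h.symm) _
    (K.haar_mul_star_intertwiner μ.isUnitaryCorep ν.isUnitaryCorep j l)) i) k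

theorem haar_star_mul_of_ne {μ ν : Irr A} (h : μ ≠ ν) (i j k l) :
    K.haar (star (μ.rep.mat i j) * ν.rep.mat k l) = 0 :=
  congrFun (congrFun (IrrMatrix.intertwiner_eq_zero (Irr.not_equivalent h.symm) _
    (K.haar_star_mul_intertwiner μ.isUnitaryCorep ν.isUnitaryCorep i k)) j) l

/-- The Gram matrix of the rows of `u^μ` with respect to `⟨a, b⟩ = φ(b a*)`. -/
def rowGram (μ : Irr A) : Matrix (Fin μ.rep.dim) (Fin μ.rep.dim) ℂ :=
  Matrix.of fun j l =>
    K.haar (μ.rep.mat ⟨0, μ.rep.dim_pos⟩ j * star (μ.rep.mat ⟨0, μ.rep.dim_pos⟩ l))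

/-- The Gram matrix of the columns of `u^μ` with respect to `⟨a, b⟩ = φ(a* b)`. -/
def colGram (μ : Irr A) : Matrix (Fin μ.rep.dim) (Fin μ.rep.dim) ℂ :=
  Matrix.of fun i k =>
    K.haar (star (μ.rep.mat i ⟨0, μ.rep.dim_pos⟩) * μ.rep.mat k ⟨0, μ.rep.dim_pos⟩)

/-- For fixed j, l the intertwiner is a scalar matrix by irreducibility. The scalar is read off at
its (0,0) entry, which is the row used in `rowGram`. -/
theorem haar_mul_star (μ : Irr A) (i j k l) :
    K.haar (μ.rep.mat i j * star (μ.rep.mat k l)) = if i = k then K.rowGram μ j l else 0 := by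
  obtain ⟨c, hc⟩ := μ.rep.irreducible _
    (K.haar_mul_star_intertwiner μ.isUnitaryCorep μ.isUnitaryCorep j l).symm
  have h : ∀ i k, K.haar (μ.rep.mat i j * star (μ.rep.mat k l)) = if i = k then c else 0 := by
    intro i k
    have := congrFun (congrFun hc i) k
    simpa [Matrix.one_apply] using this
  rw [h, rowGram, Matrix.of_apply, h, if_pos rfl]

theorem haar_star_mul (μ : Irr A) (i j k l) :
    K.haar (star (μ.rep.mat i j) * μ.rep.mat k l) = if j = l then K.colGram μ i k else 0 := by
  obtain ⟨c, hc⟩ := μ.rep.irreducible _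
    (K.haar_star_mul_intertwiner μ.isUnitaryCorep μ.isUnitaryCorep i k).symm
  have h : ∀ j l, K.haar (star (μ.rep.mat i j) * μ.rep.mat k l) = if j = l then c else 0 := by
    intro j l
    have := congrFun (congrFun hc j) l
    simpa [Matrix.one_apply] using this
  rw [h, colGram, Matrix.of_apply, h, if_pos rfl]

/-- If y annihilates the Gram matrix, every combination ∑_l y_l u_{kl} has Haar norm zero and
vanishes by faithfulness. Multiplying by u_{kj}* and summing over k recovers y_j by unitarity. -/
theorem vecMul_rowGram_injective (μ : Irr A) :
    Function.Injective (fun y => Matrix.vecMul y (K.rowGram μ)) := by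
  rw [← Matrix.coe_vecMulLinear, injective_iff_map_eq_zero]
  intro y hy
  have hy' : ∀ l, ∑ j, y j * K.rowGram μ j l = 0 := fun l => congrFun hy l
  have hz : ∀ k, ∑ l, y l • μ.rep.mat k l = 0 := by
    intro k
    rw [← star_eq_zero]
    apply K.haar_faithful
    rw [star_star, star_sum, Finset.sum_mul_sum, Finset.sum_comm, map_sum]
    refine Finset.sum_eq_zero fun l _ => ?_
    rw [map_sum]
    simp only [star_smul, smul_mul_smul_comm, map_smul, K.haar_mul_star, if_true, smul_eq_mul]
    calc ∑ j, y j * star (y l) * K.rowGram μ j l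
        = star (y l) * ∑ j, y j * K.rowGram μ j l := by
          rw [Finset.mul_sum]; exact Finset.sum_congr rfl fun j _ => by ring
      _ = 0 := by rw [hy', mul_zero]
  ext j
  have h : ∑ k, star (μ.rep.mat k j) * ∑ l, y l • μ.rep.mat k l = algebraMap ℂ A (y j) := by
    simp only [Finset.mul_sum, mul_smul_comm]
    rw [Finset.sum_comm]
    simp only [← Finset.smul_sum, μ.isUnitaryCorep.sum_star_mul]
    simp [Algebra.algebraMap_eq_smul_one]
  simp only [hz, mul_zero, Finset.sum_const_zero] at h
  have h1 := congrArg (Coalgebra.counit (R := ℂ)) h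
  rw [Bialgebra.counit_algebraMap, map_zero] at h1
  exact h1.symm

theorem vecMul_colGram_injective (μ : Irr A) :
    Function.Injective (fun y => Matrix.vecMul y (K.colGram μ)) := by
  rw [← Matrix.coe_vecMulLinear, injective_iff_map_eq_zero]
  intro y hy
  have hy' : ∀ l, ∑ j, y j * K.colGram μ j l = 0 := fun l => congrFun hy l
  have hz : ∀ k, ∑ l, star (y l) • μ.rep.mat l k = 0 := by
    intro k
    apply K.haar_faithful
    rw [star_sum, Finset.sum_mul_sum, Finset.sum_comm, map_sum]
    refine Finset.sum_eq_zero fun l _ => ?_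
    rw [map_sum]
    simp only [star_smul, smul_mul_smul_comm, map_smul, K.haar_star_mul, if_true, smul_eq_mul,
      star_star]
    calc ∑ j, y j * star (y l) * K.colGram μ j l
        = star (y l) * ∑ j, y j * K.colGram μ j l := by
          rw [Finset.mul_sum]; exact Finset.sum_congr rfl fun j _ => by ring
      _ = 0 := by rw [hy', mul_zero]
  ext j
  have h : ∑ k, (∑ l, star (y l) • μ.rep.mat l k) * star (μ.rep.mat j k) =
      algebraMap ℂ A (star (y j)) := by
    simp only [Finset.sum_mul, smul_mul_assoc]
    rw [Finset.sum_comm]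
    simp only [← Finset.smul_sum, μ.isUnitaryCorep.sum_mul_star]
    simp [Algebra.algebraMap_eq_smul_one]
  simp only [hz, zero_mul, Finset.sum_const_zero] at h
  have h1 := congrArg (Coalgebra.counit (R := ℂ)) h
  rw [Bialgebra.counit_algebraMap, map_zero] at h1
  simpa using h1.symm

theorem exists_vecMul_eq {n : ℕ} {M : Matrix (Fin n) (Fin n) ℂ}
    (h : Function.Injective (fun y => Matrix.vecMul y M)) (z : Fin n → ℂ) :
    ∃ y, Matrix.vecMul y M = z :=
  (LinearMap.injective_iff_surjective (f := Matrix.vecMulLinear M)).mp h z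

/-- Dual elements for the coefficients `u^μ_{ij}`. -/
theorem exists_haar_star_mul_dual (μ : Irr A) (i j : Fin μ.rep.dim) :
    ∃ a : A, (∀ m k, K.haar (star a * μ.rep.mat m k) = if i = m ∧ j = k then 1 else 0) ∧
      ∀ ν, μ ≠ ν → ∀ m k, K.haar (star a * ν.rep.mat m k) = 0 := by
  obtain ⟨y, hy⟩ := exists_vecMul_eq (K.vecMul_colGram_injective μ) (Pi.single i 1)
  refine ⟨∑ p, star (y p) • μ.rep.mat p j, fun m k => ?_, fun ν hν m k => ?_⟩
  · have h := congrFun hy m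
    simp only [Matrix.vecMul, dotProduct] at h
    simp only [star_sum, star_smul, star_star, Finset.sum_mul, smul_mul_assoc, map_sum, map_smul,
      K.haar_star_mul, smul_eq_mul]
    by_cases hjk : j = k
    · simp [hjk, h, Pi.single_apply, eq_comm]
    · simp [hjk]
  · simp [star_sum, Finset.sum_mul, K.haar_star_mul_of_ne hν]

/-- Dual elements for the coefficients `(u^μ_{pq})*`. -/
theorem exists_haar_mul_star_dual (μ : Irr A) (p q : Fin μ.rep.dim) :
    ∃ a : A, (∀ m l, K.haar (star a * star (μ.rep.mat m l)) = if p = m ∧ q = l then 1 else 0) ∧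
      ∀ ν, μ ≠ ν → ∀ m l, K.haar (star a * star (ν.rep.mat m l)) = 0 := by
  obtain ⟨y, hy⟩ := exists_vecMul_eq (K.vecMul_rowGram_injective μ) (Pi.single q 1)
  refine ⟨star (∑ b, y b • μ.rep.mat p b), fun m l => ?_, fun ν hν m l => ?_⟩
  · have h := congrFun hy l
    simp only [Matrix.vecMul, dotProduct] at h
    simp only [star_star, Finset.sum_mul, smul_mul_assoc, map_sum, map_smul,
      K.haar_mul_star, smul_eq_mul]
    by_cases hjk : p = m
    · simp [hjk, h, Pi.single_apply, eq_comm]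
    · simp [hjk]
  · simp [Finset.sum_mul, K.haar_mul_star_of_ne hν]

/-- Pairing a vanishing combination with the dual elements isolates each of its coefficients. -/
theorem linearIndependent_coeff (K : CompactQuantumGroup A) :
    LinearIndependent ℂ fun x : Σ μ : Irr A, Fin μ.rep.dim × Fin μ.rep.dim =>
      x.1.rep.mat x.2.1 x.2.2 := by
  rw [linearIndependent_iff']
  rintro s g hg ⟨μ, i, j⟩ hx
  obtain ⟨a, ha, ha'⟩ := K.exists_haar_star_mul_dual μ i j
  have h := congrArg (fun b => K.haar (star a * b)) hg
  simp only [Finset.mul_sum, map_sum, mul_smul_comm, map_smul, mul_zero, map_zero,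
    smul_eq_mul] at h
  rw [Finset.sum_eq_single_of_mem _ hx] at h
  · simpa [ha] using h
  · rintro ⟨ν, k, l⟩ _ hne
    by_cases hμ : μ = ν
    · subst hμ
      rw [ha, if_neg, mul_zero]
      rintro ⟨rfl, rfl⟩
      exact hne rfl
    · rw [ha' ν hμ, mul_zero]

end CompactQuantumGroup

end UnitaryCorep

/-! ### Complete reducibility of unitary corepresentations -/

noncomputable section PeterWeyl

variable {A : Type*} [Ring A] [StarRing A] [HopfAlgebra ℂ A]

theorem Matrix.map_algebraMap_map {ι κ B C : Type*} [Ring B] [Algebra ℂ B] [Ring C] [Algebra ℂ C]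
    (M : Matrix ι κ ℂ) (f : B →ₐ[ℂ] C) :
    (M.map (algebraMap ℂ B)).map f = M.map (algebraMap ℂ C) := by
  ext i j
  simp

theorem Matrix.map_algebraMap_mul_eq_one {ι κ B : Type*} [Fintype κ] [DecidableEq ι]
    [Ring B] [Algebra ℂ B] {M : Matrix ι κ ℂ} {N : Matrix κ ι ℂ} (h : M * N = 1) :
    M.map (algebraMap ℂ B) * N.map (algebraMap ℂ B) = 1 := by
  rw [← Matrix.map_mul, h, Matrix.map_one _ (map_zero _) (map_one _)]

/-- Comultiplicativity as one matrix identity over A ⊗ A, Δ(u) = (u ⊗ 1)(1 ⊗ u), so that conjugation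
by scalar matrices becomes plain matrix algebra. -/
theorem comul_iff_map_comul {ι : Type*} [Fintype ι] {u : Matrix ι ι A} :
    (∀ i j, Coalgebra.comul (R := ℂ) (u i j) = ∑ k, u i k ⊗ₜ[ℂ] u k j) ↔
      u.map (Bialgebra.comulAlgHom ℂ A) =
        u.map (Algebra.TensorProduct.includeLeft : A →ₐ[ℂ] A ⊗[ℂ] A) *
          u.map (Algebra.TensorProduct.includeRight : A →ₐ[ℂ] A ⊗[ℂ] A) := by
  constructor
  · intro h
    ext i j
    simp [Matrix.mul_apply, h]
  · intro h i j
    have := congrFun (congrFun h i) j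
    simpa [Matrix.mul_apply] using this

variable [StarModule ℂ A]

theorem IsUnitaryCorep.conj {ι : Type*} [Fintype ι] [DecidableEq ι] {u : Matrix ι ι A}
    (hu : IsUnitaryCorep u) {U : Matrix ι ι ℂ} (h1 : U.conjTranspose * U = 1)
    (h2 : U * U.conjTranspose = 1) :
    IsUnitaryCorep (U.conjTranspose.map (algebraMap ℂ A) * u * U.map (algebraMap ℂ A)) where
  comul := by
    rw [comul_iff_map_comul]
    have h := comul_iff_map_comul.mp hu.comul
    simp only [Matrix.map_mul, Matrix.map_algebraMap_map, h]
    have e := Matrix.map_algebraMap_mul_eq_one (B := A ⊗[ℂ] A) h2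
    simp only [Matrix.mul_assoc]
    rw [← Matrix.mul_assoc (U.map _) (U.conjTranspose.map _), e, Matrix.one_mul]
  unitary := by
    have e1 := Matrix.map_algebraMap_mul_eq_one (B := A) h1
    have e2 := Matrix.map_algebraMap_mul_eq_one (B := A) h2
    rw [Unitary.mem_iff]
    simp only [Matrix.star_eq_conjTranspose, Matrix.conjTranspose_mul,
      IsUnitaryCorep.map_conjTranspose, Matrix.conjTranspose_conjTranspose, Matrix.mul_assoc]
    constructor
    · rw [← Matrix.mul_assoc (U.map _) (U.conjTranspose.map _), e2, Matrix.one_mul,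
        ← Matrix.mul_assoc u.conjTranspose, hu.conjTranspose_mul_self, Matrix.one_mul, e1]
    · rw [← Matrix.mul_assoc (U.map _) (U.conjTranspose.map _), e2, Matrix.one_mul,
        ← Matrix.mul_assoc u, hu.mul_conjTranspose_self, Matrix.one_mul, e1]

theorem IsUnitaryCorep.submatrix_equiv {ι κ : Type*} [Fintype ι] [DecidableEq ι] [Fintype κ]
    [DecidableEq κ] {u : Matrix ι ι A} (hu : IsUnitaryCorep u) (e : κ ≃ ι) :
    IsUnitaryCorep (u.submatrix e e) where
  comul i j := by
    simp only [Matrix.submatrix_apply, hu.comul]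
    exact (Equiv.sum_comp e fun k => u (e i) k ⊗ₜ[ℂ] u k (e j)).symm
  unitary := by
    rw [Unitary.mem_iff]
    simp only [Matrix.star_eq_conjTranspose, Matrix.conjTranspose_submatrix,
      Matrix.submatrix_mul_equiv, hu.conjTranspose_mul_self, hu.mul_conjTranspose_self]
    simp

theorem Fintype.sum_subtype_of_forall_not {ι M : Type*} [Fintype ι] [AddCommMonoid M] (p : ι → Prop)
    [DecidablePred p] {f : ι → M} (h : ∀ k, ¬ p k → f k = 0) :
    ∑ k : {k // p k}, f k = ∑ k, f k := by
  rw [← Finset.sum_subtype (Finset.univ.filter p) (by simp) f]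
  exact Finset.sum_filter_of_ne fun k _ hk => by_contra fun hp => hk (h k hp)

/-- A union of diagonal blocks of a block diagonal unitary corepresentation. -/
theorem IsUnitaryCorep.submatrix_block {ι : Type*} [Fintype ι] [DecidableEq ι]
    {u : Matrix ι ι A} (hu : IsUnitaryCorep u) (p : ι → Prop) [DecidablePred p]
    (h : ∀ i j, (p i ↔ ¬ p j) → u i j = 0) :
    IsUnitaryCorep (u.submatrix ((↑) : {i // p i} → ι) (↑)) where
  comul i j := by
    simp only [Matrix.submatrix_apply, hu.comul]
    exact (Fintype.sum_subtype_of_forall_not p (f := fun k => u i k ⊗ₜ[ℂ] u k j)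
      fun k hk => by rw [h i k (by simp [hk, i.2]), TensorProduct.zero_tmul]).symm
  unitary := by
    rw [Unitary.mem_iff]
    constructor <;> ext i j
    · have h1 := hu.sum_star_mul i j
      rw [← Fintype.sum_subtype_of_forall_not p
        (fun k hk => by rw [h k j (by simp [hk, j.2]), mul_zero])] at h1
      simp only [Matrix.star_eq_conjTranspose, Matrix.mul_apply, Matrix.conjTranspose_apply,
        Matrix.submatrix_apply, h1, Matrix.one_apply, Subtype.ext_iff]
    · have h1 := hu.sum_mul_star i j
      rw [← Fintype.sum_subtype_of_forall_not p
        (fun k hk => by rw [h i k (by simp [hk, i.2]), zero_mul])] at h1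
      simp only [Matrix.star_eq_conjTranspose, Matrix.mul_apply, Matrix.conjTranspose_apply,
        Matrix.submatrix_apply, h1, Matrix.one_apply, Subtype.ext_iff]

/-- The span of the coefficients of the irreducible unitary corepresentations. -/
def coeffSpan (A : Type*) [Ring A] [StarRing A] [HopfAlgebra ℂ A] : Submodule ℂ A :=
  Submodule.span ℂ (Set.range fun x : Σ μ : Irr A, Fin μ.rep.dim × Fin μ.rep.dim =>
      x.1.rep.mat x.2.1 x.2.2)

theorem map_algebraMap_mul_mul_mem {ι κ : Type*} [Fintype κ] (S : Submodule ℂ A)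
    {u : Matrix κ κ A} (hu : ∀ i j, u i j ∈ S) (M : Matrix ι κ ℂ) (N : Matrix κ ι ℂ) (i j : ι) :
    (M.map (algebraMap ℂ A) * u * N.map (algebraMap ℂ A)) i j ∈ S := by
  simp only [Matrix.mul_apply, Matrix.map_apply]
  refine Submodule.sum_mem _ fun k _ => ?_
  rw [← Algebra.commutes, ← Algebra.smul_def]
  refine Submodule.smul_mem _ _ (Submodule.sum_mem _ fun l _ => ?_)
  rw [← Algebra.smul_def]
  exact Submodule.smul_mem _ _ (hu _ _)

/-- An irreducible matrix is conjugate, by a scalar unitary, to the chosen representative of its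
class. -/
theorem IrrMatrix.mem_coeffSpan (u : IrrMatrix A) (i j) : u.mat i j ∈ coeffSpan A := by
  let s : Setoid (IrrMatrix A) := ⟨IrrMatrix.Equivalent, IrrMatrix.equivalent_equivalence A⟩
  let μ : Irr A := Quotient.mk s u
  obtain ⟨T, h1, h2, h3⟩ : IrrMatrix.Equivalent μ.rep u :=
    Quotient.exact (s := s) (Quotient.out_eq (s := s) μ)
  have e := Matrix.map_algebraMap_mul_eq_one (B := A) h2
  have : u.mat = T.map (algebraMap ℂ A) * μ.rep.mat * T.conjTranspose.map (algebraMap ℂ A) := by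
    rw [h3, Matrix.mul_assoc, e, Matrix.mul_one]
  rw [this]
  exact map_algebraMap_mul_mul_mem (coeffSpan A) (u := μ.rep.mat)
    (fun i j => Submodule.subset_span ⟨⟨μ, i, j⟩, rfl⟩) _ _ _ _

/-- Complete reducibility of unitary corepresentations. -/
theorem IsUnitaryCorep.mem_coeffSpan {ι : Type} [Fintype ι] [DecidableEq ι] {u : Matrix ι ι A}
    (hu : IsUnitaryCorep u) (i j : ι) : u i j ∈ coeffSpan A := by
  induction hn : Fintype.card ι using Nat.strong_induction_on generalizing ι with
  | _ n ih =>
  by_cases hirr : ∀ T : Matrix ι ι ℂ,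
    T.map (algebraMap ℂ A) * u = u * T.map (algebraMap ℂ A) → ∃ c : ℂ, T = c • (1 : Matrix ι ι ℂ)
  · let e : Fin n ≃ ι := (Fintype.equivFinOfCardEq hn).symm
    have hu' := hu.submatrix_equiv e
    let v : IrrMatrix A :=
      { dim := n
        mat := u.submatrix e e
        dim_pos := hn ▸ Fintype.card_pos_iff.mpr ⟨i⟩
        comul_mat := hu'.comul
        mat_unitary := hu'.unitary
        irreducible := fun T hT => by
          obtain ⟨c, hc⟩ := hirr (T.submatrix e.symm e.symm) (by
            have h := congrArg (fun M => M.submatrix e.symm e.symm) hT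
            simp only [← Matrix.submatrix_mul_equiv _ _ e.symm e.symm e.symm,
              Matrix.submatrix_submatrix] at h
            simpa [Matrix.submatrix_map] using h)
          refine ⟨c, ?_⟩
          have h := congrArg (fun M => M.submatrix e e) hc
          simpa [Matrix.submatrix_submatrix, Matrix.submatrix_smul] using h }
    simpa [v] using v.mem_coeffSpan (e.symm i) (e.symm j)
  · push Not at hirr
    obtain ⟨T₀, hT₀, hT₀'⟩ := hirr
    -- The adjoint of an intertwiner is again one, so T₀ + T₀* and i(T₀ − T₀*) are Hermitian
    -- intertwiners. If both were scalar, T₀ would be scalar as well.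
    obtain ⟨T, hT, hTc, hTn⟩ : ∃ T : Matrix ι ι ℂ, T.IsHermitian ∧
        T.map (algebraMap ℂ A) * u = u * T.map (algebraMap ℂ A) ∧
        ∀ c : ℂ, T ≠ c • (1 : Matrix ι ι ℂ) := by
      have hs := (hu.intertwiner_conjTranspose hu hT₀.symm).symm
      by_contra hcon
      push Not at hcon
      have e : ∀ M N : Matrix ι ι ℂ, (M + N).map (algebraMap ℂ A) =
          M.map (algebraMap ℂ A) + N.map (algebraMap ℂ A) := fun M N => by ext; simp
      have e' : ∀ (c : ℂ) (M : Matrix ι ι ℂ), (c • M).map (algebraMap ℂ A) =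
          c • M.map (algebraMap ℂ A) := fun c N => by
          ext i j; simp only [Matrix.map_apply, Matrix.smul_apply, smul_eq_mul, map_mul, Algebra.smul_def (A := A)]
      obtain ⟨c, hc⟩ := hcon (T₀ + T₀.conjTranspose) (Matrix.isHermitian_add_transpose_self _)
        (by rw [e, Matrix.add_mul, Matrix.mul_add, hT₀, hs])
      obtain ⟨d, hd⟩ := hcon (Complex.I • T₀ + (-Complex.I) • T₀.conjTranspose)
        (by
          rw [Matrix.IsHermitian, Matrix.conjTranspose_add, Matrix.conjTranspose_smul,
            Matrix.conjTranspose_smul, Matrix.conjTranspose_conjTranspose, add_comm]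
          simp)
        (by rw [e, e', e', Matrix.add_mul, Matrix.mul_add, Matrix.smul_mul, Matrix.smul_mul,
              Matrix.mul_smul, Matrix.mul_smul, hT₀, hs])
      refine hT₀' ((2 : ℂ)⁻¹ * (c - Complex.I * d)) ?_
      have : (2 : ℂ) • T₀ = (T₀ + T₀.conjTranspose) -
          Complex.I • (Complex.I • T₀ + (-Complex.I) • T₀.conjTranspose) := by
        rw [smul_add, smul_smul, smul_smul]
        simp [two_smul]
      rw [hc, hd, smul_smul, ← sub_smul] at this
      rw [mul_smul, ← this, smul_smul]
      norm_num
    set U : Matrix ι ι ℂ := (hT.eigenvectorUnitary : Matrix ι ι ℂ) with hU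
    have hU1 : U.conjTranspose * U = 1 := Unitary.coe_star_mul_self hT.eigenvectorUnitary
    have hU2 : U * U.conjTranspose = 1 := Unitary.coe_mul_star_self hT.eigenvectorUnitary
    set D : Matrix ι ι ℂ := Matrix.diagonal fun i => (hT.eigenvalues i : ℂ) with hD
    have hspec : T = U * D * U.conjTranspose := by
      have := hT.spectral_theorem
      rw [Unitary.conjStarAlgAut_apply] at this
      exact this
    have hv := hu.conj hU1 hU2
    set v := U.conjTranspose.map (algebraMap ℂ A) * u * U.map (algebraMap ℂ A) with hvdef
    have e1 := Matrix.map_algebraMap_mul_eq_one (B := A) hU1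
    have e2 := Matrix.map_algebraMap_mul_eq_one (B := A) hU2
    have huv : u = U.map (algebraMap ℂ A) * v * U.conjTranspose.map (algebraMap ℂ A) := by
      rw [hvdef]
      simp only [Matrix.mul_assoc]
      rw [e2, Matrix.mul_one, ← Matrix.mul_assoc, e2, Matrix.one_mul]
    have hDv : D.map (algebraMap ℂ A) * v = v * D.map (algebraMap ℂ A) := by
      have hD' : D = U.conjTranspose * T * U := by
        rw [hspec]
        simp only [Matrix.mul_assoc]
        rw [hU1, Matrix.mul_one, ← Matrix.mul_assoc, hU1, Matrix.one_mul]
      rw [hD', Matrix.map_mul, Matrix.map_mul, hvdef]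
      simp only [Matrix.mul_assoc]
      rw [← Matrix.mul_assoc (U.map _) (U.conjTranspose.map _), e2, Matrix.one_mul,
        ← Matrix.mul_assoc (U.map _) (U.conjTranspose.map _), e2, Matrix.one_mul,
        ← Matrix.mul_assoc (T.map _), hTc, Matrix.mul_assoc]
    -- After diagonalisation, D v = v D reads λ_i v_{ij} = λ_j v_{ij}, so v is block diagonal along
    -- the eigenspaces of T.
    have hzero : ∀ i j, hT.eigenvalues i ≠ hT.eigenvalues j → v i j = 0 := by
      intro i j hij
      have h := congrFun (congrFun hDv i) j
      rw [hD, Matrix.diagonal_map (map_zero _), Matrix.diagonal_mul, Matrix.mul_diagonal,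
        ← Algebra.commutes, ← Algebra.smul_def, ← Algebra.smul_def, ← sub_eq_zero,
        ← sub_smul, smul_eq_zero] at h
      rcases h with h | h
      · exact absurd (by exact_mod_cast sub_eq_zero.mp h) hij
      · exact h
    have hvmem : ∀ i j, v i j ∈ coeffSpan A := by
      intro i j
      by_cases hij : hT.eigenvalues i = hT.eigenvalues j
      swap
      · rw [hzero i j hij]; exact Submodule.zero_mem _
      have hblock := hv.submatrix_block (fun k => hT.eigenvalues k = hT.eigenvalues i)
        (fun k l hkl => hzero k l (by grind))
      refine ih _ ?_ hblock ⟨i, rfl⟩ ⟨j, hij.symm⟩ rfl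
      rw [← hn]
      -- Since T is not scalar, another eigenvalue exists. The eigenvalue block of i is therefore
      -- strictly smaller than ι, and the induction applies to it.
      obtain ⟨k, hk⟩ : ∃ k, hT.eigenvalues k ≠ hT.eigenvalues i := by
        by_contra hcon
        push Not at hcon
        refine hTn (hT.eigenvalues i) ?_
        have : D = (hT.eigenvalues i : ℂ) • (1 : Matrix ι ι ℂ) := by
          rw [hD, ← Matrix.diagonal_one, ← Matrix.diagonal_smul]
          congr 1
          ext k
          simp [hcon k]
        refine hspec.trans ?_
        rw [this, Matrix.mul_smul, Matrix.smul_mul, Matrix.mul_one, hU2]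
      exact Fintype.card_subtype_lt (x := k) hk
    rw [huv]
    exact map_algebraMap_mul_mul_mem _ hvmem _ _ _ _

end PeterWeyl

/-! ### The Peter–Weyl theorem -/

noncomputable section PeterWeyl

variable {A : Type*} [Ring A] [StarRing A] [HopfAlgebra ℂ A] [StarModule ℂ A]

/-- Every element of a coalgebra lies in a finite dimensional right subcomodule. -/
theorem exists_finite_subcomodule {C : Type*} [AddCommGroup C] [Module ℂ C] [Coalgebra ℂ C]
    (a : C) : ∃ (s : Type) (_ : Fintype s) (x : s → C) (c : s → s → C),
      a ∈ Submodule.span ℂ (Set.range x) ∧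
      ∀ k, Coalgebra.comul (R := ℂ) (x k) = ∑ j, x j ⊗ₜ[ℂ] c j k := by
  classical
  let b := Module.Basis.ofVectorSpace ℂ C
  obtain ⟨x, hx⟩ := TensorProduct.eq_repr_basis_right b (Coalgebra.comul (R := ℂ) a)
  have hx' : Coalgebra.comul (R := ℂ) a = ∑ k : x.support, x k ⊗ₜ[ℂ] b k := by
    rw [← hx, Finsupp.sum, ← Finset.sum_coe_sort]
  let e : x.support ≃ Fin (x.support.card) := x.support.equivFin
  -- G k = id ⊗ b_k* contracts the last leg with a basis coordinate. Writing Δ(a) = ∑ x_k ⊗ b_k,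
  -- coassociativity contracted in this way gives Δ(x_k) = ∑_j x_j ⊗ G_k(Δ(b_j)), and the counit
  -- gives a = ∑ ε(b_k) x_k.
  let G : x.support → (C ⊗[ℂ] C →ₗ[ℂ] C) := fun k =>
    (TensorProduct.rid ℂ C).toLinearMap ∘ₗ (b.coord k).lTensor C
  have hG : ∀ (k : x.support) (t : C ⊗[ℂ] C) (y : C),
      (G k).lTensor C (TensorProduct.assoc ℂ C C C (t ⊗ₜ y)) = b.coord k y • t := by
    intro k t y
    induction t with
    | zero => simp
    | add p q hp hq => rw [TensorProduct.add_tmul, map_add, map_add, hp, hq, smul_add]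
    | tmul p q => simp [G, TensorProduct.tmul_smul]
  have hc : ∀ k : x.support, Coalgebra.comul (R := ℂ) (x k) =
      ∑ j : x.support, x j ⊗ₜ[ℂ] G k (Coalgebra.comul (R := ℂ) (b j)) := by
    intro k
    have h := congrArg ((G k).lTensor C) (Coalgebra.coassoc_apply (R := ℂ) a)
    rw [hx'] at h
    simp only [map_sum, LinearMap.rTensor_tmul, LinearMap.lTensor_tmul, hG] at h
    rw [← h, Finset.sum_eq_single k]
    · simp
    · intro j _ hj
      have : j.1 ≠ k.1 := fun h => hj (Subtype.ext h)
      simp [this]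
    · simp
  refine ⟨Fin x.support.card, inferInstance, fun k => x (e.symm k), fun j k =>
    G (e.symm k) (Coalgebra.comul (R := ℂ) (b (e.symm j))), ?_, fun k => ?_⟩
  · have h := congrArg (TensorProduct.rid ℂ C) (Coalgebra.lTensor_counit_comul (R := ℂ) a)
    rw [hx'] at h
    simp only [map_sum, LinearMap.lTensor_tmul, TensorProduct.rid_tmul, one_smul] at h
    rw [← h]
    refine Submodule.sum_mem _ fun k _ => Submodule.smul_mem _ _ (Submodule.subset_span ⟨e k, ?_⟩)
    simp
  · rw [hc]
    exact (Equiv.sum_comp e.symm fun j : x.support =>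
      x j ⊗ₜ[ℂ] G (e.symm k) (Coalgebra.comul (R := ℂ) (b j))).symm

namespace CompactQuantumGroup

variable (K : CompactQuantumGroup A)

/-- Right invariance applied to e_j* e_l gives d*d = 1, while the antipode provides a right inverse
of d; hence d* is a two-sided inverse. Comultiplicativity of d is coassociativity at e_j, paired in
the first leg with e_i. -/
theorem isUnitaryCorep_of_orthonormal {ι : Type*} [Fintype ι] [DecidableEq ι] {e : ι → A}
    (he : ∀ i j, K.haar (star (e i) * e j) = if i = j then 1 else 0) {d : Matrix ι ι A}
    (hd : ∀ j, Coalgebra.comul (R := ℂ) (e j) = ∑ i, e i ⊗ₜ[ℂ] d i j) :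
    IsUnitaryCorep d := by
  have hcomul : ∀ i j, Coalgebra.comul (R := ℂ) (d i j) = ∑ k, d i k ⊗ₜ[ℂ] d k j := by
    intro i j
    have h := Coalgebra.coassoc_apply (R := ℂ) (e j)
    let f : A →ₗ[ℂ] ℂ := K.haar ∘ₗ LinearMap.mulLeft ℂ (star (e i))
    have h' := congrArg (fun t => TensorProduct.lid ℂ (A ⊗[ℂ] A) (f.rTensor (A ⊗[ℂ] A) t)) h
    simp only [hd, map_sum, LinearMap.rTensor_tmul, LinearMap.lTensor_tmul,
      TensorProduct.sum_tmul, TensorProduct.assoc_tmul, TensorProduct.lid_tmul] at h'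
    simp only [f, LinearMap.comp_apply, LinearMap.mulLeft_apply, he, ite_smul, one_smul, zero_smul,
      Finset.sum_ite_eq, Finset.mem_univ, if_true] at h'
    exact h'.symm
  have hcounit : ∀ i j, Coalgebra.counit (R := ℂ) (d i j) = if i = j then 1 else 0 := by
    intro i j
    have h := congrArg (TensorProduct.rid ℂ A) (Coalgebra.lTensor_counit_comul (R := ℂ) (e j))
    rw [hd] at h
    simp only [map_sum, LinearMap.lTensor_tmul, TensorProduct.rid_tmul, one_smul] at h
    have h' := congrArg (fun a => K.haar (star (e i) * a)) h
    simpa [Finset.mul_sum, he] using h'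
  have h1 : d.conjTranspose * d = 1 := by
    ext j l
    have h := K.haar_right (star (e j) * e l)
    rw [Bialgebra.comul_mul, K.comul_star, hd, hd, star_sum, Finset.sum_mul_sum] at h
    simp only [TensorProduct.star_tmul, Algebra.TensorProduct.tmul_mul_tmul, map_sum,
      LinearMap.rTensor_tmul, TensorProduct.lid_tmul, he, ite_smul, one_smul, zero_smul,
      Finset.sum_ite_eq, Finset.mem_univ, if_true] at h
    rw [Matrix.mul_apply, Matrix.one_apply]
    simpa using h
  have h2 : d * (Matrix.of fun i j => HopfAlgebra.antipode ℂ (d i j)) = 1 := by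
    ext i j
    have := HopfAlgebra.mul_antipode_lTensor_comul_apply (R := ℂ) (d i j)
    rw [hcomul, hcounit] at this
    simp only [map_sum, LinearMap.lTensor_tmul, LinearMap.mul'_apply] at this
    rw [Matrix.mul_apply, Matrix.one_apply]
    simp only [Matrix.of_apply, this]
    split_ifs <;> simp
  refine ⟨hcomul, Unitary.mem_iff.mpr ⟨h1, ?_⟩⟩
  have h3 : star d = Matrix.of fun i j => HopfAlgebra.antipode ℂ (d i j) := by
    calc star d = star d * (d * (Matrix.of fun i j => HopfAlgebra.antipode ℂ (d i j))) := by
          rw [h2, Matrix.mul_one]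
      _ = _ := by rw [← Matrix.mul_assoc, Matrix.star_eq_conjTranspose, h1, Matrix.one_mul]
  rw [h3, h2]

/-- The Peter–Weyl theorem: the coefficients of the irreducible unitary corepresentations
span `C^∞(K)`. -/
theorem coeffSpan_eq_top (K : CompactQuantumGroup A) : coeffSpan A = ⊤ := by
  rw [Submodule.eq_top_iff']
  intro a
  obtain ⟨s, _, x, c, ha, hx⟩ := exists_finite_subcomodule a
  let V : Submodule ℂ K.Pre := Submodule.span ℂ (Set.range fun k => K.toPre (x k))
  have hVfin : FiniteDimensional ℂ V := FiniteDimensional.span_of_finite ℂ (Set.finite_range _)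
  let o := stdOrthonormalBasis ℂ V
  let e : Fin (Module.finrank ℂ V) → A := fun i => K.toPre.symm (o i : K.Pre)
  have he : ∀ i j, K.haar (star (e i) * e j) = if i = j then 1 else 0 := by
    intro i j
    have := orthonormal_iff_ite.mp o.orthonormal i j
    rw [← this]
    rfl
  have hexp : ∀ v : V, K.toPre.symm (v : K.Pre) =
      ∑ i, K.haar (star (e i) * K.toPre.symm (v : K.Pre)) • e i := by
    intro v
    have h := congrArg (fun w : V => K.toPre.symm (w : K.Pre)) (o.sum_repr' v)
    simp only [Submodule.coe_sum, map_sum, Submodule.coe_smul, map_smul] at h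
    exact h.symm
  let F : (Fin (Module.finrank ℂ V) → A) →ₗ[ℂ] A ⊗[ℂ] A :=
    ∑ i, (TensorProduct.mk ℂ A A (e i)) ∘ₗ LinearMap.proj i
  have hF : ∀ d, F d = ∑ i, e i ⊗ₜ[ℂ] d i := fun d => by simp [F]
  have hxV : ∀ k, K.toPre (x k) ∈ V := fun k => Submodule.subset_span ⟨k, rfl⟩
  -- Δ maps V into V ⊗ A. In the orthonormal basis e this yields the coefficient matrix d, to which
  -- unitarity is then applied.
  have hV : V ≤ (LinearMap.range F).comap
      (Coalgebra.comul (R := ℂ) ∘ₗ K.toPre.symm.toLinearMap) := by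
    refine Submodule.span_le.mpr ?_
    rintro _ ⟨k, rfl⟩
    change Coalgebra.comul (R := ℂ) (x k) ∈ LinearMap.range F
    rw [hx]
    refine Submodule.sum_mem _ fun j _ => ?_
    refine ⟨fun i => K.haar (star (e i) * x j) • c j k, ?_⟩
    rw [hF]
    conv_rhs => rw [show x j = K.toPre.symm ((⟨K.toPre (x j), hxV j⟩ : V) : K.Pre) from rfl,
      hexp, TensorProduct.sum_tmul]
    refine Finset.sum_congr rfl fun i _ => ?_
    rw [TensorProduct.tmul_smul, TensorProduct.smul_tmul']
    rfl
  choose d hd using fun i => hV (o i).2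
  have hd' : ∀ j, Coalgebra.comul (R := ℂ) (e j) = ∑ i, e i ⊗ₜ[ℂ] d j i := fun j => by
    rw [← hF, hd]; rfl
  have hcorep := K.isUnitaryCorep_of_orthonormal he (d := Matrix.of fun i j => d j i) hd'
  -- The counit in the first leg gives e_j = ∑_i ε(e_i) d_{ij}, a combination of coefficients of a
  -- unitary corepresentation.
  have heS : ∀ j, e j ∈ coeffSpan A := by
    intro j
    have h := congrArg (TensorProduct.lid ℂ A) (Coalgebra.rTensor_counit_comul (R := ℂ) (e j))
    rw [hd'] at h
    simp only [map_sum, LinearMap.rTensor_tmul, TensorProduct.lid_tmul, one_smul] at h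
    rw [← h]
    exact Submodule.sum_mem _ fun i _ => Submodule.smul_mem _ _ (hcorep.mem_coeffSpan i j)
  have haV : K.toPre a ∈ V := by
    have : V = (Submodule.span ℂ (Set.range x)).map K.toPre.toLinearMap := by
      rw [Submodule.map_span, ← Set.range_comp]; rfl
    rw [this]
    exact ⟨a, ha, rfl⟩
  have := hexp ⟨K.toPre a, haV⟩
  rw [LinearEquiv.symm_apply_apply] at this
  rw [this]
  exact Submodule.sum_mem _ fun i _ => Submodule.smul_mem _ _ (heS i)

/-- The basis of `C^∞(K)` given by the coefficients of the irreducible corepresentations. -/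
def coeffBasis : Module.Basis (Σ μ : Irr A, Fin μ.rep.dim × Fin μ.rep.dim) ℂ A :=
  Module.Basis.mk K.linearIndependent_coeff (K.coeffSpan_eq_top).ge

theorem coeffBasis_apply (μ : Irr A) (i j : Fin μ.rep.dim) :
    K.coeffBasis ⟨μ, i, j⟩ = μ.rep.mat i j := by
  exact Module.Basis.mk_apply _ _ _

/-- Two linear maps on `C^∞(K)` that agree on the coefficients are equal. -/
theorem linearMap_ext {M : Type*} [AddCommGroup M] [Module ℂ M] (K : CompactQuantumGroup A)
    {f g : A →ₗ[ℂ] M}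
    (h : ∀ (μ : Irr A) (i j : Fin μ.rep.dim), f (μ.rep.mat i j) = g (μ.rep.mat i j)) : f = g :=
  K.coeffBasis.ext fun ⟨μ, i, j⟩ => by rw [coeffBasis_apply]; exact h μ i j

end CompactQuantumGroup

end PeterWeyl

/-! ### The C*-norm of a matrix as the norm of a sesquilinear form -/

noncomputable section CStarMatrixNorm

variable {n : Type*} [Fintype n] [DecidableEq n] {B : Type*} [CStarAlgebra B]
  [PartialOrder B] [StarOrderedRing B]
  {E : Type*} [NormedAddCommGroup E] [InnerProductSpace ℂ E] [CompleteSpace E]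

/-- A matrix over a represented C*-algebra, as an operator on `Eⁿ`. -/
def CStarMatrix.toOp (π : B →⋆ₙₐ[ℂ] (E →L[ℂ] E)) (M : CStarMatrix n n B) :
    PiLp 2 (fun _ : n => E) →L[ℂ] PiLp 2 (fun _ : n => E) :=
  (PiLp.continuousLinearEquiv 2 ℂ (fun _ : n => E)).symm.toContinuousLinearMap ∘L
    ContinuousLinearMap.pi fun i => ∑ j, π (M i j) ∘L PiLp.proj 2 (fun _ : n => E) j

theorem CStarMatrix.toOp_apply (π : B →⋆ₙₐ[ℂ] (E →L[ℂ] E)) (M : CStarMatrix n n B)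
    (v : PiLp 2 (fun _ : n => E)) (i : n) :
    CStarMatrix.toOp π M v i = ∑ j, π (M i j) (v j) := by
  simp [CStarMatrix.toOp]

theorem CStarMatrix.inner_toOp (π : B →⋆ₙₐ[ℂ] (E →L[ℂ] E)) (M : CStarMatrix n n B)
    (v w : PiLp 2 (fun _ : n => E)) :
    ⟪v, CStarMatrix.toOp π M w⟫_ℂ = ∑ i, ∑ j, ⟪v i, π (M i j) (w j)⟫_ℂ := by
  simp [PiLp.inner_apply, CStarMatrix.toOp_apply, inner_sum]

/-- `CStarMatrix.toOp` as a `*`-homomorphism. -/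
def CStarMatrix.toOpHom (n : Type*) [Fintype n] [DecidableEq n] (π : B →⋆ₙₐ[ℂ] (E →L[ℂ] E)) :
    CStarMatrix n n B →⋆ₙₐ[ℂ] (PiLp 2 (fun _ : n => E) →L[ℂ] PiLp 2 (fun _ : n => E)) where
  toFun := CStarMatrix.toOp π
  map_smul' c M := by
    ext v i
    simp [CStarMatrix.toOp_apply, Finset.smul_sum]
  map_zero' := by
    ext v i
    simp [CStarMatrix.toOp_apply]
  map_add' M N := by
    ext v i
    simp [CStarMatrix.toOp_apply, Finset.sum_add_distrib]
  map_mul' M N := by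
    ext v i
    simp only [CStarMatrix.toOp_apply, CStarMatrix.mul_apply, map_sum, map_mul,
      ContinuousLinearMap.mul_def, sum_apply, ContinuousLinearMap.comp_apply]
    exact Finset.sum_comm
  map_star' M := by
    refine ContinuousLinearMap.ext fun v => ext_inner_left ℂ fun w => ?_
    rw [ContinuousLinearMap.star_eq_adjoint, ContinuousLinearMap.adjoint_inner_right,
      ← inner_conj_symm (CStarMatrix.toOp π M w), CStarMatrix.inner_toOp, CStarMatrix.inner_toOp,
      map_sum, Finset.sum_comm]
    refine Finset.sum_congr rfl fun i _ => ?_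
    rw [map_sum]
    refine Finset.sum_congr rfl fun j _ => ?_
    rw [CStarMatrix.star_apply, map_star, ContinuousLinearMap.star_eq_adjoint,
      ContinuousLinearMap.adjoint_inner_right, inner_conj_symm]

/-- An injective *-homomorphism of C*-algebras is isometric. Injectivity is tested on vectors
supported in a single coordinate. -/
theorem CStarMatrix.norm_toOp {π : B →⋆ₙₐ[ℂ] (E →L[ℂ] E)} (hπ : Function.Injective π)
    (M : CStarMatrix n n B) : ‖CStarMatrix.toOp π M‖ = ‖M‖ := by
  refine NonUnitalStarAlgHom.norm_map (CStarMatrix.toOpHom n π) ?_ M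
  rw [injective_iff_map_eq_zero]
  intro M hM
  ext i j : 1
  apply hπ
  ext x
  have h := congrArg (fun T => T (PiLp.single 2 j x) i) hM
  change CStarMatrix.toOp π M (PiLp.single 2 j x) i = 0 at h
  rw [CStarMatrix.toOp_apply, Finset.sum_eq_single j] at h
  · simpa using h
  · intro k _ hk
    simp [hk]
  · simp

/-- Test with v = M w. All later estimates of matrix norms over B(H) and over ℂ are reduced to such
forms. -/
theorem CStarMatrix.norm_le_of_inner {π : B →⋆ₙₐ[ℂ] (E →L[ℂ] E)} (hπ : Function.Injective π)
    {M : CStarMatrix n n B} {C : ℝ} (hC : 0 ≤ C)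
    (h : ∀ v w : PiLp 2 (fun _ : n => E),
      ‖∑ i, ∑ j, ⟪v i, π (M i j) (w j)⟫_ℂ‖ ≤ C * ‖v‖ * ‖w‖) : ‖M‖ ≤ C := by
  rw [← CStarMatrix.norm_toOp hπ]
  refine ContinuousLinearMap.opNorm_le_bound _ hC fun w => ?_
  have h1 := h (CStarMatrix.toOp π M w) w
  rw [← CStarMatrix.inner_toOp, inner_self_eq_norm_sq_to_K] at h1
  set r := ‖CStarMatrix.toOp π M w‖ with hr
  have h2 : r ^ 2 ≤ C * r * ‖w‖ := by
    have : ‖((r : ℂ)) ^ 2‖ = r ^ 2 := by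
      rw [norm_pow, Complex.norm_real, Real.norm_of_nonneg (norm_nonneg _)]
    rw [← this]; exact h1
  by_cases h0 : r = 0
  · rw [h0]; positivity
  · have hpos : 0 < r := lt_of_le_of_ne (norm_nonneg _) (Ne.symm h0)
    nlinarith

theorem CStarMatrix.norm_inner_le {π : B →⋆ₙₐ[ℂ] (E →L[ℂ] E)} (hπ : Function.Injective π)
    (M : CStarMatrix n n B) (v w : PiLp 2 (fun _ : n => E)) :
    ‖∑ i, ∑ j, ⟪v i, π (M i j) (w j)⟫_ℂ‖ ≤ ‖M‖ * ‖v‖ * ‖w‖ := by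
  rw [← CStarMatrix.inner_toOp, ← CStarMatrix.norm_toOp hπ]
  calc _ ≤ ‖v‖ * ‖CStarMatrix.toOp π M w‖ := norm_inner_le_norm _ _
    _ ≤ ‖v‖ * (‖CStarMatrix.toOp π M‖ * ‖w‖) := by
        gcongr; exact ContinuousLinearMap.le_opNorm _ _
    _ = _ := by ring

theorem CStarMatrix.norm_le_of_inner_op {M : CStarMatrix n n (E →L[ℂ] E)} {C : ℝ} (hC : 0 ≤ C)
    (h : ∀ v w : PiLp 2 (fun _ : n => E),
      ‖∑ i, ∑ j, ⟪v i, M i j (w j)⟫_ℂ‖ ≤ C * ‖v‖ * ‖w‖) : ‖M‖ ≤ C :=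
  CStarMatrix.norm_le_of_inner (π := NonUnitalStarAlgHom.id ℂ (E →L[ℂ] E))
    Function.injective_id hC h

theorem CStarMatrix.norm_inner_op_le (M : CStarMatrix n n (E →L[ℂ] E))
    (v w : PiLp 2 (fun _ : n => E)) :
    ‖∑ i, ∑ j, ⟪v i, M i j (w j)⟫_ℂ‖ ≤ ‖M‖ * ‖v‖ * ‖w‖ :=
  CStarMatrix.norm_inner_le (π := NonUnitalStarAlgHom.id ℂ (E →L[ℂ] E))
    Function.injective_id M v w

theorem injective_ofId_complex :
    Function.Injective ((StarAlgHom.ofId ℂ (ℂ →L[ℂ] ℂ)).toNonUnitalStarAlgHom :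
      ℂ →⋆ₙₐ[ℂ] (ℂ →L[ℂ] ℂ)) :=
  (algebraMap ℂ (ℂ →L[ℂ] ℂ)).injective

theorem CStarMatrix.norm_le_of_sum {M : CStarMatrix n n ℂ} {C : ℝ} (hC : 0 ≤ C)
    (h : ∀ v w : EuclideanSpace ℂ n,
      ‖∑ i, ∑ j, M i j * (star (v i) * w j)‖ ≤ C * ‖v‖ * ‖w‖) : ‖M‖ ≤ C := by
  refine CStarMatrix.norm_le_of_inner injective_ofId_complex hC fun v w => ?_
  convert h v w using 6 with i _ j _
  change (M i j • w j) * star (v i) = _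
  rw [smul_eq_mul]; ring

theorem CStarMatrix.norm_sum_le (M : CStarMatrix n n ℂ) (v w : EuclideanSpace ℂ n) :
    ‖∑ i, ∑ j, M i j * (star (v i) * w j)‖ ≤ ‖M‖ * ‖v‖ * ‖w‖ := by
  convert CStarMatrix.norm_inner_le injective_ofId_complex M v w using 6 with i _ j _
  change _ = (M i j • w j) * star (v i)
  rw [smul_eq_mul]; ring

end CStarMatrixNorm

/-! ### Operators on Hilbert space tensor products -/

noncomputable section HilbertTensor

namespace HilbertTensor

variable {E F E' F' E'' F'' G : Type*} [NormedAddCommGroup E] [InnerProductSpace ℂ E]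
  [NormedAddCommGroup F] [InnerProductSpace ℂ F]
  [NormedAddCommGroup E'] [InnerProductSpace ℂ E']
  [NormedAddCommGroup F'] [InnerProductSpace ℂ F']
  [NormedAddCommGroup E''] [InnerProductSpace ℂ E'']
  [NormedAddCommGroup F''] [InnerProductSpace ℂ F'']
  [NormedAddCommGroup G] [NormedSpace ℂ G]

theorem ket_apply (ξ : E) (η : F) : ket ξ η = tmul ξ η := rfl

theorem inner_tmul (ξ ξ' : E) (η η' : F) :
    ⟪tmul ξ η, tmul ξ' η'⟫_ℂ = ⟪ξ, ξ'⟫_ℂ * ⟪η, η'⟫_ℂ := by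
  simp [tmul]

theorem norm_tmul (ξ : E) (η : F) : ‖tmul ξ η‖ = ‖ξ‖ * ‖η‖ := by
  simp [tmul]

/-- `ξ ⊗ η` as a bilinear map. -/
def tmulₗ (E F : Type*) [NormedAddCommGroup E] [InnerProductSpace ℂ E]
    [NormedAddCommGroup F] [InnerProductSpace ℂ F] : E →ₗ[ℂ] F →ₗ[ℂ] HilbertTensor E F :=
  (TensorProduct.mk ℂ E F).compr₂
    (UniformSpace.Completion.toComplL (𝕜 := ℂ) (E := E ⊗[ℂ] F)).toLinearMap

theorem tmulₗ_apply (ξ : E) (η : F) : tmulₗ E F ξ η = tmul ξ η := rfl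

theorem tmul_sum {ι : Type*} (s : Finset ι) (ξ : E) (η : ι → F) :
    tmul ξ (∑ i ∈ s, η i) = ∑ i ∈ s, tmul ξ (η i) := by
  simp only [← tmulₗ_apply, map_sum]

theorem sum_tmul {ι : Type*} (s : Finset ι) (ξ : ι → E) (η : F) :
    tmul (∑ i ∈ s, ξ i) η = ∑ i ∈ s, tmul (ξ i) η := by
  simp only [← tmulₗ_apply, map_sum, LinearMap.sum_apply]

theorem tmul_smul (c : ℂ) (ξ : E) (η : F) : tmul ξ (c • η) = c • tmul ξ η := by
  rw [← tmulₗ_apply, map_smul, tmulₗ_apply]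

theorem smul_tmul (c : ℂ) (ξ : E) (η : F) : tmul (c • ξ) η = c • tmul ξ η := by
  rw [← tmulₗ_apply, map_smul, LinearMap.smul_apply, tmulₗ_apply]

theorem zero_tmul (η : F) : tmul (0 : E) η = 0 := by
  rw [← tmulₗ_apply, map_zero, LinearMap.zero_apply]

theorem tmul_zero (ξ : E) : tmul ξ (0 : F) = 0 := by
  rw [← tmulₗ_apply, map_zero]

theorem continuous_tmul_left (η : F) : Continuous fun ξ : E => tmul ξ η :=
  (UniformSpace.Completion.continuous_coe _).comp
    (TensorProduct.continuous_tmul.comp (continuous_id.prodMk continuous_const))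

theorem ext_tmul {f g : HilbertTensor E F →L[ℂ] G}
    (h : ∀ ξ η, f (tmul ξ η) = g (tmul ξ η)) : f = g := by
  ext x
  refine UniformSpace.Completion.induction_on x (isClosed_eq f.continuous g.continuous) fun t => ?_
  induction t with
  | zero => rw [UniformSpace.Completion.coe_zero, map_zero, map_zero]
  | add x y hx hy => rw [UniformSpace.Completion.coe_add, map_add, map_add, hx, hy]
  | tmul ξ η => exact h ξ η

/-- Density is used one leg at a time: first η for ξ fixed in S, then ξ for arbitrary η. -/
theorem ext_total {S : Set E} {T : Set F} (hS : Dense (Submodule.span ℂ S : Set E))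
    (hT : Dense (Submodule.span ℂ T : Set F)) {f g : HilbertTensor E F →L[ℂ] G}
    (h : ∀ ξ ∈ S, ∀ η ∈ T, f (tmul ξ η) = g (tmul ξ η)) : f = g := by
  refine ext_tmul fun ξ η => ?_
  have h1 : ∀ ξ ∈ S, f ∘L ket ξ = g ∘L ket ξ := fun ξ hξ =>
    ContinuousLinearMap.ext_on hT fun η hη => h ξ hξ η hη
  have h2 : f ∘L (⟨(tmulₗ E F).flip η, continuous_tmul_left η⟩ : E →L[ℂ] HilbertTensor E F) =
      g ∘L ⟨(tmulₗ E F).flip η, continuous_tmul_left η⟩ :=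
    ContinuousLinearMap.ext_on hS fun ξ hξ => congrArg (fun k => k η) (h1 ξ hξ)
  exact congrArg (fun k => k ξ) h2

theorem _root_.ContinuousLinearMap.mem_of_dense_span (f : E →L[ℂ] G) {N : Submodule ℂ G}
    (hN : IsClosed (N : Set G)) {S : Set E} (hS : Dense (Submodule.span ℂ S : Set E))
    (h : ∀ x ∈ S, f x ∈ N) (x : E) : f x ∈ N := by
  have h1 : (Submodule.span ℂ S : Set E) ⊆ f ⁻¹' N :=
    SetLike.coe_subset_coe.mpr (Submodule.span_le (p := N.comap f.toLinearMap).mpr h)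
  exact closure_minimal h1 (hN.preimage f.continuous) (hS x)

theorem dense_span_tmul {S : Set E} {T : Set F} (hS : Dense (Submodule.span ℂ S : Set E))
    (hT : Dense (Submodule.span ℂ T : Set F)) :
    Dense (Submodule.span ℂ {ζ : HilbertTensor E F | ∃ ξ ∈ S, ∃ η ∈ T, ζ = tmul ξ η} :
      Set (HilbertTensor E F)) := by
  rw [Submodule.dense_iff_topologicalClosure_eq_top, Submodule.eq_top_iff']
  set N := (Submodule.span ℂ {ζ : HilbertTensor E F | ∃ ξ ∈ S, ∃ η ∈ T, ζ = tmul ξ η}).topologicalClosure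
  have hN : IsClosed (N : Set (HilbertTensor E F)) := Submodule.isClosed_topologicalClosure _
  have h1 : ∀ ξ ∈ S, ∀ η, tmul ξ η ∈ N := fun ξ hξ =>
    (ket ξ).mem_of_dense_span hN hT fun η hη =>
      Submodule.le_topologicalClosure _ (Submodule.subset_span ⟨ξ, hξ, η, hη, rfl⟩)
  have h2 : ∀ ξ η, tmul ξ η ∈ N := fun ξ η =>
    (⟨(tmulₗ E F).flip η, continuous_tmul_left η⟩ : E →L[ℂ] HilbertTensor E F).mem_of_dense_span
      hN hS (fun ξ hξ => h1 ξ hξ η) ξ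
  intro x
  refine UniformSpace.Completion.induction_on x hN fun t => ?_
  induction t with
  | zero => rw [UniformSpace.Completion.coe_zero]; exact Submodule.zero_mem _
  | add x y hx hy => rw [UniformSpace.Completion.coe_add]; exact Submodule.add_mem _ hx hy
  | tmul ξ η => exact h2 ξ η

theorem map_comp_map (a : E' →L[ℂ] E'') (b : F' →L[ℂ] F'') (c : E →L[ℂ] E') (d : F →L[ℂ] F') :
    map a b ∘L map c d = map (a ∘L c) (b ∘L d) :=
  ext_tmul fun ξ η => by simp [map_tmul]

theorem swap_comp_swap : swap F E ∘L swap E F = ContinuousLinearMap.id ℂ _ :=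
  ext_tmul fun ξ η => by simp [swap_tmul]

theorem norm_lift_le (f : E ⊗[ℂ] F →L[ℂ] E' ⊗[ℂ] F') : ‖lift f‖ ≤ ‖f‖ := by
  refine ContinuousLinearMap.opNorm_le_bound _ (norm_nonneg f) fun x => ?_
  refine UniformSpace.Completion.induction_on x
    (isClosed_le (lift f).continuous.norm (continuous_const.mul continuous_norm)) fun t => ?_
  rw [lift_coe, UniformSpace.Completion.norm_coe, UniformSpace.Completion.norm_coe]
  exact f.le_opNorm t

theorem norm_map_le (a : E →L[ℂ] E') (b : F →L[ℂ] F') : ‖map a b‖ ≤ ‖a‖ * ‖b‖ :=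
  (norm_lift_le _).trans (TensorProduct.norm_mapL_le a b)

section Adjoint

variable [CompleteSpace E] [CompleteSpace F] [CompleteSpace E'] [CompleteSpace F']

theorem adjoint_eq_of_inner_tmul {S : HilbertTensor E F →L[ℂ] HilbertTensor E' F'}
    {T : HilbertTensor E' F' →L[ℂ] HilbertTensor E F}
    (h : ∀ ξ η ξ' η', ⟪S (tmul ξ η), tmul ξ' η'⟫_ℂ = ⟪tmul ξ η, T (tmul ξ' η')⟫_ℂ) :
    S.adjoint = T := by
  refine ext_tmul fun ξ' η' => ext_inner_left ℂ fun x => ?_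
  rw [ContinuousLinearMap.adjoint_inner_right]
  have : (innerSL ℂ (tmul ξ' η')) ∘L S = innerSL ℂ (T (tmul ξ' η')) := by
    refine ext_tmul fun ξ η => ?_
    simp only [ContinuousLinearMap.comp_apply, innerSL_apply_apply]
    rw [← inner_conj_symm, h, inner_conj_symm]
  rw [← inner_conj_symm, ← inner_conj_symm x]
  exact congrArg (starRingEnd ℂ) (congrArg (fun k => k x) this)

theorem adjoint_map (a : E →L[ℂ] E') (b : F →L[ℂ] F') :
    (map a b).adjoint = map a.adjoint b.adjoint :=
  adjoint_eq_of_inner_tmul fun ξ η ξ' η' => by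
    simp [map_tmul, inner_tmul, ContinuousLinearMap.adjoint_inner_right]

theorem adjoint_swap : (swap E F).adjoint = swap F E :=
  adjoint_eq_of_inner_tmul fun ξ η ξ' η' => by
    simp [swap_tmul, inner_tmul, mul_comm]

theorem adjoint_ket_tmul (ξ ξ' : E) (η : F) :
    (ket ξ : F →L[ℂ] HilbertTensor E F).adjoint (tmul ξ' η) = ⟪ξ, ξ'⟫_ℂ • η := by
  refine ext_inner_left ℂ fun x => ?_
  rw [ContinuousLinearMap.adjoint_inner_right, ket_apply, inner_tmul, inner_smul_right]

theorem slice_apply (T : HilbertTensor E F →L[ℂ] HilbertTensor E F) (ξ η : E) (x : F) :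
    slice T ξ η x = (ket ξ : F →L[ℂ] HilbertTensor E F).adjoint (T (tmul η x)) := rfl

theorem adjoint_slice (T : HilbertTensor E F →L[ℂ] HilbertTensor E F) (ξ η : E) :
    (slice T ξ η).adjoint = slice T.adjoint η ξ := by
  simp [slice, ContinuousLinearMap.adjoint_comp, ContinuousLinearMap.comp_assoc]

end Adjoint

end HilbertTensor

end HilbertTensor

/-! ### The Kac–Takesaki operator on coefficients, and `VN(K)` as block operators -/

noncomputable section DualAlgebra

open HilbertTensor

variable {A : Type*} [Ring A] [StarRing A] [HopfAlgebra ℂ A] [StarModule ℂ A]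

namespace CompactQuantumGroup

variable (K : CompactQuantumGroup A)

/-- The vector `Λ((u^μ_{kl})*)`. -/
def coeffVec (μ : Irr A) (k l : Fin μ.rep.dim) : K.L2 := K.Λ (star (μ.rep.mat k l))

/-- The set of all vectors `Λ((u^μ_{kl})*)`. -/
def coeffVecs : Set K.L2 := {ξ | ∃ μ k l, ξ = K.coeffVec μ k l}

theorem coeffVec_mem (μ : Irr A) (k l : Fin μ.rep.dim) : K.coeffVec μ k l ∈ K.coeffVecs :=
  ⟨μ, k, l, rfl⟩

/-- Peter–Weyl applied to a*. The adjoints of the coefficients are used because W and W* have closed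
formulas on them. -/
theorem Λ_mem_span_coeffVecs (a : A) : K.Λ a ∈ Submodule.span ℂ K.coeffVecs := by
  have h : ∀ b ∈ coeffSpan A, K.Λ (star b) ∈ Submodule.span ℂ K.coeffVecs := by
    intro b hb
    induction hb using Submodule.span_induction with
    | mem x hx =>
      obtain ⟨⟨μ, k, l⟩, rfl⟩ := hx
      exact Submodule.subset_span (K.coeffVec_mem μ k l)
    | zero => simp
    | add x y _ _ hx hy => rw [star_add, map_add]; exact Submodule.add_mem _ hx hy
    | smul c x _ hx => rw [star_smul, map_smul]; exact Submodule.smul_mem _ _ hx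
  have := h (star a) (by rw [K.coeffSpan_eq_top]; trivial)
  rwa [star_star] at this

theorem dense_span_coeffVecs : Dense (Submodule.span ℂ K.coeffVecs : Set K.L2) :=
  K.denseRange_Λ.mono (by rintro _ ⟨a, rfl⟩; exact K.Λ_mem_span_coeffVecs a)

theorem dense_span_range_Λ : Dense (Submodule.span ℂ (Set.range K.Λ) : Set K.L2) :=
  K.denseRange_Λ.mono Submodule.subset_span

/-- Bounded operators on `L²(K)` that agree on the coefficients are equal. -/
theorem op_ext {G : Type*} [NormedAddCommGroup G] [NormedSpace ℂ G] {f g : K.L2 →L[ℂ] G}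
    (h : ∀ μ k l, f (K.coeffVec μ k l) = g (K.coeffVec μ k l)) : f = g :=
  ContinuousLinearMap.ext_on K.dense_span_coeffVecs (by rintro _ ⟨μ, k, l, rfl⟩; exact h μ k l)

theorem tensor_ext {E G : Type*} [NormedAddCommGroup E] [InnerProductSpace ℂ E]
    [NormedAddCommGroup G] [NormedSpace ℂ G] {f g : HilbertTensor E K.L2 →L[ℂ] G}
    (h : ∀ ξ μ k l, f (tmul ξ (K.coeffVec μ k l)) = g (tmul ξ (K.coeffVec μ k l))) : f = g :=
  ext_total (S := Set.univ) (by simp) K.dense_span_coeffVecs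
    (by rintro ξ - _ ⟨μ, k, l, rfl⟩; exact h ξ μ k l)

theorem tensor_ext_Λ {G : Type*} [NormedAddCommGroup G] [NormedSpace ℂ G]
    {f g : HilbertTensor K.L2 K.L2 →L[ℂ] G}
    (h : ∀ a μ k l, f (tmul (K.Λ a) (K.coeffVec μ k l)) =
      g (tmul (K.Λ a) (K.coeffVec μ k l))) : f = g :=
  ext_total K.dense_span_range_Λ K.dense_span_coeffVecs
    (by rintro _ ⟨a, rfl⟩ _ ⟨μ, k, l, rfl⟩; exact h a μ k l)

theorem inner_coeffVec_of_ne {μ ν : Irr A} (h : μ ≠ ν) (k l k' l') :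
    ⟪K.coeffVec μ k l, K.coeffVec ν k' l'⟫_ℂ = 0 := by
  rw [coeffVec, coeffVec, inner_Λ, star_star, K.haar_mul_star_of_ne h]

theorem inner_coeffVec (μ : Irr A) (k l k' l') :
    ⟪K.coeffVec μ k l, K.coeffVec μ k' l'⟫_ℂ = if k = k' then K.rowGram μ l l' else 0 := by
  rw [coeffVec, coeffVec, inner_Λ, star_star, K.haar_mul_star]

/-- The square norm of Λ((u_{kl})*) does not depend on k. If it vanished, the whole column l of u
would vanish, against ∑_k u_{kl}* u_{kl} = 1. -/
theorem coeffVec_ne_zero (μ : Irr A) (k l) : K.coeffVec μ k l ≠ 0 := by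
  intro h
  have h1 : ∀ k', K.coeffVec μ k' l = 0 := by
    intro k'
    rw [← inner_self_eq_zero (𝕜 := ℂ), K.inner_coeffVec, if_pos rfl]
    have := K.inner_coeffVec μ k l k l
    rw [h, inner_zero_left, if_pos rfl] at this
    exact this.symm
  have h2 : ∀ k', star (μ.rep.mat k' l) = 0 := by
    intro k'
    apply K.haar_faithful
    rw [← inner_Λ]
    change ⟪K.coeffVec μ k' l, K.coeffVec μ k' l⟫_ℂ = 0
    rw [h1, inner_zero_left]
  have h3 := μ.isUnitaryCorep.sum_star_mul l l
  simp only [h2, zero_mul, Finset.sum_const_zero, if_true] at h3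
  have := K.haar_one
  rw [← h3, map_zero] at this
  exact zero_ne_one this

theorem W_adjoint_tmul (a f : A) :
    K.W.adjoint (tmul (K.Λ a) (K.Λ f)) =
      K.ΛΛ (Coalgebra.comul (R := ℂ) f * (a ⊗ₜ[ℂ] (1 : A))) := by
  rw [← ΛΛ_tmul, W_adjoint_ΛΛ, galois_tmul]

theorem W_adjoint_coeffVec (a : A) (μ : Irr A) (k l : Fin μ.rep.dim) :
    K.W.adjoint (tmul (K.Λ a) (K.coeffVec μ k l)) =
      ∑ m, tmul (K.Λ (star (μ.rep.mat k m) * a)) (K.coeffVec μ m l) := by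
  rw [coeffVec, W_adjoint_tmul, K.comul_star_corep μ.isUnitaryCorep, Finset.sum_mul, map_sum]
  refine Finset.sum_congr rfl fun m _ => ?_
  rw [Algebra.TensorProduct.tmul_mul_tmul, mul_one, ΛΛ_tmul]
  rfl

theorem W_comp_adjoint : K.W ∘L K.W.adjoint = ContinuousLinearMap.id ℂ _ := by
  refine ContinuousLinearMap.coeFn_injective
    (K.denseRange_ΛΛ.equalizer (ContinuousLinearMap.continuous _)
      (ContinuousLinearMap.continuous _) ?_)
  funext t
  simp only [Function.comp_apply, ContinuousLinearMap.comp_apply, ContinuousLinearMap.id_apply]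
  have h : ∀ s, ⟪K.ΛΛ s, K.W (K.W.adjoint (K.ΛΛ t))⟫_ℂ = ⟪K.ΛΛ s, K.ΛΛ t⟫_ℂ := by
    intro s
    rw [← ContinuousLinearMap.adjoint_inner_left, W_adjoint_ΛΛ, W_adjoint_ΛΛ, inner_galois]
  refine ext_inner_left ℂ fun x => ?_
  exact K.denseRange_ΛΛ.induction_on (p := fun x => ⟪x, K.W (K.W.adjoint (K.ΛΛ t))⟫_ℂ =
    ⟪x, K.ΛΛ t⟫_ℂ) x (isClosed_eq (by fun_prop) (by fun_prop)) h

theorem W_adjoint_apply (x : HilbertTensor K.L2 K.L2) : K.W (K.W.adjoint x) = x :=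
  congrArg (fun f => f x) K.W_comp_adjoint

/-- The relation ∑_m u_{mp}* u_{mk} = δ_{pk} collapses the double sum. Together with W W* = 1, this
explicit preimage under W* yields the formula for W and the unitarity of W. -/
theorem W_adjoint_sum (a : A) (μ : Irr A) (k l : Fin μ.rep.dim) :
    K.W.adjoint (∑ m, tmul (K.Λ (μ.rep.mat m k * a)) (K.coeffVec μ m l)) =
      tmul (K.Λ a) (K.coeffVec μ k l) := by
  rw [map_sum]
  simp only [W_adjoint_coeffVec]
  rw [Finset.sum_comm]
  have h : ∀ p, ∑ m, tmul (K.Λ (star (μ.rep.mat m p) * (μ.rep.mat m k * a)))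
      (K.coeffVec μ p l) = if p = k then tmul (K.Λ a) (K.coeffVec μ p l) else 0 := by
    intro p
    rw [← sum_tmul, ← map_sum]
    simp only [← mul_assoc]
    rw [← Finset.sum_mul, μ.isUnitaryCorep.sum_star_mul]
    split_ifs
    · rw [one_mul]
    · rw [zero_mul, map_zero, zero_tmul]
  simp only [h, Finset.sum_ite_eq', Finset.mem_univ, if_true]

theorem W_coeffVec (a : A) (μ : Irr A) (k l : Fin μ.rep.dim) :
    K.W (tmul (K.Λ a) (K.coeffVec μ k l)) =
      ∑ m, tmul (K.Λ (μ.rep.mat m k * a)) (K.coeffVec μ m l) := by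
  rw [← W_adjoint_sum, W_adjoint_apply]

theorem W_adjoint_comp : K.W.adjoint ∘L K.W = ContinuousLinearMap.id ℂ _ :=
  K.tensor_ext_Λ fun a μ k l => by
    rw [ContinuousLinearMap.comp_apply, W_coeffVec, W_adjoint_sum, ContinuousLinearMap.id_apply]

/-- Only the index k is moved and the coefficients do not involve l; hence slices of W respect the
blocks. -/
theorem slice_W_coeffVec (ξ : K.L2) (b : A) (μ : Irr A) (k l : Fin μ.rep.dim) :
    slice K.W ξ (K.Λ b) (K.coeffVec μ k l) =
      ∑ m, ⟪ξ, K.Λ (μ.rep.mat m k * b)⟫_ℂ • K.coeffVec μ m l := by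
  rw [slice_apply, W_coeffVec, map_sum]
  simp only [adjoint_ket_tmul]

theorem slice_W_adjoint_coeffVec (ξ : K.L2) (b : A) (μ : Irr A) (k l : Fin μ.rep.dim) :
    slice K.W.adjoint ξ (K.Λ b) (K.coeffVec μ k l) =
      ∑ m, ⟪ξ, K.Λ (star (μ.rep.mat k m) * b)⟫_ℂ • K.coeffVec μ m l := by
  rw [slice_apply, W_adjoint_coeffVec, map_sum]
  simp only [adjoint_ket_tmul]

/-- The matrix unit `ω^μ_{ij}`, as a slice of `W`. -/
def matUnit (μ : Irr A) (i j : Fin μ.rep.dim) : K.L2 →L[ℂ] K.L2 :=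
  slice K.W (K.Λ (K.exists_haar_star_mul_dual μ i j).choose) (K.Λ 1)

theorem matUnit_coeffVec (μ : Irr A) (i j k l : Fin μ.rep.dim) :
    K.matUnit μ i j (K.coeffVec μ k l) = if j = k then K.coeffVec μ i l else 0 := by
  have h := (K.exists_haar_star_mul_dual μ i j).choose_spec.1
  rw [matUnit, slice_W_coeffVec]
  simp only [mul_one, inner_Λ, h]
  by_cases hjk : j = k
  · simp [hjk]
  · simp [hjk]

theorem matUnit_coeffVec_of_ne {μ ν : Irr A} (hν : μ ≠ ν) (i j k l) :
    K.matUnit μ i j (K.coeffVec ν k l) = 0 := by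
  have h := (K.exists_haar_star_mul_dual μ i j).choose_spec.2 ν hν
  rw [matUnit, slice_W_coeffVec]
  simp only [mul_one, inner_Λ, h, zero_smul, Finset.sum_const_zero]

theorem matUnit_mem_VN (μ : Irr A) (i j : Fin μ.rep.dim) : K.matUnit μ i j ∈ K.VN.toStarSubalgebra :=
  subset_vonNeumannClosure _ ⟨_, _, rfl⟩

theorem slice_W_mem_VN (ξ η : K.L2) : slice K.W ξ η ∈ K.VN.toStarSubalgebra :=
  subset_vonNeumannClosure _ ⟨_, _, rfl⟩

/-- The operator `Λ((u^μ_{kq})*) ↦ Λ((u^μ_{kp})*)` in the commutant of `VN(K)`. -/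
def commUnit (μ : Irr A) (p q : Fin μ.rep.dim) : K.L2 →L[ℂ] K.L2 :=
  (ket (K.Λ (K.exists_haar_mul_star_dual μ p q).choose)).adjoint ∘L swap K.L2 K.L2 ∘L
    K.W.adjoint ∘L ket (K.Λ 1)

/-- Applied to Λ(1) ⊗ Λ((u_{kl})*), W* gives ∑_m Λ((u_{km})*) ⊗ Λ((u_{ml})*). Pairing the second leg
with a vector leaves an operator that acts on l alone. -/
theorem commUnit_apply_coeffVec (μ : Irr A) (p q : Fin μ.rep.dim) (ν : Irr A)
    (k l : Fin ν.rep.dim) : K.commUnit μ p q (K.coeffVec ν k l) =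
      ∑ m, K.haar (star (K.exists_haar_mul_star_dual μ p q).choose * star (ν.rep.mat m l)) •
        K.coeffVec ν k m := by
  simp only [commUnit, ContinuousLinearMap.comp_apply, ket_apply]
  rw [W_adjoint_coeffVec, map_sum, map_sum]
  refine Finset.sum_congr rfl fun m _ => ?_
  rw [swap_tmul, adjoint_ket_tmul, mul_one]
  congr 1
  rw [coeffVec, inner_Λ]

theorem commUnit_coeffVec (μ : Irr A) (p q k l : Fin μ.rep.dim) :
    K.commUnit μ p q (K.coeffVec μ k l) = if q = l then K.coeffVec μ k p else 0 := by
  have h := (K.exists_haar_mul_star_dual μ p q).choose_spec.1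
  rw [commUnit_apply_coeffVec]
  simp only [h]
  by_cases hjk : q = l
  · simp [hjk]
  · simp [hjk]

theorem commUnit_coeffVec_of_ne {μ ν : Irr A} (hν : μ ≠ ν) (p q k l) :
    K.commUnit μ p q (K.coeffVec ν k l) = 0 := by
  have h := (K.exists_haar_mul_star_dual μ p q).choose_spec.2 ν hν
  rw [commUnit_apply_coeffVec]
  simp only [h, zero_smul, Finset.sum_const_zero]

/-- An operator acting on each block of `L²(K)` by left multiplication with a matrix. -/
def HasBlocks (x : K.L2 →L[ℂ] K.L2) : Prop :=
  ∀ μ : Irr A, ∃ X : Fin μ.rep.dim → Fin μ.rep.dim → ℂ, ∀ k l,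
    x (K.coeffVec μ k l) = ∑ m, X m k • K.coeffVec μ m l

variable {K}

theorem HasBlocks.commute {x : K.L2 →L[ℂ] K.L2} (hx : K.HasBlocks x) (μ : Irr A)
    (p q : Fin μ.rep.dim) : K.commUnit μ p q * x = x * K.commUnit μ p q := by
  refine K.op_ext fun ν k l => ?_
  obtain ⟨X, hX⟩ := hx ν
  rw [ContinuousLinearMap.mul_def, ContinuousLinearMap.mul_def, ContinuousLinearMap.comp_apply,
    ContinuousLinearMap.comp_apply, hX, map_sum]
  simp only [map_smul]
  by_cases hν : μ = ν
  · subst hν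
    simp only [commUnit_coeffVec]
    split_ifs
    · rw [hX]
    · simp
  · simp [K.commUnit_coeffVec_of_ne hν]

/-- `commUnit μ z z` maps L²(K) into the span of the column z of the block μ. An x that commutes
with it preserves this column, which determines a matrix; commuting with `commUnit μ l z` carries
the same matrix to every column l. -/
theorem hasBlocks_of_commute {x : K.L2 →L[ℂ] K.L2}
    (hx : ∀ μ p q, K.commUnit μ p q * x = x * K.commUnit μ p q) : K.HasBlocks x := by
  intro μ
  have hcomm : ∀ p q ξ, K.commUnit μ p q (x ξ) = x (K.commUnit μ p q ξ) := fun p q ξ =>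
    congrArg (fun f => f ξ) (hx μ p q)
  let z : Fin μ.rep.dim := ⟨0, μ.rep.dim_pos⟩
  let V : Submodule ℂ K.L2 := Submodule.span ℂ (Set.range fun m => K.coeffVec μ m z)
  have hVfin : FiniteDimensional ℂ V := FiniteDimensional.span_of_finite ℂ (Set.finite_range _)
  have hVcl : IsClosed (V : Set K.L2) := V.closed_of_finiteDimensional
  -- V is finite dimensional, hence closed, so it suffices to check coefficient vectors.
  have hrange : ∀ ξ, K.commUnit μ z z ξ ∈ V := by
    intro ξ
    have hd := K.dense_span_coeffVecs
    refine hd.induction (P := fun ξ => K.commUnit μ z z ξ ∈ V) ?_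
      (hVcl.preimage (K.commUnit μ z z).continuous) ξ
    intro ξ hξ
    induction hξ using Submodule.span_induction with
    | mem x hx =>
      obtain ⟨ν, k, l, rfl⟩ := hx
      by_cases hν : μ = ν
      · subst hν
        rw [commUnit_coeffVec]
        split_ifs
        · exact Submodule.subset_span ⟨k, rfl⟩
        · exact Submodule.zero_mem _
      · rw [K.commUnit_coeffVec_of_ne hν]
        exact Submodule.zero_mem _
    | zero => simp
    | add x y _ _ hx hy => rw [map_add]; exact Submodule.add_mem _ hx hy
    | smul c x _ hx => rw [map_smul]; exact Submodule.smul_mem _ _ hx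
  have hex : ∀ k, ∃ c : Fin μ.rep.dim → ℂ, ∑ m, c m • K.coeffVec μ m z =
      x (K.coeffVec μ k z) := by
    intro k
    have h := hrange (x (K.coeffVec μ k z))
    rw [hcomm, commUnit_coeffVec, if_pos rfl] at h
    exact (Submodule.mem_span_range_iff_exists_fun ℂ).mp h
  choose c hc using hex
  refine ⟨fun m k => c k m, fun k l => ?_⟩
  have h : K.coeffVec μ k l = K.commUnit μ l z (K.coeffVec μ k z) := by
    rw [commUnit_coeffVec, if_pos rfl]
  rw [h, ← hcomm, ← hc, map_sum]
  simp only [map_smul, commUnit_coeffVec, if_true]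

/-- The set of slices of W is not visibly self-adjoint, so commutation is needed with the adjoints
too, which are slices of W*. By continuity in the second vector, slices at vectors Λ(b) suffice, and
these act through the index k. -/
theorem commUnit_mem_centralizer (μ : Irr A) (p q : Fin μ.rep.dim) :
    K.commUnit μ p q ∈ StarSubalgebra.centralizer ℂ {x | ∃ ξ η : K.L2, x = slice K.W ξ η} := by
  rw [StarSubalgebra.mem_centralizer_iff]
  have key : ∀ T : HilbertTensor K.L2 K.L2 →L[ℂ] HilbertTensor K.L2 K.L2,
      (∀ (ξ : K.L2) (b : A), K.HasBlocks (slice T ξ (K.Λ b))) → ∀ ξ η : K.L2,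
      slice T ξ η * K.commUnit μ p q = K.commUnit μ p q * slice T ξ η := by
    intro T hT ξ η
    have hc : Continuous fun η => slice T ξ η := by
      let f : K.L2 →ₗ[ℂ] (K.L2 →L[ℂ] K.L2) :=
        { toFun := fun η => slice T ξ η
          map_add' := fun a b => slice_add_right T ξ a b
          map_smul' := fun c a => slice_smul_right T c ξ a }
      exact (f.mkContinuous (‖T‖ * ‖ξ‖) fun η => norm_slice_le T ξ η).continuous
    refine K.denseRange_Λ.induction_on (p := fun η => slice T ξ η * K.commUnit μ p q =
      K.commUnit μ p q * slice T ξ η) η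
      (isClosed_eq (hc.mul continuous_const) (continuous_const.mul hc)) fun b => ?_
    exact ((hT ξ b).commute μ p q).symm
  rintro _ ⟨ξ, η, rfl⟩
  refine ⟨key _ (fun ξ b ν => ⟨_, K.slice_W_coeffVec ξ b ν⟩) ξ η, ?_⟩
  rw [ContinuousLinearMap.star_eq_adjoint, adjoint_slice]
  exact key _ (fun ξ b ν => ⟨fun m k => ⟪ξ, K.Λ (star (ν.rep.mat k m) * b)⟫_ℂ,
    K.slice_W_adjoint_coeffVec ξ b ν⟩) η ξ

theorem commute_of_mem_VN {x : K.L2 →L[ℂ] K.L2} (hx : x ∈ K.VN.toStarSubalgebra) (μ : Irr A)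
    (p q : Fin μ.rep.dim) : K.commUnit μ p q * x = x * K.commUnit μ p q :=
  ((StarSubalgebra.mem_centralizer_iff ℂ).mp hx _ (commUnit_mem_centralizer μ p q)).1

/-- A criterion for membership in a double commutant. -/
theorem mem_vonNeumannClosure_of_blocks {E : Type*} [NormedAddCommGroup E] [InnerProductSpace ℂ E]
    [CompleteSpace E] {S : Set (E →L[ℂ] E)} {ι : Type*} {P : ι → E →L[ℂ] E} {x : E →L[ℂ] E}
    (hP : ∀ i, P i ∈ (vonNeumannClosure S).toStarSubalgebra)
    (hxP : ∀ i, x * P i ∈ (vonNeumannClosure S).toStarSubalgebra)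
    (hd : Dense (Submodule.span ℂ {ξ | ∃ i, P i ξ = ξ} : Set E)) :
    x ∈ (vonNeumannClosure S).toStarSubalgebra := by
  -- If P_i ξ = ξ, then s x ξ = s (x P_i) ξ = x P_i s ξ = x s P_i ξ = x s ξ.
  have key : ∀ s ∈ StarSubalgebra.centralizer ℂ S, s * x = x * s := by
    intro s hs
    refine ContinuousLinearMap.ext_on hd ?_
    rintro ξ ⟨i, hi⟩
    have h1 := congrArg (fun f => f ξ) ((StarSubalgebra.mem_centralizer_iff ℂ).mp (hP i) s hs).1
    have h2 := congrArg (fun f => f ξ) ((StarSubalgebra.mem_centralizer_iff ℂ).mp (hxP i) s hs).1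
    simp only [ContinuousLinearMap.mul_def, ContinuousLinearMap.comp_apply, hi] at h1 h2 ⊢
    rw [h2, ← h1]
  change x ∈ StarSubalgebra.centralizer ℂ (StarSubalgebra.centralizer ℂ S : Set (E →L[ℂ] E))
  rw [StarSubalgebra.mem_centralizer_iff]
  exact fun s hs => ⟨key s hs, key _ (star_mem hs)⟩

variable (K) in
/-- The central projection onto the block `μ`. -/
def blockProj (μ : Irr A) : K.L2 →L[ℂ] K.L2 := ∑ i, K.matUnit μ i i

theorem blockProj_coeffVec (μ : Irr A) (k l : Fin μ.rep.dim) :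
    K.blockProj μ (K.coeffVec μ k l) = K.coeffVec μ k l := by
  simp [blockProj, sum_apply, matUnit_coeffVec]

theorem blockProj_coeffVec_of_ne {μ ν : Irr A} (h : μ ≠ ν) (k l) :
    K.blockProj μ (K.coeffVec ν k l) = 0 := by
  simp [blockProj, sum_apply, K.matUnit_coeffVec_of_ne h]

theorem blockProj_mem_VN (μ : Irr A) : K.blockProj μ ∈ K.VN.toStarSubalgebra :=
  sum_mem fun i _ => K.matUnit_mem_VN μ i i

/-- Cut down to one block, x is a finite combination of matrix units, which are slices of W. The
double commutant criterion removes the cut-off. -/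
theorem HasBlocks.mem_VN {x : K.L2 →L[ℂ] K.L2} (hx : K.HasBlocks x) :
    x ∈ K.VN.toStarSubalgebra := by
  refine mem_vonNeumannClosure_of_blocks (P := K.blockProj) blockProj_mem_VN (fun μ => ?_) ?_
  · obtain ⟨X, hX⟩ := hx μ
    have : x * K.blockProj μ = ∑ m, ∑ k, X m k • K.matUnit μ m k := by
      refine K.op_ext fun ν k l => ?_
      rw [ContinuousLinearMap.mul_def, ContinuousLinearMap.comp_apply]
      by_cases hν : μ = ν
      · subst hν
        rw [blockProj_coeffVec, hX]
        simp [sum_apply, matUnit_coeffVec]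
      · simp [blockProj_coeffVec_of_ne hν, sum_apply, K.matUnit_coeffVec_of_ne hν]
    rw [this]
    exact sum_mem fun m _ => sum_mem fun k _ =>
      StarSubalgebra.smul_mem _ (K.matUnit_mem_VN μ m k) _
  · refine K.dense_span_coeffVecs.mono (Submodule.span_mono ?_)
    rintro _ ⟨μ, k, l, rfl⟩
    exact ⟨μ, blockProj_coeffVec μ k l⟩

/-- `VN(K)` consists of the operators that act by matrices on all blocks. -/
theorem mem_VN_iff_hasBlocks {x : K.L2 →L[ℂ] K.L2} :
    x ∈ K.VN.toStarSubalgebra ↔ K.HasBlocks x :=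
  ⟨fun hx => hasBlocks_of_commute (commute_of_mem_VN hx), HasBlocks.mem_VN⟩

theorem mem_VN_of_commute {x : K.L2 →L[ℂ] K.L2}
    (hx : ∀ μ p q, K.commUnit μ p q * x = x * K.commUnit μ p q) : x ∈ K.VN.toStarSubalgebra :=
  (hasBlocks_of_commute hx).mem_VN

section Tensor

variable {H : Type*} [NormedAddCommGroup H] [InnerProductSpace ℂ H] [CompleteSpace H]

theorem HasComponent.apply_coeffVec {T : HilbertTensor H K.L2 →L[ℂ] HilbertTensor H K.L2}
    {μ : Irr A} {X : CStarMatrix (Fin μ.rep.dim) (Fin μ.rep.dim) (H →L[ℂ] H)}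
    (hT : K.HasComponent T μ X) (h : H) (k l : Fin μ.rep.dim) :
    T (tmul h (K.coeffVec μ k l)) = ∑ i, tmul (X i k h) (K.coeffVec μ i l) := hT h k l

theorem map_mem_boundedTensorVN (a : H →L[ℂ] H) {x : K.L2 →L[ℂ] K.L2}
    (hx : x ∈ K.VN.toStarSubalgebra) :
    HilbertTensor.map a x ∈ (K.boundedTensorVN H).toStarSubalgebra :=
  subset_vonNeumannClosure _ ⟨a, x, hx, rfl⟩

/-- The same criterion with the projections 1 ⊗ P_μ: the cut-down of T is the finite sum ∑ X_{mk} ⊗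
ω^μ_{mk}. -/
theorem mem_boundedTensorVN_of_hasComponent {T : HilbertTensor H K.L2 →L[ℂ] HilbertTensor H K.L2}
    (hT : ∀ μ, ∃ X, K.HasComponent T μ X) : T ∈ (K.boundedTensorVN H).toStarSubalgebra := by
  refine mem_vonNeumannClosure_of_blocks
    (P := fun μ => HilbertTensor.map (ContinuousLinearMap.id ℂ H) (K.blockProj μ))
    (fun μ => map_mem_boundedTensorVN _ (blockProj_mem_VN μ)) (fun μ => ?_) ?_
  · obtain ⟨X, hX⟩ := hT μ
    have : T * HilbertTensor.map (ContinuousLinearMap.id ℂ H) (K.blockProj μ) =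
        ∑ m, ∑ k, HilbertTensor.map (X m k) (K.matUnit μ m k) := by
      refine K.tensor_ext fun ξ ν k l => ?_
      rw [ContinuousLinearMap.mul_def, ContinuousLinearMap.comp_apply, map_tmul]
      by_cases hν : μ = ν
      · subst hν
        rw [blockProj_coeffVec, ContinuousLinearMap.id_apply, hX.apply_coeffVec]
        simp only [sum_apply, map_tmul, matUnit_coeffVec]
        refine Finset.sum_congr rfl fun m _ => ?_
        rw [Finset.sum_eq_single k]
        · simp
        · intro b _ hb; simp [hb, tmul_zero]
        · simp
      · simp [blockProj_coeffVec_of_ne hν, sum_apply, K.matUnit_coeffVec_of_ne hν, map_tmul,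
          tmul_zero]
    rw [this]
    exact sum_mem fun m _ => sum_mem fun k _ =>
      map_mem_boundedTensorVN _ (K.matUnit_mem_VN μ m k)
  · refine (dense_span_tmul (S := Set.univ) (E := H) (by simp) K.dense_span_coeffVecs).mono
      (Submodule.span_mono ?_)
    rintro _ ⟨ξ, -, _, ⟨μ, k, l, rfl⟩, rfl⟩
    exact ⟨μ, by rw [map_tmul, blockProj_coeffVec, ContinuousLinearMap.id_apply]⟩

/-- The slices have the scalar components ⟪ξ, X_{mk} η⟫, so their membership in VN(K) is read off
from the components of T. -/
theorem hasBlocks_slice {T : HilbertTensor H K.L2 →L[ℂ] HilbertTensor H K.L2}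
    (hT : ∀ μ, ∃ X, K.HasComponent T μ X) (ξ η : H) : K.HasBlocks (slice T ξ η) := by
  intro μ
  obtain ⟨X, hX⟩ := hT μ
  refine ⟨fun m k => ⟪ξ, X m k η⟫_ℂ, fun k l => ?_⟩
  rw [slice_apply, hX.apply_coeffVec, map_sum]
  simp only [adjoint_ket_tmul]

end Tensor

end CompactQuantumGroup

end DualAlgebra

/-! ### The predual of `VN(K)` and its coordinate functionals -/

noncomputable section Predual

open HilbertTensor

section Instances

variable {E : Type*} [NormedAddCommGroup E] [InnerProductSpace ℂ E] [CompleteSpace E]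
  (M : VonNeumannAlgebra E)

instance : SeminormedAddCommGroup M.toStarSubalgebra := inferInstance
instance : NormedAddCommGroup M.toStarSubalgebra := inferInstance
instance : AddCommGroup M.toStarSubalgebra := inferInstance
instance : AddCommMonoid M.toStarSubalgebra := inferInstance
instance : NormedSpace ℂ M.toStarSubalgebra := inferInstance
instance : Module ℂ M.toStarSubalgebra := inferInstance
instance : TopologicalSpace M.toStarSubalgebra := inferInstance
instance : AddCommGroup (StrongDual ℂ M.toStarSubalgebra) := inferInstance
instance : AddCommMonoid (StrongDual ℂ M.toStarSubalgebra) := inferInstance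
instance : Module ℂ (StrongDual ℂ M.toStarSubalgebra) := inferInstance
instance : SeminormedAddCommGroup (StrongDual ℂ M.toStarSubalgebra) := inferInstance
instance : NormedAddCommGroup (StrongDual ℂ M.toStarSubalgebra) := inferInstance
instance : NormedSpace ℂ (StrongDual ℂ M.toStarSubalgebra) := inferInstance
instance : AddCommGroup M.predual := inferInstance
instance : AddCommMonoid M.predual := inferInstance
instance : Module ℂ M.predual := inferInstance
instance : SeminormedAddCommGroup M.predual := inferInstance
instance : NormedAddCommGroup M.predual := inferInstance
instance : NormedSpace ℂ M.predual := inferInstance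

end Instances

/-- The vector functional `x ↦ ⟪ξ, x η⟫`. -/
def VonNeumannAlgebra.vecFunctional {E : Type*} [NormedAddCommGroup E] [InnerProductSpace ℂ E]
    [CompleteSpace E] (M : VonNeumannAlgebra E) (ξ η : E) : StrongDual ℂ M.toStarSubalgebra :=
  LinearMap.mkContinuous
    { toFun := fun x => ⟪ξ, (x : E →L[ℂ] E) η⟫_ℂ
      map_add' := fun x y => by simp
      map_smul' := fun c x => by simp } (‖ξ‖ * ‖η‖) (fun x => by
        calc ‖⟪ξ, (x : E →L[ℂ] E) η⟫_ℂ‖ ≤ ‖ξ‖ * ‖(x : E →L[ℂ] E) η‖ := norm_inner_le_norm _ _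
          _ ≤ ‖ξ‖ * (‖(x : E →L[ℂ] E)‖ * ‖η‖) := by
              gcongr; exact ContinuousLinearMap.le_opNorm _ _
          _ = ‖ξ‖ * ‖η‖ * ‖x‖ := by rw [show ‖x‖ = ‖(x : E →L[ℂ] E)‖ from rfl]; ring)

theorem VonNeumannAlgebra.vecFunctional_apply {E : Type*} [NormedAddCommGroup E]
    [InnerProductSpace ℂ E] [CompleteSpace E] (M : VonNeumannAlgebra E) (ξ η : E)
    (x : M.toStarSubalgebra) : M.vecFunctional ξ η x = ⟪ξ, (x : E →L[ℂ] E) η⟫_ℂ := rfl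

theorem VonNeumannAlgebra.vecFunctional_mem_predual {E : Type*} [NormedAddCommGroup E]
    [InnerProductSpace ℂ E] [CompleteSpace E] (M : VonNeumannAlgebra E) (ξ η : E) :
    M.vecFunctional ξ η ∈ M.predual :=
  Submodule.le_topologicalClosure _ (Submodule.subset_span ⟨ξ, η, fun _ => rfl⟩)

variable {A : Type*} [Ring A] [StarRing A] [HopfAlgebra ℂ A] [StarModule ℂ A]

/-- The first index of the matrix `u^μ`. -/
abbrev Irr.idx {A : Type*} [Ring A] [StarRing A] [HopfAlgebra ℂ A] (μ : Irr A) : Fin μ.rep.dim :=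
  ⟨0, μ.rep.dim_pos⟩

namespace CompactQuantumGroup

variable (K : CompactQuantumGroup A)

theorem rowGram_idx_ne_zero (μ : Irr A) : K.rowGram μ μ.idx μ.idx ≠ 0 := by
  intro h
  have h1 := K.inner_coeffVec μ μ.idx μ.idx μ.idx μ.idx
  rw [if_pos rfl, h, inner_self_eq_zero] at h1
  exact K.coeffVec_ne_zero _ _ _ h1

/-- The normal functional on `VN(K)` reading off the `(i, j)`-entry of the component in
`End(V(μ))`. -/
def entry (μ : Irr A) (i j : Fin μ.rep.dim) : K.VN.predual :=
  (K.rowGram μ μ.idx μ.idx)⁻¹ • ⟨K.VN.vecFunctional (K.coeffVec μ i μ.idx) (K.coeffVec μ j μ.idx),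
    K.VN.vecFunctional_mem_predual _ _⟩

theorem entry_apply (μ : Irr A) (i j : Fin μ.rep.dim) (x : K.VN.toStarSubalgebra) :
    (K.entry μ i j : StrongDual ℂ K.VN.toStarSubalgebra) x = (K.rowGram μ μ.idx μ.idx)⁻¹ *
      ⟪K.coeffVec μ i μ.idx, (x : K.L2 →L[ℂ] K.L2) (K.coeffVec μ j μ.idx)⟫_ℂ := rfl

variable {K}

/-- For varying m, the vectors Λ((u_{m0})*) are orthogonal with the common square norm `rowGram μ 0
0`, which the normalisation of `entry` cancels. -/
theorem entry_eq {μ : Irr A} {j : Fin μ.rep.dim} {x : K.VN.toStarSubalgebra}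
    {c : Fin μ.rep.dim → ℂ} (h : (x : K.L2 →L[ℂ] K.L2) (K.coeffVec μ j μ.idx) =
      ∑ m, c m • K.coeffVec μ m μ.idx) (i : Fin μ.rep.dim) :
    (K.entry μ i j : StrongDual ℂ K.VN.toStarSubalgebra) x = c i := by
  rw [entry_apply, h, inner_sum]
  simp only [inner_smul_right, inner_coeffVec]
  have := K.rowGram_idx_ne_zero μ
  simp only [mul_ite, mul_zero, Finset.sum_ite_eq, Finset.mem_univ, if_true]
  field_simp

/-- The entries are measured in column 0 only, but an element of VN(K) acts by the same matrix on
every column. -/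
theorem apply_coeffVec (x : K.VN.toStarSubalgebra) (μ : Irr A) (k l : Fin μ.rep.dim) :
    (x : K.L2 →L[ℂ] K.L2) (K.coeffVec μ k l) =
      ∑ m, (K.entry μ m k : StrongDual ℂ K.VN.toStarSubalgebra) x • K.coeffVec μ m l := by
  obtain ⟨X, hX⟩ := mem_VN_iff_hasBlocks.mp x.2 μ
  have : ∀ m, (K.entry μ m k : StrongDual ℂ K.VN.toStarSubalgebra) x = X m k :=
    entry_eq (c := fun m => X m k) (hX k μ.idx)
  simp only [this, hX]

theorem VN_ext {x y : K.VN.toStarSubalgebra} (h : ∀ μ k l,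
    (x : K.L2 →L[ℂ] K.L2) (K.coeffVec μ k l) = (y : K.L2 →L[ℂ] K.L2) (K.coeffVec μ k l)) :
    x = y :=
  Subtype.ext (K.op_ext h)

/-- The predual of `VN(K)` is the closed linear span of the functionals `entry`. -/
theorem predual_le_closure {R : Submodule ℂ (StrongDual ℂ K.VN.toStarSubalgebra)}
    (hR : ∀ μ i j, (K.entry μ i j : StrongDual ℂ K.VN.toStarSubalgebra) ∈ R) :
    K.VN.predual ≤ R.topologicalClosure := by
  have hcl : IsClosed (R.topologicalClosure : Set (StrongDual ℂ K.VN.toStarSubalgebra)) :=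
    Submodule.isClosed_topologicalClosure _
  -- Within one block, a vector functional on coefficient vectors is a multiple of an entry; between
  -- different blocks it vanishes by orthogonality.
  have h1 : ∀ μ k l ν k' l', K.VN.vecFunctional (K.coeffVec μ k l) (K.coeffVec ν k' l') ∈ R := by
    intro μ k l ν k' l'
    by_cases hν : μ = ν
    · subst hν
      have : K.VN.vecFunctional (K.coeffVec μ k l) (K.coeffVec μ k' l') =
          K.rowGram μ l l' • (K.entry μ k k' : StrongDual ℂ K.VN.toStarSubalgebra) := by
        ext x
        rw [VonNeumannAlgebra.vecFunctional_apply, apply_coeffVec, inner_sum]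
        simp only [inner_smul_right, inner_coeffVec]
        simp [mul_comm]
      rw [this]
      exact R.smul_mem _ (hR _ _ _)
    · have : K.VN.vecFunctional (K.coeffVec μ k l) (K.coeffVec ν k' l') = 0 := by
        ext x
        rw [VonNeumannAlgebra.vecFunctional_apply, apply_coeffVec, inner_sum]
        simp [inner_smul_right, K.inner_coeffVec_of_ne hν]
      rw [this]
      exact R.zero_mem
  have hnorm : ∀ ξ η, ‖K.VN.vecFunctional ξ η‖ ≤ ‖ξ‖ * ‖η‖ := fun ξ η =>
    LinearMap.mkContinuous_norm_le _ (by positivity) _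
  -- The bound ‖ξ‖ ‖η‖ allows passage to the closed span in one vector at a time; the functional is
  -- linear in η and conjugate linear in ξ.
  have h2 : ∀ μ k l η, K.VN.vecFunctional (K.coeffVec μ k l) η ∈ R.topologicalClosure := by
    intro μ k l
    let f : K.L2 →ₗ[ℂ] StrongDual ℂ K.VN.toStarSubalgebra :=
      { toFun := fun η => K.VN.vecFunctional (K.coeffVec μ k l) η
        map_add' := fun a b => by
          ext x; simp [VonNeumannAlgebra.vecFunctional_apply]
        map_smul' := fun c a => by
          ext x; simp [VonNeumannAlgebra.vecFunctional_apply] }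
    exact (f.mkContinuous ‖K.coeffVec μ k l‖ fun η => hnorm _ η).mem_of_dense_span hcl
      K.dense_span_coeffVecs (by
        rintro _ ⟨ν, k', l', rfl⟩
        exact Submodule.le_topologicalClosure _ (h1 μ k l ν k' l'))
  have h3 : ∀ ξ η, K.VN.vecFunctional ξ η ∈ R.topologicalClosure := by
    intro ξ η
    let f : K.L2 →ₗ⋆[ℂ] StrongDual ℂ K.VN.toStarSubalgebra :=
      { toFun := fun ξ => K.VN.vecFunctional ξ η
        map_add' := fun a b => by
          ext x; simp [VonNeumannAlgebra.vecFunctional_apply]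
        map_smul' := fun c a => by
          ext x; simp [VonNeumannAlgebra.vecFunctional_apply, mul_comm] }
    have hf : Continuous f :=
      (f.mkContinuous ‖η‖ fun ξ => (hnorm ξ η).trans (le_of_eq (mul_comm _ _))).continuous
    have hsub : (Submodule.span ℂ K.coeffVecs : Set K.L2) ⊆ f ⁻¹' R.topologicalClosure := by
      refine SetLike.coe_subset_coe.mpr
        (Submodule.span_le (p := R.topologicalClosure.comap f).mpr ?_)
      rintro _ ⟨μ, k, l, rfl⟩
      exact h2 μ k l η
    exact closure_minimal hsub (hcl.preimage hf) (K.dense_span_coeffVecs ξ)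
  refine Submodule.topologicalClosure_minimal _ (Submodule.span_le.mpr ?_) hcl
  rintro ω ⟨ξ, η, h⟩
  have : ω = K.VN.vecFunctional ξ η := by ext x; exact h x
  rw [this]
  exact h3 ξ η

variable (K) in
/-- The linear map on `C^∞(K)` with prescribed values on the matrix coefficients. -/
def liftCoeff {M : Type*} [AddCommMonoid M] [Module ℂ M]
    (f : (μ : Irr A) → Fin μ.rep.dim → Fin μ.rep.dim → M) : A →ₗ[ℂ] M :=
  K.coeffBasis.constr ℂ fun x => f x.1 x.2.1 x.2.2

theorem liftCoeff_coeff {M : Type*} [AddCommMonoid M] [Module ℂ M]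
    (f : (μ : Irr A) → Fin μ.rep.dim → Fin μ.rep.dim → M) (μ : Irr A) (i j : Fin μ.rep.dim) :
    K.liftCoeff f (μ.rep.mat i j) = f μ i j := by
  rw [← coeffBasis_apply K, liftCoeff, Module.Basis.constr_basis]

variable (K) in
/-- The functional `a ∈ C^∞(K)` on `VN(K)`, with `u^μ_{ij}` acting as `entry μ i j`. -/
def toPredual : A →ₗ[ℂ] K.VN.predual :=
  K.liftCoeff K.entry

theorem toPredual_coeff (μ : Irr A) (i j : Fin μ.rep.dim) :
    K.toPredual (μ.rep.mat i j) = K.entry μ i j :=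
  liftCoeff_coeff _ μ i j

/-- For a = u_{ij}, the (i,j) entry of the slice of W at ξ, Λ(b) is ⟪ξ, Λ(u_{ij} b)⟫; the general
case is linear in a. -/
theorem fourier_toPredual (a b : A) :
    K.fourier (K.toPredual a : StrongDual ℂ K.VN.toStarSubalgebra) (K.Λ b) = K.Λ (a * b) := by
  let f : A →ₗ[ℂ] K.L2 := (LinearMap.applyₗ (K.Λ b) ∘ₗ ContinuousLinearMap.coeLM ℂ) ∘ₗ
    K.fourier ∘ₗ K.VN.predual.subtype ∘ₗ K.toPredual
  let g : A →ₗ[ℂ] K.L2 := K.Λ ∘ₗ LinearMap.mulRight ℂ b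
  refine congrArg (fun h => h a) (K.linearMap_ext (f := f) (g := g) fun μ i j => ?_)
  change K.fourier (K.toPredual (μ.rep.mat i j) : StrongDual ℂ K.VN.toStarSubalgebra) (K.Λ b) =
    K.Λ (μ.rep.mat i j * b)
  refine ext_inner_left ℂ fun ξ => ?_
  rw [inner_fourier, toPredual_coeff]
  exact entry_eq (x := K.sliceW ξ (K.Λ b)) (c := fun m => ⟪ξ, K.Λ (μ.rep.mat m j * b)⟫_ℂ)
    (K.slice_W_coeffVec ξ b μ j μ.idx) i

/-- The projection onto the blocks in a finite set. -/
theorem exists_finsetProj (F : Finset (Irr A)) : ∃ p : K.VN.toStarSubalgebra, ‖p‖ ≤ 1 ∧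
    (∀ μ ∈ F, ∀ k l, (p : K.L2 →L[ℂ] K.L2) (K.coeffVec μ k l) = K.coeffVec μ k l) ∧
    ∀ μ ∉ F, ∀ k l, (p : K.L2 →L[ℂ] K.L2) (K.coeffVec μ k l) = 0 := by
  let V : Submodule ℂ K.L2 := Submodule.span ℂ
    (Set.range fun x : Σ μ : F, Fin μ.1.rep.dim × Fin μ.1.rep.dim => K.coeffVec x.1 x.2.1 x.2.2)
  have hVfin : FiniteDimensional ℂ V := FiniteDimensional.span_of_finite ℂ (Set.finite_range _)
  have h1 : ∀ μ ∈ F, ∀ k l, V.starProjection (K.coeffVec μ k l) = K.coeffVec μ k l :=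
    fun μ hμ k l => Submodule.starProjection_eq_self_iff.mpr
      (Submodule.subset_span ⟨⟨⟨μ, hμ⟩, k, l⟩, rfl⟩)
  have h2 : ∀ μ ∉ F, ∀ k l, V.starProjection (K.coeffVec μ k l) = 0 := by
    intro μ hμ k l
    rw [Submodule.starProjection_apply_eq_zero_iff]
    change _ ∈ (Submodule.span ℂ _)ᗮ
    rw [Submodule.mem_orthogonal]
    intro v hv
    induction hv using Submodule.span_induction with
    | mem x hx =>
      obtain ⟨⟨ν, k', l'⟩, rfl⟩ := hx
      exact K.inner_coeffVec_of_ne (fun h : ν.1 = μ => hμ (h ▸ ν.2)) _ _ _ _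
    | zero => exact inner_zero_left _
    | add x y _ _ hx hy => rw [inner_add_left, hx, hy, add_zero]
    | smul c x _ hx => rw [inner_smul_left, hx, mul_zero]
  have hb : K.HasBlocks V.starProjection := by
    intro μ
    by_cases hμ : μ ∈ F
    · exact ⟨fun m k => if m = k then 1 else 0, fun k l => by simp [h1 μ hμ]⟩
    · exact ⟨fun m k => 0, fun k l => by simp [h2 μ hμ]⟩
  exact ⟨⟨V.starProjection, hb.mem_VN⟩, Submodule.starProjection_norm_le V, h1, h2⟩

variable (K) in
/-- The projection in `VN(K)` onto the blocks in a finite set. -/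
def finsetProj (F : Finset (Irr A)) : K.VN.toStarSubalgebra := (K.exists_finsetProj F).choose

theorem norm_finsetProj_le (F : Finset (Irr A)) : ‖K.finsetProj F‖ ≤ 1 :=
  (K.exists_finsetProj F).choose_spec.1

theorem finsetProj_coeffVec (F : Finset (Irr A)) (μ : Irr A) [Decidable (μ ∈ F)] (k l) :
    (K.finsetProj F : K.L2 →L[ℂ] K.L2) (K.coeffVec μ k l) =
      if μ ∈ F then K.coeffVec μ k l else 0 := by
  split_ifs with h
  · exact (K.exists_finsetProj F).choose_spec.2.1 μ h k l
  · exact (K.exists_finsetProj F).choose_spec.2.2 μ h k l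

theorem coe_mul_apply (x y : K.VN.toStarSubalgebra) (ξ : K.L2) :
    ((x * y : K.VN.toStarSubalgebra) : K.L2 →L[ℂ] K.L2) ξ =
      (x : K.L2 →L[ℂ] K.L2) ((y : K.L2 →L[ℂ] K.L2) ξ) := rfl

theorem predual_smul_apply (c : ℂ) (ω : K.VN.predual) (x : K.VN.toStarSubalgebra) :
    ((c • ω : K.VN.predual) : StrongDual ℂ K.VN.toStarSubalgebra) x =
      c * (ω : StrongDual ℂ K.VN.toStarSubalgebra) x := rfl

theorem predual_add_apply (ω ω' : K.VN.predual) (x : K.VN.toStarSubalgebra) :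
    ((ω + ω' : K.VN.predual) : StrongDual ℂ K.VN.toStarSubalgebra) x =
      (ω : StrongDual ℂ K.VN.toStarSubalgebra) x +
        (ω' : StrongDual ℂ K.VN.toStarSubalgebra) x := rfl

theorem norm_smul_subtypeL {E : Type*} [NormedAddCommGroup E] [NormedSpace ℂ E]
    {V : Submodule ℂ E} [Nontrivial V] (c : ℂ) : ‖c • V.subtypeL‖ = ‖c‖ := by
  refine le_antisymm (ContinuousLinearMap.opNorm_le_bound _ (norm_nonneg _) fun v =>
    (norm_smul c (v : E)).le) ?_
  obtain ⟨v, hv⟩ := exists_ne (0 : V)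
  have h : ‖c • (v : E)‖ ≤ ‖c • V.subtypeL‖ * ‖v‖ := (c • V.subtypeL).le_opNorm v
  rw [norm_smul] at h
  exact le_of_mul_le_mul_right h (norm_pos_iff.mpr hv : 0 < ‖v‖)

/-- Evaluation of normal functionals at an element of `VN(K)`. -/
def predualEval (x : K.VN.toStarSubalgebra) : K.VN.predual →ₗ[ℂ] ℂ where
  toFun ω := (ω : StrongDual ℂ K.VN.toStarSubalgebra) x
  map_add' ω ω' := predual_add_apply ω ω' x
  map_smul' c ω := predual_smul_apply c ω x

theorem predualEval_apply (x : K.VN.toStarSubalgebra) (ω : K.VN.predual) :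
    predualEval x ω = (ω : StrongDual ℂ K.VN.toStarSubalgebra) x := rfl

/-! ### Central weights and the embedding of `C^∞(K)` into the weighted predual -/

namespace DualWeight

variable {w : K.DualWeight}

/-- Put x = w⁻¹y: then ⟪w⁻¹y, y⟫ = ⟪x, w x⟫, which is positive by strict positivity of w. -/
theorem inner_inv_pos (w : K.DualWeight) {y : K.L2} (hy : y ≠ 0) :
    0 < ⟪(w.inv : K.L2 →L[ℂ] K.L2) y, y⟫_ℂ := by
  obtain ⟨h, hop⟩ := w.op_inv y
  have h0 : (w.inv : K.L2 →L[ℂ] K.L2) y ≠ 0 := by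
    intro h0
    apply hy
    rw [← hop]
    have : (⟨(w.inv : K.L2 →L[ℂ] K.L2) y, h⟩ : w.op.domain) = 0 := Subtype.ext h0
    rw [this]
    exact map_zero w.op.toFun
  have := w.strictly_positive ⟨_, h⟩ h0
  rwa [hop] at this

theorem adjoint_inv (w : K.DualWeight) :
    (w.inv : K.L2 →L[ℂ] K.L2).adjoint = (w.inv : K.L2 →L[ℂ] K.L2) := by
  have h : ((w.inv : K.L2 →L[ℂ] K.L2) : K.L2 →ₗ[ℂ] K.L2).IsSymmetric := by
    rw [LinearMap.isSymmetric_iff_inner_map_self_real]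
    intro y
    by_cases hy : y = 0
    · simp [hy]
    · have := w.inner_inv_pos hy
      exact Complex.conj_eq_iff_im.mpr (Complex.pos_iff.mp this).2.symm
  exact (ContinuousLinearMap.isSelfAdjoint_iff_isSymmetric.mpr h).star_eq

/-- Commuting with the matrix units ω_{k0} forces w⁻¹ to act on the block by a single scalar c, and
positivity of w⁻¹ gives c > 0. The norm in `component` then equals c, so w(μ) = c⁻¹. -/
theorem component_pos_and_inv_coeffVec (hw : w.IsCentral) (μ : Irr A) : 0 < w.component μ ∧
    ∀ k l, (w.inv : K.L2 →L[ℂ] K.L2) (K.coeffVec μ k l) =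
      ((w.component μ : ℂ))⁻¹ • K.coeffVec μ k l := by
  set c : ℂ := (K.entry μ μ.idx μ.idx : StrongDual ℂ K.VN.toStarSubalgebra) w.inv with hcdef
  have h1 : ∀ k l, (w.inv : K.L2 →L[ℂ] K.L2) (K.coeffVec μ k l) = c • K.coeffVec μ k l := by
    intro k l
    have h := congrArg (fun x : K.VN.toStarSubalgebra =>
      (x : K.L2 →L[ℂ] K.L2) (K.coeffVec μ μ.idx l))
      (hw ⟨K.matUnit μ k μ.idx, K.matUnit_mem_VN μ k μ.idx⟩)
    simp only [coe_mul_apply, matUnit_coeffVec, if_true] at h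
    rw [h, apply_coeffVec, map_sum]
    simp [matUnit_coeffVec, hcdef]
  have hv := K.coeffVec_ne_zero μ μ.idx μ.idx
  have hcpos : 0 < c := by
    have h2 := w.inner_inv_pos hv
    rw [h1, inner_smul_left, inner_self_eq_norm_sq_to_K] at h2
    have h3 : (0 : ℂ) < ((‖K.coeffVec μ μ.idx μ.idx‖ : ℂ)) ^ 2 := by
      have : 0 < ‖K.coeffVec μ μ.idx μ.idx‖ ^ 2 := by positivity
      exact_mod_cast this
    have h4 : 0 < (starRingEnd ℂ) c := pos_of_mul_pos_left h2 h3.le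
    have h5 := Complex.pos_iff.mp h4
    rw [Complex.pos_iff]
    simpa [eq_comm] using h5
  have hcre : ((c.re : ℝ) : ℂ) = c := by
    apply Complex.ext <;> simp [(Complex.pos_iff.mp hcpos).2]
  have hcomp : w.component μ = (c.re)⁻¹ := by
    rw [component]
    congr 1
    have : (w.inv : K.L2 →L[ℂ] K.L2) ∘L (K.block μ).subtypeL = c • (K.block μ).subtypeL := by
      ext ⟨ξ, hξ⟩
      change (w.inv : K.L2 →L[ℂ] K.L2) ξ = c • ξ
      induction hξ using Submodule.span_induction with
      | mem x hx =>
        obtain ⟨k, l, rfl⟩ := hx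
        exact h1 k l
      | zero => simp
      | add x y _ _ hx hy => rw [map_add, smul_add, hx, hy]
      | smul d x _ hx => rw [map_smul, hx, smul_comm]
    have hnt : Nontrivial (K.block μ) :=
      ⟨⟨K.coeffVec μ μ.idx μ.idx, Submodule.subset_span ⟨_, _, rfl⟩⟩, 0,
        fun h => hv (congrArg Subtype.val h)⟩
    have hn : ‖c • (K.block μ).subtypeL‖ = ‖c‖ := norm_smul_subtypeL c
    rw [this, hn, ← hcre, Complex.norm_real,
      Real.norm_of_nonneg (Complex.pos_iff.mp hcpos).1.le, Complex.ofReal_re]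
  refine ⟨by rw [hcomp]; exact inv_pos.mpr (Complex.pos_iff.mp hcpos).1, fun k l => ?_⟩
  rw [h1, hcomp, Complex.ofReal_inv, inv_inv, hcre]

theorem component_pos (hw : w.IsCentral) (μ : Irr A) : 0 < w.component μ :=
  (component_pos_and_inv_coeffVec hw μ).1

theorem component_ne_zero (hw : w.IsCentral) (μ : Irr A) : ((w.component μ : ℂ)) ≠ 0 :=
  Complex.ofReal_ne_zero.mpr (component_pos hw μ).ne'

theorem inv_coeffVec (hw : w.IsCentral) (μ : Irr A) (k l) :
    (w.inv : K.L2 →L[ℂ] K.L2) (K.coeffVec μ k l) = ((w.component μ : ℂ))⁻¹ • K.coeffVec μ k l :=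
  (component_pos_and_inv_coeffVec hw μ).2 k l

theorem entry_mul_inv (hw : w.IsCentral) (μ : Irr A) (i j) (x : K.VN.toStarSubalgebra) :
    (K.entry μ i j : StrongDual ℂ K.VN.toStarSubalgebra) (x * w.inv) =
      ((w.component μ : ℂ))⁻¹ * (K.entry μ i j : StrongDual ℂ K.VN.toStarSubalgebra) x := by
  refine entry_eq (c := fun m => ((w.component μ : ℂ))⁻¹ *
    (K.entry μ m j : StrongDual ℂ K.VN.toStarSubalgebra) x) ?_ i
  rw [coe_mul_apply, inv_coeffVec hw, map_smul, apply_coeffVec, Finset.smul_sum]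
  simp only [smul_smul]

variable (w) in
/-- The functional `ω_a ∈ VN(K)_*` with `(id ⊗ w⁻¹ω_a)(W) = a`, for `a ∈ C^∞(K)`. -/
def toPredual : A →ₗ[ℂ] K.VN.predual :=
  K.liftCoeff fun μ i j => (w.component μ : ℂ) • K.entry μ i j

theorem toPredual_coeff (μ : Irr A) (i j : Fin μ.rep.dim) :
    w.toPredual (μ.rep.mat i j) = (w.component μ : ℂ) • K.entry μ i j :=
  liftCoeff_coeff _ μ i j

theorem smulInv_apply (ω : StrongDual ℂ K.VN.toStarSubalgebra) (x : K.VN.toStarSubalgebra) :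
    w.smulInv ω x = ω (x * w.inv) := rfl

/-- On coefficients, the factor w(μ) built into ω_a cancels the scalar w(μ)⁻¹ of w⁻¹. -/
theorem toPredual_mul_inv (hw : w.IsCentral) (a : A) (x : K.VN.toStarSubalgebra) :
    (w.toPredual a : StrongDual ℂ K.VN.toStarSubalgebra) (x * w.inv) =
      (K.toPredual a : StrongDual ℂ K.VN.toStarSubalgebra) x := by
  have h := K.linearMap_ext (f := predualEval (x * w.inv) ∘ₗ w.toPredual)
    (g := predualEval x ∘ₗ K.toPredual) fun μ i j => by
      change (w.toPredual (μ.rep.mat i j) : StrongDual ℂ K.VN.toStarSubalgebra) (x * w.inv) =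
        (K.toPredual (μ.rep.mat i j) : StrongDual ℂ K.VN.toStarSubalgebra) x
      rw [toPredual_coeff, CompactQuantumGroup.toPredual_coeff, predual_smul_apply,
        entry_mul_inv hw, mul_inv_cancel_left₀ (component_ne_zero hw μ)]
  exact LinearMap.congr_fun h a

theorem smulInv_toPredual (hw : w.IsCentral) (a : A) :
    w.smulInv (w.toPredual a : StrongDual ℂ K.VN.toStarSubalgebra) =
      (K.toPredual a : StrongDual ℂ K.VN.toStarSubalgebra) :=
  ContinuousLinearMap.ext fun x => toPredual_mul_inv hw a x

theorem fourier_toPredual (hw : w.IsCentral) (a : A) :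
    w.fourier (w.toPredual a) =
      K.fourier (K.toPredual a : StrongDual ℂ K.VN.toStarSubalgebra) := by
  rw [← smulInv_toPredual hw]
  rfl

theorem toPredual_inv_smul_coeff (hw : w.IsCentral) (μ : Irr A) (i j : Fin μ.rep.dim) :
    w.toPredual (((w.component μ : ℂ))⁻¹ • μ.rep.mat i j) = K.entry μ i j :=
  (map_smul w.toPredual _ _).trans
    (by rw [toPredual_coeff, inv_smul_smul₀ (component_ne_zero hw μ)])

theorem denseRange_toPredual (hw : w.IsCentral) : DenseRange w.toPredual := by
  have h := predual_le_closure (K := K)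
    (R := (LinearMap.range w.toPredual).map K.VN.predual.subtype) (fun μ i j =>
      ⟨K.entry μ i j, ⟨_, toPredual_inv_smul_coeff hw μ i j⟩, rfl⟩)
  intro ω
  rw [Metric.mem_closure_iff]
  intro ε hε
  obtain ⟨_, ⟨_, ⟨a, rfl⟩, rfl⟩, ha⟩ := Metric.mem_closure_iff.mp (h ω.2) ε hε
  exact ⟨_, ⟨a, rfl⟩, ha⟩

/-- The functionals `ω_a` are supported on finitely many blocks. -/
theorem exists_finset_toPredual (a : A) :
    ∃ F : Finset (Irr A), ∀ G, F ⊆ G → ∀ x : K.VN.toStarSubalgebra,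
      (w.toPredual a : StrongDual ℂ K.VN.toStarSubalgebra) (x * K.finsetProj G) =
        (w.toPredual a : StrongDual ℂ K.VN.toStarSubalgebra) x := by
  classical
  have ha : a ∈ coeffSpan A := by rw [K.coeffSpan_eq_top]; trivial
  obtain ⟨L, hL⟩ : ∃ L : K.VN.toStarSubalgebra → A →ₗ[ℂ] ℂ, ∀ x a,
      (w.toPredual a : StrongDual ℂ K.VN.toStarSubalgebra) x = L x a :=
    ⟨fun x => predualEval x ∘ₗ w.toPredual, fun _ _ => rfl⟩
  have h1 : ∀ μ i j, ∀ G : Finset (Irr A), μ ∈ G → ∀ x : K.VN.toStarSubalgebra,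
      L (x * K.finsetProj G) (μ.rep.mat i j) = L x (μ.rep.mat i j) := by
    intro μ i j G hG x
    have h2 : ∀ y, L y (μ.rep.mat i j) = (w.component μ : ℂ) *
        (K.entry μ i j : StrongDual ℂ K.VN.toStarSubalgebra) y := fun y => by
      rw [← hL, toPredual_coeff]; rfl
    rw [h2 (x * _), h2 x, entry_apply, entry_apply, coe_mul_apply, finsetProj_coeffVec, if_pos hG]
  simp only [hL]
  clear hL
  induction ha using Submodule.span_induction with
  | mem b hb =>
    obtain ⟨⟨μ, i, j⟩, rfl⟩ := hb
    exact ⟨{μ}, fun G hG x => h1 μ i j G (hG (Finset.mem_singleton_self μ)) x⟩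
  | zero => exact ⟨∅, fun G _ x => by simp only [map_zero]⟩
  | add b c _ _ hb hc =>
    obtain ⟨F, hF⟩ := hb
    obtain ⟨F', hF'⟩ := hc
    refine ⟨F ∪ F', fun G hG x => ?_⟩
    simp only [map_add, hF G (Finset.union_subset_left hG), hF' G (Finset.union_subset_right hG)]
  | smul c b _ hb =>
    obtain ⟨F, hF⟩ := hb
    refine ⟨F, fun G hG x => ?_⟩
    simp only [map_smul, hF G hG]

/-- On finitely many blocks the possibly unbounded w becomes bounded: y = ∑_{μ ∈ F} w(μ) P_μ. -/
theorem exists_mul_inv_eq (hw : w.IsCentral) (F : Finset (Irr A)) :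
    ∃ y : K.VN.toStarSubalgebra, y * w.inv = K.finsetProj F := by
  classical
  refine ⟨∑ μ ∈ F, (w.component μ : ℂ) • ⟨K.blockProj μ, blockProj_mem_VN μ⟩,
    VN_ext fun ν k l => ?_⟩
  rw [coe_mul_apply, inv_coeffVec hw, map_smul, finsetProj_coeffVec]
  have h : ((∑ μ ∈ F, (w.component μ : ℂ) • (⟨K.blockProj μ, blockProj_mem_VN μ⟩ :
      K.VN.toStarSubalgebra) : K.VN.toStarSubalgebra) : K.L2 →L[ℂ] K.L2) =
      ∑ μ ∈ F, (w.component μ : ℂ) • K.blockProj μ := by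
    rw [AddSubmonoidClass.coe_finsetSum]
    rfl
  rw [h, sum_apply]
  split_ifs with hν
  · rw [Finset.sum_eq_single_of_mem ν hν]
    · rw [smul_apply, blockProj_coeffVec,
        inv_smul_smul₀ (component_ne_zero hw ν)]
    · intro μ _ hμ
      rw [smul_apply, blockProj_coeffVec_of_ne hμ, smul_zero]
  · rw [Finset.sum_eq_zero, smul_zero]
    intro μ hμ
    rw [smul_apply, blockProj_coeffVec_of_ne (fun h : μ = ν => hν (h ▸ hμ)), smul_zero]

/-- An element of `VN(K)` cut down to finitely many blocks is a combination of matrix units. -/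
theorem mul_finsetProj (F : Finset (Irr A)) (x : K.VN.toStarSubalgebra) :
    x * K.finsetProj F = ∑ μ ∈ F, ∑ i, ∑ j,
        (K.entry μ i j : StrongDual ℂ K.VN.toStarSubalgebra) x •
          (⟨K.matUnit μ i j, K.matUnit_mem_VN μ i j⟩ : K.VN.toStarSubalgebra) := by
  classical
  refine VN_ext fun ν k l => ?_
  rw [coe_mul_apply, finsetProj_coeffVec]
  have e : ((∑ μ ∈ F, ∑ i, ∑ j, (K.entry μ i j : StrongDual ℂ K.VN.toStarSubalgebra) x •
      (⟨K.matUnit μ i j, K.matUnit_mem_VN μ i j⟩ : K.VN.toStarSubalgebra) :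
      K.VN.toStarSubalgebra) : K.L2 →L[ℂ] K.L2) = ∑ μ ∈ F, ∑ i, ∑ j,
      (K.entry μ i j : StrongDual ℂ K.VN.toStarSubalgebra) x • K.matUnit μ i j := by
    simp only [AddSubmonoidClass.coe_finsetSum]
    rfl
  rw [e]
  simp only [sum_apply, smul_apply]
  split_ifs with hν
  · rw [Finset.sum_eq_single_of_mem ν hν]
    · rw [apply_coeffVec]
      simp [matUnit_coeffVec]
    · intro μ _ hμ
      simp [K.matUnit_coeffVec_of_ne hμ]
  · rw [map_zero, Finset.sum_eq_zero]
    intro μ hμ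
    have hμν : μ ≠ ν := fun h => hν (h ▸ hμ)
    simp [K.matUnit_coeffVec_of_ne hμν]

/-- Normal functionals are approximated by their restrictions to finitely many blocks. -/
theorem exists_finset_norm_sub_le (hw : w.IsCentral) (ω : K.VN.predual)
    (x : K.VN.toStarSubalgebra) {ε : ℝ} (hε : 0 < ε) : ∃ F : Finset (Irr A),
      ‖(ω : StrongDual ℂ K.VN.toStarSubalgebra) (x - x * K.finsetProj F)‖ ≤ ε := by
  -- The constant comes from ‖x − x p‖ ≤ 2‖x‖, where p is the projection onto the blocks in F; the
  -- added 1 keeps the denominator positive when x = 0.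
  obtain ⟨a, ha⟩ := Metric.denseRange_iff.mp (denseRange_toPredual hw) ω
    (ε / (2 * (‖x‖ + 1))) (by positivity)
  obtain ⟨F, hFa⟩ := exists_finset_toPredual (w := w) a
  refine ⟨F, ?_⟩
  have hδ : ‖(ω : StrongDual ℂ K.VN.toStarSubalgebra) -
      (w.toPredual a : StrongDual ℂ K.VN.toStarSubalgebra)‖ ≤ ε / (2 * (‖x‖ + 1)) := by
    rw [dist_eq_norm] at ha; exact ha.le
  generalize (w.toPredual a : StrongDual ℂ K.VN.toStarSubalgebra) = α at hδ hFa
  generalize (ω : StrongDual ℂ K.VN.toStarSubalgebra) = β at hδ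
  have e : β (x - x * K.finsetProj F) = (β - α) (x - x * K.finsetProj F) := by
    have h1 := hFa F subset_rfl x
    have h2 : α (x - x * K.finsetProj F) = 0 := by rw [map_sub, h1, sub_self]
    change _ = β (x - x * K.finsetProj F) - α (x - x * K.finsetProj F)
    rw [h2, sub_zero]
  have hx : ‖x - x * K.finsetProj F‖ ≤ 2 * ‖x‖ := by
    calc ‖x - x * K.finsetProj F‖ ≤ ‖x‖ + ‖x * K.finsetProj F‖ := norm_sub_le _ _
      _ ≤ ‖x‖ + ‖x‖ * ‖K.finsetProj F‖ := by gcongr; exact norm_mul_le _ _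
      _ ≤ ‖x‖ + ‖x‖ * 1 := by gcongr; exact norm_finsetProj_le F
      _ = 2 * ‖x‖ := by ring
  rw [e]
  generalize x - x * K.finsetProj F = z at hx
  calc ‖(β - α) z‖ ≤ ‖β - α‖ * ‖z‖ := ContinuousLinearMap.le_opNorm _ _
    _ ≤ ε / (2 * (‖x‖ + 1)) * (2 * ‖x‖) := by gcongr
    _ ≤ ε / (2 * (‖x‖ + 1)) * (2 * (‖x‖ + 1)) := by gcongr; linarith
    _ = ε := by field_simp

/-- A normal functional that vanishes on all matrix units is zero. -/
theorem predual_eq_zero (hw : w.IsCentral) {ω : K.VN.predual}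
    (h : ∀ μ i j, (ω : StrongDual ℂ K.VN.toStarSubalgebra)
      ⟨K.matUnit μ i j, K.matUnit_mem_VN μ i j⟩ = 0) : ω = 0 := by
  have hF : ∀ (F : Finset (Irr A)) (x : K.VN.toStarSubalgebra),
      (ω : StrongDual ℂ K.VN.toStarSubalgebra) (x * K.finsetProj F) = 0 := by
    intro F x
    rw [mul_finsetProj]
    simp only [map_sum, map_smul, h, smul_zero, Finset.sum_const_zero]
  refine Subtype.ext (ContinuousLinearMap.ext fun x => ?_)
  change (ω : StrongDual ℂ K.VN.toStarSubalgebra) x = 0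
  rw [← norm_le_zero_iff]
  refine le_of_forall_pos_le_add fun ε hε => ?_
  obtain ⟨F, hF'⟩ := exists_finset_norm_sub_le hw ω x hε
  rwa [map_sub, hF, sub_zero, ← zero_add ε] at hF'

/-- Evaluate (id ⊗ w⁻¹ω)(W) between a dual element of u^μ_{ij} and Λ(1). The result is w(μ)⁻¹
ω(ω^μ_{ij}), so ω vanishes on all matrix units and hence is zero. -/
theorem fourier_injective (hw : w.IsCentral) : Function.Injective w.fourier := by
  rw [injective_iff_map_eq_zero]
  intro ω hω
  refine predual_eq_zero hw fun μ i j => ?_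
  have h := K.inner_fourier (w.smulInv (ω : StrongDual ℂ K.VN.toStarSubalgebra))
    (K.Λ (K.exists_haar_star_mul_dual μ i j).choose) (K.Λ 1)
  have h0 : K.fourier (w.smulInv (ω : StrongDual ℂ K.VN.toStarSubalgebra)) = 0 := hω
  rw [h0, zero_apply, inner_zero_right, smulInv_apply] at h
  have e : K.sliceW (K.Λ (K.exists_haar_star_mul_dual μ i j).choose) (K.Λ 1) * w.inv =
      ((w.component μ : ℂ))⁻¹ • (⟨K.matUnit μ i j, K.matUnit_mem_VN μ i j⟩ :
        K.VN.toStarSubalgebra) := by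
    refine VN_ext fun ν k l => ?_
    change K.matUnit μ i j ((w.inv : K.L2 →L[ℂ] K.L2) (K.coeffVec ν k l)) =
      ((w.component μ : ℂ))⁻¹ • K.matUnit μ i j (K.coeffVec ν k l)
    rw [inv_coeffVec hw, map_smul]
    by_cases hν : μ = ν
    · subst hν; rfl
    · rw [K.matUnit_coeffVec_of_ne hν, smul_zero, smul_zero]
  rw [e, map_smul, smul_eq_mul] at h
  rcases mul_eq_zero.mp h.symm with h | h
  · exact absurd h (inv_ne_zero (component_ne_zero hw μ))
  · exact h

end DualWeight

end CompactQuantumGroup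

end Predual

/-! ### The dual comultiplication and the product of `C^∞(K)` -/

noncomputable section DualComultiplication

open HilbertTensor

variable {A : Type*} [Ring A] [StarRing A] [HopfAlgebra ℂ A] [StarModule ℂ A]

namespace CompactQuantumGroup

variable {K : CompactQuantumGroup A}

variable (K) in
-- Through the antipode the coefficient vectors depend linearly on the coefficient, so the action of
-- VN(K) can be written as a convolution and applied to products.
theorem Λ_antipode_coeff (μ : Irr A) (k l : Fin μ.rep.dim) :
    K.Λ (HopfAlgebra.antipode ℂ (μ.rep.mat l k)) = K.coeffVec μ k l := by
  rw [μ.isUnitaryCorep.antipode, coeffVec]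

/-- The functional on `C^∞(K)` defined by an element of `VN(K)`. -/
def pairing (x : K.VN.toStarSubalgebra) : A →ₗ[ℂ] ℂ := predualEval x ∘ₗ K.toPredual

theorem pairing_apply (x : K.VN.toStarSubalgebra) (a : A) :
    pairing x a = (K.toPredual a : StrongDual ℂ K.VN.toStarSubalgebra) x := rfl

theorem pairing_coeff (x : K.VN.toStarSubalgebra) (μ : Irr A) (i j : Fin μ.rep.dim) :
    pairing x (μ.rep.mat i j) = (K.entry μ i j : StrongDual ℂ K.VN.toStarSubalgebra) x := by
  rw [pairing_apply, toPredual_coeff]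

/-- An element of `VN(K)` acts on `Λ(S(c))` by convolution with a functional on `C^∞(K)`. -/
theorem apply_Λ_antipode (x : K.VN.toStarSubalgebra) (c : A) :
    (x : K.L2 →L[ℂ] K.L2) (K.Λ (HopfAlgebra.antipode ℂ c)) =
      K.Λ (HopfAlgebra.antipode ℂ (TensorProduct.rid ℂ A
        ((pairing x).lTensor A (Coalgebra.comul (R := ℂ) c)))) := by
  let f : A →ₗ[ℂ] K.L2 := (x : K.L2 →L[ℂ] K.L2).toLinearMap ∘ₗ K.Λ ∘ₗ HopfAlgebra.antipode ℂ
  let g : A →ₗ[ℂ] K.L2 := K.Λ ∘ₗ HopfAlgebra.antipode ℂ ∘ₗ (TensorProduct.rid ℂ A).toLinearMap ∘ₗ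
    (pairing x).lTensor A ∘ₗ Coalgebra.comul (R := ℂ)
  refine LinearMap.congr_fun (K.linearMap_ext (f := f) (g := g) fun μ l k => ?_) c
  change (x : K.L2 →L[ℂ] K.L2) (K.Λ (HopfAlgebra.antipode ℂ (μ.rep.mat l k))) =
    K.Λ (HopfAlgebra.antipode ℂ (TensorProduct.rid ℂ A ((pairing x).lTensor A
      (Coalgebra.comul (R := ℂ) (μ.rep.mat l k)))))
  rw [Λ_antipode_coeff, apply_coeffVec, μ.rep.comul_mat]
  simp only [map_sum, LinearMap.lTensor_tmul, TensorProduct.rid_tmul, map_smul, Λ_antipode_coeff]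
  refine Finset.sum_congr rfl fun m _ => ?_
  rw [pairing_coeff]

/-- Since S reverses products, (u^ν_{ps})* (u^μ_{kl})* = S(u^μ_{lk} u^ν_{sp}). The convolution
formula applies, and the coproduct of the product is a double sum. -/
theorem apply_Λ_star_mul_star (x : K.VN.toStarSubalgebra) (μ ν : Irr A) (k l : Fin μ.rep.dim)
    (p s : Fin ν.rep.dim) :
    (x : K.L2 →L[ℂ] K.L2) (K.Λ (star (ν.rep.mat p s) * star (μ.rep.mat k l))) =
      ∑ r, ∑ m, pairing x (μ.rep.mat m k * ν.rep.mat r p) •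
          K.Λ (star (ν.rep.mat r s) * star (μ.rep.mat m l)) := by
  have hS : ∀ p k, star (ν.rep.mat p s) * star (μ.rep.mat k l) =
      HopfAlgebra.antipode ℂ (μ.rep.mat l k * ν.rep.mat s p) := fun p k => by
    rw [HopfAlgebra.antipode_mul_antidistrib, μ.isUnitaryCorep.antipode,
      ν.isUnitaryCorep.antipode]
  simp only [hS]
  rw [apply_Λ_antipode]
  generalize pairing x = f
  rw [Bialgebra.comul_mul, μ.rep.comul_mat, ν.rep.comul_mat, Finset.sum_mul_sum, Finset.sum_comm]
  simp only [map_sum, Algebra.TensorProduct.tmul_mul_tmul, LinearMap.lTensor_tmul,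
    TensorProduct.rid_tmul, map_smul]

variable (K) in
/-- The operator `Ŵ = Σ W* Σ`. -/
def dualW : HilbertTensor K.L2 K.L2 →L[ℂ] HilbertTensor K.L2 K.L2 :=
  swap K.L2 K.L2 ∘L K.W.adjoint ∘L swap K.L2 K.L2

variable (K) in
theorem dualComul_eq (x : K.L2 →L[ℂ] K.L2) : K.dualComul x =
    K.dualW.adjoint ∘L HilbertTensor.map (ContinuousLinearMap.id ℂ K.L2) x ∘L K.dualW := rfl

variable (K) in
theorem adjoint_dualW : K.dualW.adjoint = swap K.L2 K.L2 ∘L K.W ∘L swap K.L2 K.L2 := by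
  rw [dualW, ContinuousLinearMap.adjoint_comp, ContinuousLinearMap.adjoint_comp,
    ContinuousLinearMap.adjoint_adjoint, adjoint_swap, ContinuousLinearMap.comp_assoc]

variable (K) in
theorem swap_swap_apply (ζ : HilbertTensor K.L2 K.L2) :
    swap K.L2 K.L2 (swap K.L2 K.L2 ζ) = ζ :=
  congrArg (fun f => f ζ) swap_comp_swap

variable (K) in
theorem adjoint_dualW_apply (ζ : HilbertTensor K.L2 K.L2) : K.dualW.adjoint (K.dualW ζ) = ζ := by
  rw [adjoint_dualW, dualW]
  simp only [ContinuousLinearMap.comp_apply, swap_swap_apply, W_adjoint_apply]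

variable (K) in
theorem dualW_adjoint_apply (ζ : HilbertTensor K.L2 K.L2) : K.dualW (K.dualW.adjoint ζ) = ζ := by
  have h : ∀ ζ, K.W.adjoint (K.W ζ) = ζ := fun ζ => congrArg (fun f => f ζ) K.W_adjoint_comp
  rw [adjoint_dualW, dualW]
  simp only [ContinuousLinearMap.comp_apply, swap_swap_apply, h]

theorem dualW_coeffVec (ν μ : Irr A) (p q : Fin ν.rep.dim) (k l : Fin μ.rep.dim) :
    K.dualW (tmul (K.coeffVec ν p q) (K.coeffVec μ k l)) =
      ∑ s, tmul (K.coeffVec ν s q) (K.Λ (star (ν.rep.mat p s) * star (μ.rep.mat k l))) := by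
  rw [dualW, ContinuousLinearMap.comp_apply, ContinuousLinearMap.comp_apply, swap_tmul,
    coeffVec.eq_1 K μ, W_adjoint_coeffVec, map_sum]
  simp only [swap_tmul]

/-- The comultiplication of `VN(K)` is dual to the product of `C^∞(K)`. -/
theorem dualComul_coeffVec (x : K.VN.toStarSubalgebra) (ν μ : Irr A) (p q : Fin ν.rep.dim)
    (k l : Fin μ.rep.dim) :
    K.dualComul (x : K.L2 →L[ℂ] K.L2) (tmul (K.coeffVec ν p q) (K.coeffVec μ k l)) =
      ∑ r, ∑ m, pairing x (μ.rep.mat m k * ν.rep.mat r p) •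
          tmul (K.coeffVec ν r q) (K.coeffVec μ m l) := by
  rw [dualComul_eq, ContinuousLinearMap.comp_apply, ContinuousLinearMap.comp_apply,
    dualW_coeffVec, map_sum]
  simp only [map_tmul, apply_Λ_star_mul_star, ContinuousLinearMap.id_apply, tmul_sum, tmul_smul]
  generalize pairing x = f
  rw [Finset.sum_comm]
  -- The sum over s reassembles Ŵ(Λ((u^ν_{rq})*) ⊗ Λ((u^μ_{ml})*)), which the final Ŵ* undoes.
  have : ∀ r m, ∑ s, f (μ.rep.mat m k * ν.rep.mat r p) • tmul (K.coeffVec ν s q)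
          (K.Λ (star (ν.rep.mat r s) * star (μ.rep.mat m l))) =
      f (μ.rep.mat m k * ν.rep.mat r p) •
        K.dualW (tmul (K.coeffVec ν r q) (K.coeffVec μ m l)) := fun r m => by
    rw [dualW_coeffVec, Finset.smul_sum]
  rw [Finset.sum_congr rfl fun r _ => Finset.sum_comm]
  simp only [this, map_sum, map_smul, adjoint_dualW_apply]

theorem dualComul_mul (x y : K.L2 →L[ℂ] K.L2) :
    K.dualComul (x ∘L y) = K.dualComul x ∘L K.dualComul y := by
  refine ContinuousLinearMap.ext fun ζ => ?_
  have h : HilbertTensor.map (ContinuousLinearMap.id ℂ K.L2) (x ∘L y) =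
      HilbertTensor.map (ContinuousLinearMap.id ℂ K.L2) x ∘L
        HilbertTensor.map (ContinuousLinearMap.id ℂ K.L2) y := by
    rw [map_comp_map, ContinuousLinearMap.id_comp]
  simp only [dualComul_eq, h, ContinuousLinearMap.comp_apply, dualW_adjoint_apply]

theorem adjoint_dualComul (x : K.L2 →L[ℂ] K.L2) :
    (K.dualComul x).adjoint = K.dualComul x.adjoint := by
  rw [dualComul_eq, dualComul_eq, ContinuousLinearMap.adjoint_comp,
    ContinuousLinearMap.adjoint_comp, ContinuousLinearMap.adjoint_adjoint, adjoint_map,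
    ContinuousLinearMap.adjoint_id, ContinuousLinearMap.comp_assoc]

theorem norm_dualW_apply (ζ : HilbertTensor K.L2 K.L2) : ‖K.dualW ζ‖ = ‖ζ‖ := by
  have h : ⟪K.dualW ζ, K.dualW ζ⟫_ℂ = ⟪ζ, ζ⟫_ℂ := by
    rw [← ContinuousLinearMap.adjoint_inner_right, adjoint_dualW_apply]
  rw [inner_self_eq_norm_sq_to_K, inner_self_eq_norm_sq_to_K] at h
  have h' : ‖K.dualW ζ‖ ^ 2 = ‖ζ‖ ^ 2 := by exact_mod_cast h
  exact (sq_eq_sq₀ (norm_nonneg _) (norm_nonneg _)).mp h'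

theorem norm_dualComul_apply_le (x : K.L2 →L[ℂ] K.L2) (ζ : HilbertTensor K.L2 K.L2) :
    ‖K.dualComul x ζ‖ ≤ ‖x‖ * ‖ζ‖ := by
  rw [← norm_dualW_apply, dualComul_eq, ContinuousLinearMap.comp_apply,
    ContinuousLinearMap.comp_apply, dualW_adjoint_apply]
  refine (ContinuousLinearMap.le_opNorm _ _).trans ?_
  rw [norm_dualW_apply]
  gcongr
  refine (norm_map_le _ _).trans ?_
  calc _ ≤ 1 * ‖x‖ := by gcongr; exact ContinuousLinearMap.norm_id_le
    _ = ‖x‖ := one_mul _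

section DualSlice

variable {E : Type*} [NormedAddCommGroup E] [InnerProductSpace ℂ E] [CompleteSpace E]

/-- The right slice `(id ⊗ ω)(y)` of an operator `y` on `E ⊗ L²(K)` whose left slices belong to
`VN(K)`. -/
theorem exists_rightSlice {y : HilbertTensor E K.L2 →L[ℂ] HilbertTensor E K.L2}
    (hy : ∀ ξ η, slice y ξ η ∈ K.VN.toStarSubalgebra) (ω : StrongDual ℂ K.VN.toStarSubalgebra) :
    ∃ D : E →L[ℂ] E, ‖D‖ ≤ ‖ω‖ * ‖y‖ ∧ ∀ ξ η, ⟪ξ, D η⟫_ℂ = ω ⟨slice y ξ η, hy ξ η⟩ := by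
  have hle : ∀ ξ η, ‖ω ⟨slice y ξ η, hy ξ η⟩‖ ≤ ‖ω‖ * ‖y‖ * ‖ξ‖ * ‖η‖ := fun ξ η => by
    refine (ω.le_opNorm _).trans ?_
    have h : ‖(⟨slice y ξ η, hy ξ η⟩ : K.VN.toStarSubalgebra)‖ ≤ ‖y‖ * ‖ξ‖ * ‖η‖ :=
      norm_slice_le y ξ η
    calc _ ≤ ‖ω‖ * (‖y‖ * ‖ξ‖ * ‖η‖) := by gcongr
      _ = ‖ω‖ * ‖y‖ * ‖ξ‖ * ‖η‖ := by ring
  let B : E →L⋆[ℂ] E →L[ℂ] ℂ := LinearMap.mkContinuous₂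
    (LinearMap.mk₂'ₛₗ (starRingEnd ℂ) (RingHom.id ℂ) (fun ξ η => ω ⟨slice y ξ η, hy ξ η⟩)
      (fun ξ₁ ξ₂ η => by
        rw [← map_add]; congr 1; ext1
        exact slice_add_left _ _ _ _)
      (fun c ξ η => by
        rw [← map_smul]; congr 1; ext1
        exact slice_smul_left _ _ _ _)
      (fun ξ η₁ η₂ => by
        rw [← map_add]; congr 1; ext1
        exact slice_add_right _ _ _ _)
      (fun c ξ η => by
        rw [RingHom.id_apply, ← map_smul]; congr 1; ext1
        exact slice_smul_right _ _ _ _))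
    (‖ω‖ * ‖y‖) hle
  have hD : ∀ ξ η, ⟪ξ, (InnerProductSpace.continuousLinearMapOfBilin B).adjoint η⟫_ℂ =
      ω ⟨slice y ξ η, hy ξ η⟩ := fun ξ η => by
    simp only [ContinuousLinearMap.adjoint_inner_right,
      InnerProductSpace.continuousLinearMapOfBilin_apply]
    rfl
  refine ⟨_, ContinuousLinearMap.opNorm_le_bound _ (by positivity) fun η => ?_, hD⟩
  set z := (InnerProductSpace.continuousLinearMapOfBilin B).adjoint η with hz
  by_cases h0 : z = 0
  · rw [h0, norm_zero]; positivity
  · have h1 := hle z η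
    rw [← hD, ← hz, inner_self_eq_norm_sq_to_K, norm_pow, RCLike.norm_ofReal, abs_norm] at h1
    have h2 : 0 < ‖z‖ := norm_pos_iff.mpr h0
    refine le_of_mul_le_mul_left (a := ‖z‖) ?_ h2
    calc ‖z‖ * ‖z‖ = ‖z‖ ^ 2 := by ring
      _ ≤ _ := h1
      _ = _ := by ring

/-- The right slice `(id ⊗ ω)(y)`. -/
def rightSlice (y : HilbertTensor E K.L2 →L[ℂ] HilbertTensor E K.L2)
    (hy : ∀ ξ η, slice y ξ η ∈ K.VN.toStarSubalgebra) (ω : StrongDual ℂ K.VN.toStarSubalgebra) :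
    E →L[ℂ] E := (exists_rightSlice hy ω).choose

variable {y : HilbertTensor E K.L2 →L[ℂ] HilbertTensor E K.L2}
  (hy : ∀ ξ η, slice y ξ η ∈ K.VN.toStarSubalgebra) (ω : StrongDual ℂ K.VN.toStarSubalgebra)

theorem norm_rightSlice_le : ‖rightSlice y hy ω‖ ≤ ‖ω‖ * ‖y‖ :=
  (exists_rightSlice hy ω).choose_spec.1

theorem inner_rightSlice (ξ η : E) :
    ⟪ξ, rightSlice y hy ω η⟫_ℂ = ω ⟨slice y ξ η, hy ξ η⟩ :=
  (exists_rightSlice hy ω).choose_spec.2 ξ η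

end DualSlice

section Commutation

variable {y : HilbertTensor K.L2 K.L2 →L[ℂ] HilbertTensor K.L2 K.L2}

/-- The operator `y` acts on `Λ((u^ν_{pq})*) ⊗ Λ((u^μ_{kl})*)` through the indices `p` and `k`. -/
def HasDoubleBlocks (y : HilbertTensor K.L2 K.L2 →L[ℂ] HilbertTensor K.L2 K.L2) : Prop :=
  ∀ ν μ : Irr A, ∃ X : Fin ν.rep.dim → Fin ν.rep.dim → Fin μ.rep.dim → Fin μ.rep.dim → ℂ,
    ∀ p q k l, y (tmul (K.coeffVec ν p q) (K.coeffVec μ k l)) =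
      ∑ r, ∑ m, X r p m k • tmul (K.coeffVec ν r q) (K.coeffVec μ m l)

theorem tensor_ext_coeffVec {G : Type*} [NormedAddCommGroup G] [NormedSpace ℂ G]
    {f g : HilbertTensor K.L2 K.L2 →L[ℂ] G}
    (h : ∀ ν p q μ k l, f (tmul (K.coeffVec ν p q) (K.coeffVec μ k l)) =
      g (tmul (K.coeffVec ν p q) (K.coeffVec μ k l))) : f = g :=
  ext_total K.dense_span_coeffVecs K.dense_span_coeffVecs
    (by rintro _ ⟨ν, p, q, rfl⟩ _ ⟨μ, k, l, rfl⟩; exact h ν p q μ k l)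

theorem HasDoubleBlocks.commute_left (hy : HasDoubleBlocks y) (μ : Irr A)
    (s t : Fin μ.rep.dim) :
    HilbertTensor.map (K.commUnit μ s t) (ContinuousLinearMap.id ℂ K.L2) ∘L y =
      y ∘L HilbertTensor.map (K.commUnit μ s t) (ContinuousLinearMap.id ℂ K.L2) := by
  refine tensor_ext_coeffVec fun ν p q κ k l => ?_
  obtain ⟨X, hX⟩ := hy ν κ
  simp only [ContinuousLinearMap.comp_apply, hX, map_sum, map_smul, map_tmul,
    ContinuousLinearMap.id_apply]
  by_cases hν : μ = ν
  · subst hν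
    simp only [commUnit_coeffVec]
    split_ifs
    · rw [hX]
    · simp [zero_tmul]
  · simp [K.commUnit_coeffVec_of_ne hν, zero_tmul]

theorem HasDoubleBlocks.commute_right (hy : HasDoubleBlocks y) (μ : Irr A)
    (s t : Fin μ.rep.dim) :
    HilbertTensor.map (ContinuousLinearMap.id ℂ K.L2) (K.commUnit μ s t) ∘L y =
      y ∘L HilbertTensor.map (ContinuousLinearMap.id ℂ K.L2) (K.commUnit μ s t) := by
  refine tensor_ext_coeffVec fun ν p q κ k l => ?_
  obtain ⟨X, hX⟩ := hy ν κ
  simp only [ContinuousLinearMap.comp_apply, hX, map_sum, map_smul, map_tmul,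
    ContinuousLinearMap.id_apply]
  by_cases hκ : μ = κ
  · subst hκ
    simp only [commUnit_coeffVec]
    split_ifs
    · rw [hX]
    · simp [tmul_zero]
  · simp [K.commUnit_coeffVec_of_ne hκ, tmul_zero]

/-- Since y commutes with 1 ⊗ `commUnit`, its left slices commute with `commUnit`, which
characterises VN(K). The right slices are handled in the same way through `commUnit` ⊗ 1. -/
theorem HasDoubleBlocks.slice_mem_VN (hy : HasDoubleBlocks y) (ξ η : K.L2) :
    slice y ξ η ∈ K.VN.toStarSubalgebra := by
  refine mem_VN_of_commute fun μ s t =>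
    ContinuousLinearMap.ext fun z => ext_inner_left ℂ fun x => ?_
  have h := congrArg (fun f => f (tmul η z)) (hy.commute_right μ s t)
  simp only [ContinuousLinearMap.comp_apply, map_tmul, ContinuousLinearMap.id_apply] at h
  rw [ContinuousLinearMap.mul_def, ContinuousLinearMap.mul_def, ContinuousLinearMap.comp_apply,
    ContinuousLinearMap.comp_apply, ← ContinuousLinearMap.adjoint_inner_left, inner_slice,
    inner_slice, ← h,
    ← ContinuousLinearMap.adjoint_inner_left (HilbertTensor.map _ _), adjoint_map, map_tmul,
    ContinuousLinearMap.adjoint_id, ContinuousLinearMap.id_apply]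

theorem HasDoubleBlocks.rightSlice_mem_VN (hy : HasDoubleBlocks y)
    (ω : StrongDual ℂ K.VN.toStarSubalgebra) :
    rightSlice y hy.slice_mem_VN ω ∈ K.VN.toStarSubalgebra := by
  refine mem_VN_of_commute fun μ s t =>
    ContinuousLinearMap.ext fun η => ext_inner_left ℂ fun ξ => ?_
  rw [ContinuousLinearMap.mul_def, ContinuousLinearMap.mul_def, ContinuousLinearMap.comp_apply,
    ContinuousLinearMap.comp_apply, ← ContinuousLinearMap.adjoint_inner_left, inner_rightSlice,
    inner_rightSlice]
  congr 2
  refine ContinuousLinearMap.ext fun z => ext_inner_left ℂ fun x => ?_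
  have h := congrArg (fun f => f (tmul η z)) (hy.commute_left μ s t)
  simp only [ContinuousLinearMap.comp_apply, map_tmul, ContinuousLinearMap.id_apply] at h
  rw [inner_slice, inner_slice, ← h,
    ← ContinuousLinearMap.adjoint_inner_left (HilbertTensor.map _ _), adjoint_map, map_tmul, ContinuousLinearMap.adjoint_id, ContinuousLinearMap.id_apply]

end Commutation

/-! ### The weight inequality and submultiplicativity -/

namespace DualWeight

variable (w : K.DualWeight)

/-- The operator `Δ̂(x) (w⁻¹ ⊗ w⁻¹)`. -/
def weightedComul (x : K.VN.toStarSubalgebra) :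
    HilbertTensor K.L2 K.L2 →L[ℂ] HilbertTensor K.L2 K.L2 :=
  K.dualComul (x : K.L2 →L[ℂ] K.L2) ∘L
    HilbertTensor.map (w.inv : K.L2 →L[ℂ] K.L2) (w.inv : K.L2 →L[ℂ] K.L2)

/-- Pass to the adjoint (w⁻¹ ⊗ w⁻¹) Δ̂(x*) and put z = Δ̂(x*)ζ. The inequality w⁻² ⊗ w⁻² ≤ Δ̂(w⁻²),
evaluated at z, gives ‖(w⁻¹ ⊗ w⁻¹)z‖ ≤ ‖Δ̂(w⁻¹)z‖ = ‖Δ̂(w⁻¹x*)ζ‖, and Δ̂ is contractive. -/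
theorem norm_weightedComul_le (x : K.VN.toStarSubalgebra) :
    ‖w.weightedComul x‖ ≤ ‖x * w.inv‖ := by
  set v : K.L2 →L[ℂ] K.L2 := (w.inv : K.L2 →L[ℂ] K.L2) with hv
  set X : K.L2 →L[ℂ] K.L2 := (x : K.L2 →L[ℂ] K.L2) with hX
  have hadj : v.adjoint = v := w.adjoint_inv
  have hc : ‖v ∘L X.adjoint‖ = ‖x * w.inv‖ := by
    have : (X ∘L v).adjoint = v ∘L X.adjoint := by
      rw [ContinuousLinearMap.adjoint_comp, hadj]
    rw [← this, LinearIsometryEquiv.norm_map]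
    rfl
  rw [← LinearIsometryEquiv.norm_map ContinuousLinearMap.adjoint, weightedComul,
    ContinuousLinearMap.adjoint_comp, adjoint_dualComul, adjoint_map, ← hv, ← hX, hadj, ← hc]
  refine ContinuousLinearMap.opNorm_le_bound _ (norm_nonneg _) fun ζ => ?_
  rw [ContinuousLinearMap.comp_apply]
  set z := K.dualComul X.adjoint ζ with hz
  have h1 : HilbertTensor.map (v ^ 2) (v ^ 2) =
      (HilbertTensor.map v v).adjoint ∘L HilbertTensor.map v v := by
    rw [adjoint_map, map_comp_map, hadj, pow_two]
    rfl
  have h2 : K.dualComul (v ^ 2) = (K.dualComul v).adjoint ∘L K.dualComul v := by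
    rw [adjoint_dualComul, ← dualComul_mul, hadj, pow_two]
    rfl
  have h3 := ((ContinuousLinearMap.le_def _ _).mp w.comul_le).re_inner_nonneg_right z
  rw [← hv, sub_apply, inner_sub_right, h1, h2, ContinuousLinearMap.comp_apply,
    ContinuousLinearMap.comp_apply, ContinuousLinearMap.adjoint_inner_right,
    ContinuousLinearMap.adjoint_inner_right, map_sub, inner_self_eq_norm_sq,
    inner_self_eq_norm_sq, sub_nonneg] at h3
  have h4 : ‖HilbertTensor.map v v z‖ ≤ ‖K.dualComul v z‖ :=
    le_of_sq_le_sq h3 (norm_nonneg _)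
  have h5 : K.dualComul v z = K.dualComul (v ∘L X.adjoint) ζ := by rw [dualComul_mul]; rfl
  exact h4.trans (h5 ▸ norm_dualComul_apply_le _ _)

variable {w}

theorem weightedComul_coeffVec (hw : w.IsCentral) (x : K.VN.toStarSubalgebra) (ν μ : Irr A)
    (p q : Fin ν.rep.dim) (k l : Fin μ.rep.dim) :
    w.weightedComul x (tmul (K.coeffVec ν p q) (K.coeffVec μ k l)) =
      ∑ r, ∑ m, (((w.component ν : ℂ))⁻¹ * ((w.component μ : ℂ))⁻¹ *
        pairing x (μ.rep.mat m k * ν.rep.mat r p)) •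
          tmul (K.coeffVec ν r q) (K.coeffVec μ m l) := by
  rw [weightedComul, ContinuousLinearMap.comp_apply, map_tmul, inv_coeffVec hw, inv_coeffVec hw,
    smul_tmul, tmul_smul, map_smul, map_smul, dualComul_coeffVec, smul_smul]
  simp only [Finset.smul_sum, smul_smul]

theorem hasDoubleBlocks_weightedComul (hw : w.IsCentral) (x : K.VN.toStarSubalgebra) :
    HasDoubleBlocks (w.weightedComul x) := fun ν μ =>
  ⟨fun r p m k => ((w.component ν : ℂ))⁻¹ * ((w.component μ : ℂ))⁻¹ *
    pairing x (μ.rep.mat m k * ν.rep.mat r p),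
    fun p q k l => weightedComul_coeffVec hw x ν μ p q k l⟩

/-- The right slice `(id ⊗ ω)(Δ̂(x) (w⁻¹ ⊗ w⁻¹))`, as an element of `VN(K)`. -/
def comulSlice (hw : w.IsCentral) (x : K.VN.toStarSubalgebra)
    (ω : StrongDual ℂ K.VN.toStarSubalgebra) : K.VN.toStarSubalgebra :=
  ⟨rightSlice (w.weightedComul x) (hasDoubleBlocks_weightedComul hw x).slice_mem_VN ω,
    (hasDoubleBlocks_weightedComul hw x).rightSlice_mem_VN ω⟩

theorem norm_comulSlice_le (hw : w.IsCentral) (x : K.VN.toStarSubalgebra)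
    (ω : StrongDual ℂ K.VN.toStarSubalgebra) :
    ‖comulSlice hw x ω‖ ≤ ‖ω‖ * ‖x * w.inv‖ :=
  (norm_rightSlice_le _ _).trans (by gcongr; exact w.norm_weightedComul_le x)

theorem inner_comulSlice (hw : w.IsCentral) (x : K.VN.toStarSubalgebra)
    (ω : StrongDual ℂ K.VN.toStarSubalgebra) (ξ η : K.L2) :
    ⟪ξ, (comulSlice hw x ω : K.L2 →L[ℂ] K.L2) η⟫_ℂ = ω ⟨slice (w.weightedComul x) ξ η,
      (hasDoubleBlocks_weightedComul hw x).slice_mem_VN ξ η⟩ :=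
  inner_rightSlice _ _ _ _

/-- Both sides are linear in a. At a = u^μ_{mk} the functional ω_a is w(μ) times an entry, which
removes the factor w(μ)⁻¹ of the second leg and leaves only w(ν)⁻¹. -/
theorem comulSlice_coeffVec (hw : w.IsCentral) (x : K.VN.toStarSubalgebra) (a : A)
    (ν : Irr A) (p q : Fin ν.rep.dim) :
    (comulSlice hw x (w.toPredual a) : K.L2 →L[ℂ] K.L2) (K.coeffVec ν p q) =
      ∑ r, (((w.component ν : ℂ))⁻¹ * pairing x (a * ν.rep.mat r p)) • K.coeffVec ν r q := by
  refine ext_inner_left ℂ fun ξ => ?_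
  rw [inner_comulSlice, inner_sum]
  simp only [inner_smul_right]
  set y : K.VN.toStarSubalgebra := ⟨slice (w.weightedComul x) ξ (K.coeffVec ν p q),
    (hasDoubleBlocks_weightedComul hw x).slice_mem_VN ξ _⟩ with hy
  let g : A →ₗ[ℂ] ℂ := ∑ r, (((w.component ν : ℂ))⁻¹ * ⟪ξ, K.coeffVec ν r q⟫_ℂ) •
    (pairing x ∘ₗ LinearMap.mulRight ℂ (ν.rep.mat r p))
  have h := K.linearMap_ext (f := predualEval y ∘ₗ w.toPredual) (g := g) fun μ m k => by
    have e : (y : K.L2 →L[ℂ] K.L2) (K.coeffVec μ k μ.idx) = ∑ m', (∑ r,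
        ((w.component ν : ℂ))⁻¹ * ((w.component μ : ℂ))⁻¹ *
          pairing x (μ.rep.mat m' k * ν.rep.mat r p) * ⟪ξ, K.coeffVec ν r q⟫_ℂ) •
            K.coeffVec μ m' μ.idx := by
      change slice (w.weightedComul x) ξ (K.coeffVec ν p q) (K.coeffVec μ k μ.idx) = _
      rw [slice_apply, weightedComul_coeffVec hw, Finset.sum_comm]
      simp only [map_sum, map_smul, adjoint_ket_tmul, smul_smul, Finset.sum_smul]
    have e2 := entry_eq e m
    have e3 : predualEval y (w.toPredual (μ.rep.mat m k)) = (w.component μ : ℂ) *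
        (K.entry μ m k : StrongDual ℂ K.VN.toStarSubalgebra) y := by
      rw [toPredual_coeff, predualEval_apply, predual_smul_apply]
    rw [LinearMap.comp_apply, e3, e2, Finset.mul_sum]
    simp only [g, LinearMap.sum_apply, LinearMap.smul_apply, LinearMap.comp_apply,
      LinearMap.mulRight_apply, smul_eq_mul]
    refine Finset.sum_congr rfl fun r _ => ?_
    have := component_ne_zero hw μ
    field_simp
  have h' : predualEval y (w.toPredual a) = g a := LinearMap.congr_fun h a
  rw [← predualEval_apply, h']
  simp only [g, LinearMap.sum_apply, LinearMap.smul_apply, LinearMap.comp_apply,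
    LinearMap.mulRight_apply, smul_eq_mul]
  exact Finset.sum_congr rfl fun r _ => by ring

/-- This is (ω_b ⊗ ω_a)(Δ̂(x)(w⁻¹ ⊗ w⁻¹)) = ⟨x, ab⟩: the weights cancel in both legs, and the
product is dual to Δ̂. -/
theorem toPredual_comulSlice (hw : w.IsCentral) (x : K.VN.toStarSubalgebra) (a b : A) :
    (w.toPredual b : StrongDual ℂ K.VN.toStarSubalgebra) (comulSlice hw x (w.toPredual a)) =
      pairing x (a * b) := by
  set D := comulSlice hw x (w.toPredual a) with hD
  have h := K.linearMap_ext (f := predualEval D ∘ₗ w.toPredual)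
    (g := pairing x ∘ₗ LinearMap.mulLeft ℂ a) fun ν r p => by
      have e3 : predualEval D (w.toPredual (ν.rep.mat r p)) = (w.component ν : ℂ) *
          (K.entry ν r p : StrongDual ℂ K.VN.toStarSubalgebra) D := by
        rw [toPredual_coeff, predualEval_apply, predual_smul_apply]
      rw [LinearMap.comp_apply, e3, entry_eq (comulSlice_coeffVec hw x a ν p ν.idx) r,
        mul_inv_cancel_left₀ (component_ne_zero hw ν)]
      rfl
  exact LinearMap.congr_fun h b

set_option maxHeartbeats 2000000 in
/-- The norm of `VN(K)_*` is submultiplicative for the product of `A(K,w)`. -/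
theorem norm_toPredual_mul_le (hw : w.IsCentral) (a b : A) :
    ‖w.toPredual (a * b)‖ ≤ ‖w.toPredual a‖ * ‖w.toPredual b‖ := by
  obtain ⟨F, hF⟩ := exists_finset_toPredual (w := w) (a * b)
  obtain ⟨y, hy⟩ := exists_mul_inv_eq hw F
  -- As w may be unbounded, x w is replaced by x y with y w⁻¹ = p_F, where F supports ω_{ab}. Then
  -- ω_{ab}(x) = ω_{ab}(x y w⁻¹) = ⟨xy, ab⟩ is the value of ω_b at the slice of Δ̂(xy)(w⁻¹ ⊗ w⁻¹) by
  -- ω_a, and ‖x y w⁻¹‖ = ‖x p_F‖ ≤ ‖x‖.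
  have hbound : ∀ x : K.VN.toStarSubalgebra, ∃ D : K.VN.toStarSubalgebra,
      ‖D‖ ≤ ‖(w.toPredual a : StrongDual ℂ K.VN.toStarSubalgebra)‖ * ‖x‖ ∧
      (w.toPredual (a * b) : StrongDual ℂ K.VN.toStarSubalgebra) x =
        (w.toPredual b : StrongDual ℂ K.VN.toStarSubalgebra) D := fun x => by
    have hx : x * y * w.inv = x * K.finsetProj F := by rw [mul_assoc, hy]
    have hn : ‖x * y * w.inv‖ ≤ ‖x‖ := by
      rw [hx]
      calc _ ≤ ‖x‖ * ‖K.finsetProj F‖ := norm_mul_le _ _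
        _ ≤ ‖x‖ * 1 := by gcongr; exact norm_finsetProj_le F
        _ = ‖x‖ := mul_one _
    refine ⟨comulSlice hw (x * y) (w.toPredual a), (norm_comulSlice_le hw _ _).trans
      (mul_le_mul_of_nonneg_left hn (norm_nonneg _)), ?_⟩
    rw [toPredual_comulSlice, pairing_apply, ← toPredual_mul_inv hw, hx, hF F subset_rfl]
  change ‖(w.toPredual (a * b) : StrongDual ℂ K.VN.toStarSubalgebra)‖ ≤
    ‖(w.toPredual a : StrongDual ℂ K.VN.toStarSubalgebra)‖ *
      ‖(w.toPredual b : StrongDual ℂ K.VN.toStarSubalgebra)‖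
  generalize (w.toPredual (a * b) : StrongDual ℂ K.VN.toStarSubalgebra) = γ at hbound
  generalize (w.toPredual a : StrongDual ℂ K.VN.toStarSubalgebra) = α at hbound
  generalize (w.toPredual b : StrongDual ℂ K.VN.toStarSubalgebra) = β at hbound
  refine ContinuousLinearMap.opNorm_le_bound _ (by positivity) fun x => ?_
  obtain ⟨D, hD, e⟩ := hbound x
  rw [e]
  calc _ ≤ ‖β‖ * ‖D‖ := ContinuousLinearMap.le_opNorm _ _
    _ ≤ ‖β‖ * (‖α‖ * ‖x‖) := by gcongr
    _ = _ := by ring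

end DualWeight

end CompactQuantumGroup

end DualComultiplication

/-! ### Assembling an operator from a bounded family of components -/

noncomputable section BlockOperators

open HilbertTensor

theorem norm_sum_sq_of_orthogonal {E ι : Type*} [NormedAddCommGroup E] [InnerProductSpace ℂ E]
    (s : Finset ι) (z : ι → E) (h : ∀ i j, i ≠ j → ⟪z i, z j⟫_ℂ = 0) :
    ‖∑ i ∈ s, z i‖ ^ 2 = ∑ i ∈ s, ‖z i‖ ^ 2 := by
  classical
  have h1 : ⟪∑ i ∈ s, z i, ∑ i ∈ s, z i⟫_ℂ = ∑ i ∈ s, ⟪z i, z i⟫_ℂ := by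
    rw [sum_inner]
    refine Finset.sum_congr rfl fun i hi => ?_
    rw [inner_sum, Finset.sum_eq_single_of_mem i hi]
    exact fun j _ hj => h i j hj.symm
  simp only [inner_self_eq_norm_sq_to_K] at h1
  exact_mod_cast h1

variable {A : Type*} [Ring A] [StarRing A] [HopfAlgebra ℂ A] [StarModule ℂ A]
  {H : Type*} [NormedAddCommGroup H] [InnerProductSpace ℂ H] [CompleteSpace H]

namespace CompactQuantumGroup

variable (K : CompactQuantumGroup A)

/-- The Gram matrix of the coefficient vectors is δ_{kk'} times a matrix in l, l'. Matrix units act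
on k only, so they have the usual adjoints even though different columns l need not be orthogonal.
-/
theorem adjoint_matUnit (μ : Irr A) (i j : Fin μ.rep.dim) :
    (K.matUnit μ i j).adjoint = K.matUnit μ j i := by
  refine K.op_ext fun ν k l => ?_
  have h : innerSL ℂ ((K.matUnit μ i j).adjoint (K.coeffVec ν k l)) =
      innerSL ℂ (K.matUnit μ j i (K.coeffVec ν k l)) := K.op_ext fun κ p q => by
    simp only [innerSL_apply_apply, ContinuousLinearMap.adjoint_inner_left]
    by_cases hν : μ = ν
    · subst hν
      by_cases hκ : μ = κ
      · subst hκ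
        rw [matUnit_coeffVec, matUnit_coeffVec]
        split_ifs with h1 h2 h2
        · rw [inner_coeffVec, inner_coeffVec]
          simp [h1, h2.symm]
        · rw [inner_coeffVec, if_neg (fun h => h2 h.symm), inner_zero_left]
        · rw [inner_zero_right, inner_coeffVec, if_neg h1]
        · simp
      · rw [K.matUnit_coeffVec_of_ne hκ, matUnit_coeffVec]
        split_ifs
        · rw [K.inner_coeffVec_of_ne hκ, inner_zero_right]
        · simp
    · rw [K.matUnit_coeffVec_of_ne hν, inner_zero_left]
      by_cases hκ : μ = κ
      · subst hκ
        rw [matUnit_coeffVec]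
        split_ifs
        · rw [K.inner_coeffVec_of_ne (Ne.symm hν)]
        · simp
      · rw [K.matUnit_coeffVec_of_ne hκ, inner_zero_right]
  exact (innerSL_inj).mp h

variable {K} in
theorem tensor_ext_of_block {G : Type*} [NormedAddCommGroup G] [NormedSpace ℂ G] (μ : Irr A)
    {f g : HilbertTensor H K.L2 →L[ℂ] G}
    (h : ∀ ξ k l, f (tmul ξ (K.coeffVec μ k l)) = g (tmul ξ (K.coeffVec μ k l)))
    (h' : ∀ ξ ν k l, μ ≠ ν → f (tmul ξ (K.coeffVec ν k l)) = g (tmul ξ (K.coeffVec ν k l))) :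
    f = g := by
  refine K.tensor_ext fun ξ ν k l => ?_
  by_cases hν : μ = ν
  · subst hν; exact h ξ k l
  · exact h' ξ ν k l hν

/-- The operator `∑ X_{ij} ⊗ ω^μ_{ij}`. -/
def blockOp (μ : Irr A) (X : CStarMatrix (Fin μ.rep.dim) (Fin μ.rep.dim) (H →L[ℂ] H)) :
    HilbertTensor H K.L2 →L[ℂ] HilbertTensor H K.L2 :=
  ∑ i, ∑ j, HilbertTensor.map (X i j) (K.matUnit μ i j)

variable {K}

theorem blockOp_tmul (μ : Irr A) (X : CStarMatrix (Fin μ.rep.dim) (Fin μ.rep.dim) (H →L[ℂ] H))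
    (h : H) (k l : Fin μ.rep.dim) : K.blockOp μ X (tmul h (K.coeffVec μ k l)) =
      ∑ i, tmul (X i k h) (K.coeffVec μ i l) := by
  simp only [blockOp, sum_apply, map_tmul, matUnit_coeffVec]
  refine Finset.sum_congr rfl fun m _ => ?_
  rw [Finset.sum_eq_single k]
  · simp
  · intro b _ hb; simp [hb, tmul_zero]
  · simp

theorem blockOp_tmul_of_ne {μ ν : Irr A} (hν : μ ≠ ν)
    (X : CStarMatrix (Fin μ.rep.dim) (Fin μ.rep.dim) (H →L[ℂ] H)) (h : H)
    (k l : Fin ν.rep.dim) : K.blockOp μ X (tmul h (K.coeffVec ν k l)) = 0 := by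
  simp only [blockOp, sum_apply, map_tmul, K.matUnit_coeffVec_of_ne hν, tmul_zero,
    Finset.sum_const_zero]

theorem adjoint_blockOp (μ : Irr A)
    (X : CStarMatrix (Fin μ.rep.dim) (Fin μ.rep.dim) (H →L[ℂ] H)) :
    (K.blockOp μ X).adjoint = K.blockOp μ (star X) := by
  rw [blockOp, blockOp, Finset.sum_comm]
  simp only [map_sum, adjoint_map, adjoint_matUnit]
  rfl

theorem blockOp_comp (μ : Irr A)
    (X Y : CStarMatrix (Fin μ.rep.dim) (Fin μ.rep.dim) (H →L[ℂ] H)) :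
    K.blockOp μ X ∘L K.blockOp μ Y = K.blockOp μ (X * Y) := by
  refine tensor_ext_of_block μ (fun ξ k l => ?_) fun ξ ν k l hν => ?_
  · simp only [ContinuousLinearMap.comp_apply, blockOp_tmul, map_sum]
    rw [Finset.sum_comm]
    refine Finset.sum_congr rfl fun i _ => ?_
    rw [← sum_tmul]
    congr 1
    rw [CStarMatrix.mul_apply, sum_apply]
    rfl
  · simp only [ContinuousLinearMap.comp_apply, blockOp_tmul_of_ne hν, map_zero]

theorem blockOp_comp_of_ne {μ ν : Irr A} (hν : μ ≠ ν)
    (X : CStarMatrix (Fin μ.rep.dim) (Fin μ.rep.dim) (H →L[ℂ] H))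
    (Y : CStarMatrix (Fin ν.rep.dim) (Fin ν.rep.dim) (H →L[ℂ] H)) :
    K.blockOp μ X ∘L K.blockOp ν Y = 0 := by
  refine tensor_ext_of_block ν (fun ξ k l => ?_) fun ξ κ k l hκ => ?_
  · simp only [ContinuousLinearMap.comp_apply, blockOp_tmul, map_sum, blockOp_tmul_of_ne hν,
      Finset.sum_const_zero, zero_apply]
  · simp only [ContinuousLinearMap.comp_apply, blockOp_tmul_of_ne hκ, map_zero, zero_apply]

theorem inner_blockOp_of_ne {μ ν : Irr A} (hν : μ ≠ ν)
    (X : CStarMatrix (Fin μ.rep.dim) (Fin μ.rep.dim) (H →L[ℂ] H))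
    (Y : CStarMatrix (Fin ν.rep.dim) (Fin ν.rep.dim) (H →L[ℂ] H))
    (ζ ζ' : HilbertTensor H K.L2) : ⟪K.blockOp μ X ζ, K.blockOp ν Y ζ'⟫_ℂ = 0 := by
  rw [← ContinuousLinearMap.adjoint_inner_right, adjoint_blockOp,
    ← ContinuousLinearMap.comp_apply, blockOp_comp_of_ne hν, zero_apply, inner_zero_right]

/-- X ↦ ∑ X_{ij} ⊗ ω_{ij} is a *-homomorphism of C*-algebras, hence contractive. -/
theorem norm_blockOp_le (μ : Irr A)
    (X : CStarMatrix (Fin μ.rep.dim) (Fin μ.rep.dim) (H →L[ℂ] H)) : ‖K.blockOp μ X‖ ≤ ‖X‖ := by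
  let π : CStarMatrix (Fin μ.rep.dim) (Fin μ.rep.dim) (H →L[ℂ] H) →⋆ₙₐ[ℂ]
      (HilbertTensor H K.L2 →L[ℂ] HilbertTensor H K.L2) :=
    { toFun := K.blockOp μ
      map_smul' := fun c X => tensor_ext_of_block μ (fun ξ k l => by
        simp [blockOp_tmul, smul_tmul, Finset.smul_sum])
        fun ξ ν k l hν => by simp [blockOp_tmul_of_ne hν]
      map_zero' := tensor_ext_of_block μ (fun ξ k l => by simp [blockOp_tmul, zero_tmul])
        fun ξ ν k l hν => by simp [blockOp_tmul_of_ne hν]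
      map_add' := fun X Y => tensor_ext_of_block μ (fun ξ k l => by
        rw [add_apply, blockOp_tmul, blockOp_tmul, blockOp_tmul, ← Finset.sum_add_distrib]
        exact Finset.sum_congr rfl fun i _ =>
          map_add ((tmulₗ H K.L2).flip (K.coeffVec μ i l)) (X i k ξ) (Y i k ξ))
        fun ξ ν k l hν => by simp [blockOp_tmul_of_ne hν]
      map_mul' := fun X Y => (blockOp_comp μ X Y).symm
      map_star' := fun X => (adjoint_blockOp μ X).symm }
  exact NonUnitalStarAlgHom.norm_apply_le π X

/-- A bounded family of components defines an operator on `H ⊗ L²(K)`. -/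
theorem exists_hasComponent
    (X : (μ : Irr A) → CStarMatrix (Fin μ.rep.dim) (Fin μ.rep.dim) (H →L[ℂ] H)) {C : ℝ}
    (hX : ∀ μ, ‖X μ‖ ≤ C) :
    ∃ T : HilbertTensor H K.L2 →L[ℂ] HilbertTensor H K.L2, ∀ μ, K.HasComponent T μ (X μ) := by
  classical
  let I := Σ μ : Irr A, Fin μ.rep.dim × Fin μ.rep.dim
  -- Finitely supported families of vectors of H parametrise a dense subspace through e, and f is
  -- the desired operator on it. The estimate ‖f x‖ ≤ C ‖e x‖ provides both well-definedness and the
  -- bounded extension.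
  let e : (I →₀ H) →ₗ[ℂ] HilbertTensor H K.L2 :=
    Finsupp.lsum ℂ fun s => (tmulₗ H K.L2).flip (K.coeffVec s.1 s.2.1 s.2.2)
  let f : (I →₀ H) →ₗ[ℂ] HilbertTensor H K.L2 :=
    Finsupp.lsum ℂ fun s => (K.blockOp s.1 (X s.1)).toLinearMap ∘ₗ
      (tmulₗ H K.L2).flip (K.coeffVec s.1 s.2.1 s.2.2)
  have he : ∀ s h, e (Finsupp.single s h) = tmul h (K.coeffVec s.1 s.2.1 s.2.2) := fun s h => by
    simp [e, tmulₗ_apply]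
  have hf : ∀ s h, f (Finsupp.single s h) =
      K.blockOp s.1 (X s.1) (tmul h (K.coeffVec s.1 s.2.1 s.2.2)) := fun s h => by
    simp [f, tmulₗ_apply]
  have hdense : DenseRange e := by
    refine (dense_span_tmul (S := Set.univ) (E := H) (by simp) K.dense_span_coeffVecs).mono ?_
    rw [← LinearMap.coe_range]
    refine SetLike.coe_subset_coe.mpr (Submodule.span_le.mpr ?_)
    rintro _ ⟨h, -, _, ⟨μ, k, l, rfl⟩, rfl⟩
    exact ⟨Finsupp.single ⟨μ, k, l⟩ h, he _ h⟩
  have hsum : ∀ (Y : (μ : Irr A) → CStarMatrix (Fin μ.rep.dim) (Fin μ.rep.dim) (H →L[ℂ] H))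
      (F : Finset (Irr A)) (s : I), s.1 ∈ F → ∀ h,
      ∑ μ ∈ F, K.blockOp μ (Y μ) (e (Finsupp.single s h)) =
        K.blockOp s.1 (Y s.1) (e (Finsupp.single s h)) := by
    intro Y F s hs h
    refine Finset.sum_eq_single_of_mem s.1 hs fun μ _ hμ => ?_
    rw [he, blockOp_tmul_of_ne hμ]
  have hx : ∀ x : I →₀ H, ∃ F : Finset (Irr A),
      f x = ∑ μ ∈ F, K.blockOp μ (X μ) (e x) ∧ e x = ∑ μ ∈ F, K.blockOp μ 1 (e x) := by
    intro x
    have key : ∀ F : Finset (Irr A), x.support.image Sigma.fst ⊆ F →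
        f x = ∑ μ ∈ F, K.blockOp μ (X μ) (e x) ∧ e x = ∑ μ ∈ F, K.blockOp μ 1 (e x) := by
      intro F hF
      have hmem : ∀ s ∈ x.support, s.1 ∈ F := fun s hs => hF (Finset.mem_image_of_mem _ hs)
      have hxs : x = ∑ s ∈ x.support, Finsupp.single s (x s) := x.sum_single.symm
      constructor
      · conv_lhs => rw [hxs, map_sum]
        conv_rhs => rw [hxs]
        simp only [map_sum]
        rw [Finset.sum_comm]
        refine Finset.sum_congr rfl fun s hs => ?_
        rw [hsum X F s (hmem s hs), hf, he]
      · conv_lhs => rw [hxs, map_sum]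
        conv_rhs => rw [hxs]
        simp only [map_sum]
        rw [Finset.sum_comm]
        refine Finset.sum_congr rfl fun s hs => ?_
        rw [hsum (fun _ => 1) F s (hmem s hs), he, blockOp_tmul, Finset.sum_eq_single s.2.1]
        · simp
        · intro b _ hb; simp [hb, zero_tmul]
        · simp
    exact ⟨_, key _ subset_rfl⟩
  have hnorm : ∀ x, ‖f x‖ ≤ C * ‖e x‖ := by
    intro x
    obtain ⟨F, h1, h2⟩ := hx x
    -- C is nonnegative as soon as some block occurs; if F is empty, both vectors vanish.
    have hC : 0 ≤ C ∨ F = ∅ := by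
      rcases F.eq_empty_or_nonempty with h | ⟨μ, -⟩
      · exact Or.inr h
      · exact Or.inl ((norm_nonneg _).trans (hX μ))
    rcases hC with hC | rfl
    · refine le_of_sq_le_sq ?_ (by positivity)
      -- Different blocks have orthogonal ranges, so by Pythagoras it suffices to estimate each
      -- block, where the norm is at most C.
      have hn1 : ‖f x‖ ^ 2 = ∑ μ ∈ F, ‖K.blockOp μ (X μ) (K.blockOp μ 1 (e x))‖ ^ 2 := by
        rw [h1, norm_sum_sq_of_orthogonal F _ fun μ ν hν => inner_blockOp_of_ne hν _ _ _ _]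
        refine Finset.sum_congr rfl fun μ _ => ?_
        rw [← ContinuousLinearMap.comp_apply, blockOp_comp, mul_one]
      have hn2 : ‖e x‖ ^ 2 = ∑ μ ∈ F, ‖K.blockOp μ 1 (e x)‖ ^ 2 := by
        conv_lhs => rw [h2]
        exact norm_sum_sq_of_orthogonal F _ fun μ ν hν => inner_blockOp_of_ne hν _ _ _ _
      rw [hn1, mul_pow, hn2, Finset.mul_sum]
      refine Finset.sum_le_sum fun μ _ => ?_
      rw [← mul_pow]
      gcongr
      refine (ContinuousLinearMap.le_opNorm _ _).trans ?_
      gcongr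
      exact (norm_blockOp_le μ _).trans (hX μ)
    · rw [Finset.sum_empty] at h1 h2
      rw [h1, h2, norm_zero, mul_zero]
  refine ⟨f.extendOfNorm e, fun μ h k l => ?_⟩
  have h3 : f.extendOfNorm e (e (Finsupp.single ⟨μ, k, l⟩ h)) = f (Finsupp.single ⟨μ, k, l⟩ h) :=
    LinearMap.extendOfNorm_eq hdense ⟨C, hnorm⟩ _
  rw [he, hf, blockOp_tmul] at h3
  exact h3

end CompactQuantumGroup

end BlockOperators

/-! ### Matrix norms of the predual, and extension of multiplicative maps by density -/

noncomputable section CompletelyBounded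

open HilbertTensor

/-- The common square norm g is kept as a parameter because it is applied to the unnormalised
vectors Λ((u_{i0})*). -/
theorem norm_sum_tmul_sq {E F ι : Type*} [Fintype ι] [DecidableEq ι] [NormedAddCommGroup E]
    [InnerProductSpace ℂ E] [NormedAddCommGroup F] [InnerProductSpace ℂ F] {e : ι → F} {g : ℝ}
    (he : ∀ i j, ⟪e i, e j⟫_ℂ = if i = j then (g : ℂ) else 0) (v : PiLp 2 fun _ : ι => E) :
    ‖∑ i, tmul (v i) (e i)‖ ^ 2 = g * ‖v‖ ^ 2 := by
  rw [norm_sum_sq_of_orthogonal _ _ fun i j hij => by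
    rw [inner_tmul, he, if_neg hij, mul_zero], PiLp.norm_sq_eq_of_L2, Finset.mul_sum]
  refine Finset.sum_congr rfl fun i _ => ?_
  have h : ‖e i‖ ^ 2 = g := by
    have := he i i
    rw [if_pos rfl, inner_self_eq_norm_sq_to_K] at this
    exact Complex.ofReal_injective (by rw [Complex.ofReal_pow]; exact this)
  rw [norm_tmul, mul_pow, h, mul_comm]

theorem norm_sum_tmul_sq' {E F ι : Type*} [Fintype ι] [DecidableEq ι] [NormedAddCommGroup E]
    [InnerProductSpace ℂ E] [NormedAddCommGroup F] [InnerProductSpace ℂ F] {e : ι → F} {g : ℝ}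
    (he : ∀ i j, ⟪e i, e j⟫_ℂ = if i = j then (g : ℂ) else 0) (v : PiLp 2 fun _ : ι => E) :
    ‖∑ i, tmul (e i) (v i)‖ ^ 2 = g * ‖v‖ ^ 2 := by
  rw [norm_sum_sq_of_orthogonal _ _ fun i j hij => by
    rw [inner_tmul, he, if_neg hij, zero_mul], PiLp.norm_sq_eq_of_L2, Finset.mul_sum]
  refine Finset.sum_congr rfl fun i _ => ?_
  have h : ‖e i‖ ^ 2 = g := by
    have := he i i
    rw [if_pos rfl, inner_self_eq_norm_sq_to_K] at this
    exact Complex.ofReal_injective (by rw [Complex.ofReal_pow]; exact this)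
  rw [norm_tmul, mul_pow, h]

theorem norm_sum_smul_sq {F ι : Type*} [Fintype ι] [DecidableEq ι]
    [NormedAddCommGroup F] [InnerProductSpace ℂ F] {e : ι → F} {g : ℝ}
    (he : ∀ i j, ⟪e i, e j⟫_ℂ = if i = j then (g : ℂ) else 0) (v : ι → ℂ) :
    ‖∑ i, v i • e i‖ ^ 2 = g * ∑ i, ‖v i‖ ^ 2 := by
  rw [norm_sum_sq_of_orthogonal _ _ fun i j hij => by
    rw [inner_smul_left, inner_smul_right, he, if_neg hij, mul_zero, mul_zero], Finset.mul_sum]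
  refine Finset.sum_congr rfl fun i _ => ?_
  have h : ‖e i‖ ^ 2 = g := by
    have := he i i
    rw [if_pos rfl, inner_self_eq_norm_sq_to_K] at this
    exact Complex.ofReal_injective (by rw [Complex.ofReal_pow]; exact this)
  rw [norm_smul, mul_pow, h, mul_comm]

section Predual

variable {E : Type*} [NormedAddCommGroup E] [InnerProductSpace ℂ E] [CompleteSpace E]

/-- The operator is the compression v* x w of the matrix x: its form at ζ, η is that of x at (v_k
ζ)_k and (w_l η)_l. -/
theorem norm_sum_smul_op_le {m : ℕ} (x : Fin m → Fin m → E →L[ℂ] E)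
    (v w : Fin m → ℂ) : ‖∑ k, ∑ l, (star (v k) * w l) • x k l‖ ≤
      ‖CStarMatrix.ofMatrix x‖ * ‖WithLp.toLp 2 v‖ * ‖WithLp.toLp 2 w‖ := by
  have hn : ∀ (u : Fin m → ℂ) (ξ : E), ‖WithLp.toLp 2 (fun k => u k • ξ)‖ =
      ‖WithLp.toLp 2 u‖ * ‖ξ‖ := fun u ξ => by
    refine (sq_eq_sq₀ (norm_nonneg _) (by positivity)).mp ?_
    rw [mul_pow, PiLp.norm_sq_eq_of_L2, PiLp.norm_sq_eq_of_L2, Finset.sum_mul]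
    exact Finset.sum_congr rfl fun k _ => by rw [← mul_pow, ← norm_smul]
  refine ContinuousLinearMap.opNorm_le_bound _ (by positivity) fun η => ?_
  set z := (∑ k, ∑ l, (star (v k) * w l) • x k l) η with hz
  have h := CStarMatrix.norm_inner_op_le (CStarMatrix.ofMatrix x)
    (WithLp.toLp 2 fun k => v k • z) (WithLp.toLp 2 fun k => w k • η)
  have e : ∀ ζ : E, ∑ k, ∑ l, ⟪(WithLp.toLp 2 fun k => v k • ζ : PiLp 2 fun _ : Fin m => E) k,
      CStarMatrix.ofMatrix x k l ((WithLp.toLp 2 fun k => w k • η :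
        PiLp 2 fun _ : Fin m => E) l)⟫_ℂ = ⟪ζ, z⟫_ℂ := fun ζ => by
    rw [hz]
    simp only [sum_apply, smul_apply, inner_sum]
    refine Finset.sum_congr rfl fun k _ => Finset.sum_congr rfl fun l _ => ?_
    change ⟪v k • ζ, x k l (w l • η)⟫_ℂ = _
    rw [map_smul, inner_smul_left, inner_smul_right, inner_smul_right, mul_assoc]
    rfl
  rw [e, hn, hn, inner_self_eq_norm_sq_to_K, norm_pow, RCLike.norm_ofReal, abs_norm] at h
  by_cases h0 : z = 0
  · rw [h0, norm_zero]; positivity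
  · refine le_of_mul_le_mul_left (a := ‖z‖) ?_ (norm_pos_iff.mpr h0)
    calc ‖z‖ * ‖z‖ = ‖z‖ ^ 2 := by ring
      _ ≤ _ := h
      _ = _ := by ring

/-- The set whose supremum is the norm of `M_n(M_*)` is bounded. -/
theorem VonNeumannAlgebra.bddAbove_predualMatrixNorm (M : VonNeumannAlgebra E) {n : ℕ}
    (ω : Fin n → Fin n → M.predual) :
    BddAbove {r : ℝ | ∃ (m : ℕ) (x : Fin m → Fin m → M.toStarSubalgebra),
      ‖CStarMatrix.ofMatrix (fun k l => (x k l : E →L[ℂ] E))‖ ≤ 1 ∧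
      r = ‖(CStarMatrix.ofMatrix fun p q => (ω p.1 q.1 : StrongDual ℂ M.toStarSubalgebra)
        (x p.2 q.2) : CStarMatrix (Fin n × Fin m) (Fin n × Fin m) ℂ)‖} := by
  -- The crude bound ∑ ‖ω_{ij}‖ suffices; it is needed because the supremum of an unbounded set of
  -- reals is 0 by convention.
  refine ⟨∑ i, ∑ j, ‖(ω i j : StrongDual ℂ M.toStarSubalgebra)‖, ?_⟩
  rintro _ ⟨m, x, hx, rfl⟩
  generalize hω : (fun i j => (ω i j : StrongDual ℂ M.toStarSubalgebra)) = α
  have hω' : ∀ i j, (ω i j : StrongDual ℂ M.toStarSubalgebra) = α i j := fun i j => by rw [← hω]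
  simp only [hω']
  refine CStarMatrix.norm_le_of_sum
    (Finset.sum_nonneg fun i _ => Finset.sum_nonneg fun j _ => norm_nonneg _) fun v w => ?_
  have hrow : ∀ (u : EuclideanSpace ℂ (Fin n × Fin m)) (i : Fin n),
      ‖WithLp.toLp 2 (fun k : Fin m => u (i, k))‖ ≤ ‖u‖ := fun u i => by
    refine le_of_sq_le_sq ?_ (norm_nonneg _)
    rw [PiLp.norm_sq_eq_of_L2, PiLp.norm_sq_eq_of_L2, Fintype.sum_prod_type]
    exact Finset.single_le_sum (f := fun i => ∑ k, ‖u (i, k)‖ ^ 2)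
      (fun i _ => Finset.sum_nonneg fun k _ => by positivity) (Finset.mem_univ i)
  have hone : ∀ i j, ‖∑ k, ∑ l, α i j (x k l) * (star (v (i, k)) * w (j, l))‖ ≤
      ‖α i j‖ * ‖v‖ * ‖w‖ := fun i j => by
    have e : ∑ k, ∑ l, α i j (x k l) * (star (v (i, k)) * w (j, l)) =
        α i j (∑ k, ∑ l, (star (v (i, k)) * w (j, l)) • x k l) := by
      simp only [map_sum, map_smul, smul_eq_mul, mul_comm]
    have hle : ‖∑ k, ∑ l, (star (v (i, k)) * w (j, l)) • x k l‖ ≤ ‖v‖ * ‖w‖ := by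
      have h1 := norm_sum_smul_op_le (fun k l => (x k l : E →L[ℂ] E)) (fun k => v (i, k))
        (fun l => w (j, l))
      have e2 : ((∑ k, ∑ l, (star (v (i, k)) * w (j, l)) • x k l : M.toStarSubalgebra) :
          E →L[ℂ] E) = ∑ k, ∑ l, (star (v (i, k)) * w (j, l)) • (x k l : E →L[ℂ] E) := by
        simp only [AddSubmonoidClass.coe_finsetSum]
        rfl
      change ‖((∑ k, ∑ l, (star (v (i, k)) * w (j, l)) • x k l : M.toStarSubalgebra) :
          E →L[ℂ] E)‖ ≤ _
      rw [e2]
      refine h1.trans ?_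
      calc _ ≤ 1 * ‖v‖ * ‖w‖ := by gcongr; exacts [hrow v i, hrow w j]
        _ = _ := by ring
    rw [e]
    refine ((α i j).le_opNorm _).trans ?_
    rw [mul_assoc]
    gcongr
  calc _ = ‖∑ i, ∑ j, ∑ k, ∑ l, α i j (x k l) * (star (v (i, k)) * w (j, l))‖ := by
        congr 1
        simp only [Fintype.sum_prod_type]
        refine Finset.sum_congr rfl fun i _ => ?_
        rw [Finset.sum_comm]
        rfl
    _ ≤ ∑ i, ∑ j, ‖∑ k, ∑ l, α i j (x k l) * (star (v (i, k)) * w (j, l))‖ :=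
        (norm_sum_le _ _).trans (Finset.sum_le_sum fun i _ => norm_sum_le _ _)
    _ ≤ ∑ i, ∑ j, ‖α i j‖ * ‖v‖ * ‖w‖ :=
        Finset.sum_le_sum fun i _ => Finset.sum_le_sum fun j _ => hone i j
    _ = _ := by simp only [Finset.sum_mul]

/-- Rescaling by C⁻¹ brings x into the unit ball over which the supremum runs; this needs C > 0. -/
theorem VonNeumannAlgebra.norm_le_predualMatrixNorm (M : VonNeumannAlgebra E) {n m : ℕ}
    (ω : Fin n → Fin n → M.predual) (x : Fin m → Fin m → M.toStarSubalgebra) {C : ℝ} (hC : 0 < C)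
    (hx : ‖CStarMatrix.ofMatrix (fun k l => (x k l : E →L[ℂ] E))‖ ≤ C) :
    ‖(CStarMatrix.ofMatrix fun p q => (ω p.1 q.1 : StrongDual ℂ M.toStarSubalgebra)
        (x p.2 q.2) : CStarMatrix (Fin n × Fin m) (Fin n × Fin m) ℂ)‖ ≤
      C * M.predualMatrixNorm ω := by
  have h := le_csSup (M.bddAbove_predualMatrixNorm ω)
    ⟨m, fun k l => ((C⁻¹ : ℝ) : ℂ) • x k l, ?_, rfl⟩
  · have e : (CStarMatrix.ofMatrix fun p q => (ω p.1 q.1 : StrongDual ℂ M.toStarSubalgebra)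
        (((C⁻¹ : ℝ) : ℂ) • x p.2 q.2) : CStarMatrix (Fin n × Fin m) (Fin n × Fin m) ℂ) =
        ((C⁻¹ : ℝ) : ℂ) • (CStarMatrix.ofMatrix fun p q =>
          (ω p.1 q.1 : StrongDual ℂ M.toStarSubalgebra) (x p.2 q.2) :
            CStarMatrix (Fin n × Fin m) (Fin n × Fin m) ℂ) := by
      ext p q
      exact map_smul (ω p.1 q.1 : StrongDual ℂ M.toStarSubalgebra) _ _
    rw [e, norm_smul, Complex.norm_real, Real.norm_of_nonneg (by positivity),
      inv_mul_le_iff₀ hC] at h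
    exact h
  · have e : CStarMatrix.ofMatrix (fun k l => ((((C⁻¹ : ℝ) : ℂ) • x k l :
        M.toStarSubalgebra) : E →L[ℂ] E)) =
        ((C⁻¹ : ℝ) : ℂ) • CStarMatrix.ofMatrix (fun k l => (x k l : E →L[ℂ] E)) := rfl
    rw [e, norm_smul, Complex.norm_real, Real.norm_of_nonneg (by positivity),
      inv_mul_le_iff₀ hC, mul_one]
    exact hx

end Predual

/-- A linear map from a completion that is multiplicative on a dense algebra. -/
theorem exists_apply_eq_mul {A P B B' : Type*} [NonUnitalRing A] [Module ℂ A]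
    [NormedAddCommGroup P] [NormedSpace ℂ P] [CompleteSpace P] [NonUnitalNormedRing B]
    [NormedSpace ℂ B] [NonUnitalNormedRing B'] [NormedSpace ℂ B'] (τ : A →ₗ[ℂ] P) (hτ : DenseRange τ)
    (hle : ∀ a b, ‖τ (a * b)‖ ≤ ‖τ a‖ * ‖τ b‖) (G : P →L[ℂ] B)
    (G' : P →L[ℂ] B') (hG : ∀ a b, G (τ (a * b)) = G (τ a) * G (τ b))
    (hG' : ∀ a b, G' (τ (a * b)) = G' (τ a) * G' (τ b)) (p q : P) :
    ∃ r, G r = G p * G q ∧ G' r = G' p * G' q := by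
  obtain ⟨u, hu, hup⟩ := mem_closure_iff_seq_limit.mp (hτ p)
  obtain ⟨v, hv, hvq⟩ := mem_closure_iff_seq_limit.mp (hτ q)
  choose a ha using hu
  choose b hb using hv
  obtain ⟨M, hM⟩ := hup.norm.bddAbove_range
  obtain ⟨N, hN⟩ := hvq.norm.bddAbove_range
  have hM' : ∀ n, ‖τ (a n)‖ ≤ M := fun n => by rw [ha]; exact hM ⟨n, rfl⟩
  have hN' : ∀ n, ‖τ (b n)‖ ≤ N := fun n => by rw [hb]; exact hN ⟨n, rfl⟩
  -- Splitting a_m b_m − a_n b_n = (a_m − a_n) b_m + a_n (b_m − b_n) and using submultiplicativity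
  -- makes the images of the products Cauchy. Their limit r serves G and G' at once.
  have hbound : ∀ m n, dist (τ (a m * b m)) (τ (a n * b n)) ≤
      dist (u m) (u n) * N + M * dist (v m) (v n) := fun m n => by
    have e : τ (a m * b m) - τ (a n * b n) =
        τ ((a m - a n) * b m) + τ (a n * (b m - b n)) := by
      rw [← map_sub, ← map_add]
      congr 1
      noncomm_ring
    rw [dist_eq_norm, e]
    refine (norm_add_le _ _).trans (add_le_add ((hle _ _).trans ?_) ((hle _ _).trans ?_))
    · rw [map_sub, ha, ha, dist_eq_norm]
      gcongr
      exact hN' m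
    · rw [map_sub, hb, hb, dist_eq_norm]
      gcongr
      exact hM' n
  have hc : CauchySeq fun n => τ (a n * b n) := by
    have h1 := cauchySeq_iff_tendsto_dist_atTop_0.mp hup.cauchySeq
    have h2 := cauchySeq_iff_tendsto_dist_atTop_0.mp hvq.cauchySeq
    have h3 := (h1.mul_const N).add (h2.const_mul M)
    rw [zero_mul, mul_zero, add_zero] at h3
    rw [cauchySeq_iff_tendsto_dist_atTop_0]
    exact squeeze_zero (fun _ => dist_nonneg) (fun x => hbound x.1 x.2) h3
  obtain ⟨r, hr⟩ := cauchySeq_tendsto_of_complete hc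
  refine ⟨r, tendsto_nhds_unique ((G.continuous.tendsto r).comp hr)
    ((((G.continuous.tendsto p).comp hup).mul ((G.continuous.tendsto q).comp hvq)).congr
      fun n => ?_), tendsto_nhds_unique ((G'.continuous.tendsto r).comp hr)
    ((((G'.continuous.tendsto p).comp hup).mul ((G'.continuous.tendsto q).comp hvq)).congr
      fun n => ?_)⟩
  · simp only [Function.comp_apply, ← ha, ← hb, hG]
  · simp only [Function.comp_apply, ← ha, ← hb, hG']

end CompletelyBounded

/-! ### Complete boundedness of slice maps and of components -/

noncomputable section MainTheorem

open HilbertTensor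

variable {A : Type*} [Ring A] [StarRing A] [HopfAlgebra ℂ A] [StarModule ℂ A]

theorem mul_eq_of_sq_eq {a b c d g : ℝ} (ha : 0 ≤ a) (hb : 0 ≤ b) (hc : 0 ≤ c) (hd : 0 ≤ d)
    (hg : 0 ≤ g) (h1 : a ^ 2 = g * c ^ 2) (h2 : b ^ 2 = g * d ^ 2) : a * b = g * (c * d) := by
  refine (sq_eq_sq₀ (by positivity) (by positivity)).mp ?_
  rw [mul_pow, h1, h2]
  ring

namespace CompactQuantumGroup

variable {K : CompactQuantumGroup A}

section Slices

variable {E : Type*} [NormedAddCommGroup E] [InnerProductSpace ℂ E] [CompleteSpace E]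

/-- For an orthonormal family f, the matrix of slices is the compression of y to span(f) ⊗ F. -/
theorem norm_slice_matrix_le {F : Type*} [NormedAddCommGroup F] [InnerProductSpace ℂ F]
    [CompleteSpace F] (y : HilbertTensor E F →L[ℂ] HilbertTensor E F) {m : ℕ} {f : Fin m → E}
    (hf : ∀ i j, ⟪f i, f j⟫_ℂ = if i = j then ((1 : ℝ) : ℂ) else 0) :
    ‖CStarMatrix.ofMatrix fun k l => slice y (f k) (f l)‖ ≤ ‖y‖ := by
  refine CStarMatrix.norm_le_of_inner_op y.opNorm_nonneg fun v w => ?_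
  have e : ∑ k, ∑ l, ⟪v k, CStarMatrix.ofMatrix (fun k l => slice y (f k) (f l)) k l (w l)⟫_ℂ =
      ⟪∑ k, tmul (f k) (v k), y (∑ l, tmul (f l) (w l))⟫_ℂ := by
    rw [map_sum, sum_inner]
    refine Finset.sum_congr rfl fun k _ => ?_
    rw [inner_sum]
    exact Finset.sum_congr rfl fun l _ => inner_slice y (f k) (f l) (v k) (w l)
  have h := mul_eq_of_sq_eq (norm_nonneg _) (norm_nonneg _) (norm_nonneg _) (norm_nonneg _)
    zero_le_one (norm_sum_tmul_sq' hf v) (norm_sum_tmul_sq' hf w)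
  rw [e]
  calc _ ≤ ‖∑ k, tmul (f k) (v k)‖ * (‖y‖ * ‖∑ l, tmul (f l) (w l)‖) :=
        (norm_inner_le_norm _ _).trans (by gcongr; exact y.le_opNorm _)
    _ = ‖y‖ * (‖∑ k, tmul (f k) (v k)‖ * ‖∑ l, tmul (f l) (w l)‖) := by ring
    _ = ‖y‖ * ‖v‖ * ‖w‖ := by rw [h]; ring

theorem predualMatrixNorm_nonneg (M : VonNeumannAlgebra E) {n : ℕ}
    (ω : Fin n → Fin n → M.predual) : 0 ≤ M.predualMatrixNorm ω :=
  Real.sSup_nonneg (by rintro _ ⟨m, x, -, rfl⟩; exact norm_nonneg _)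

/-- The map `ω ↦ (id ⊗ ω)(y)` is completely bounded. -/
theorem norm_rightSlice_matrix_le {y : HilbertTensor E K.L2 →L[ℂ] HilbertTensor E K.L2}
    (hy : ∀ ξ η, slice y ξ η ∈ K.VN.toStarSubalgebra) {n : ℕ}
    (ω : Fin n → Fin n → K.VN.predual) :
    ‖CStarMatrix.ofMatrix fun i j => rightSlice y hy (ω i j)‖ ≤
      (‖y‖ + 1) * K.VN.predualMatrixNorm ω := by
  have hpos := predualMatrixNorm_nonneg K.VN ω
  refine CStarMatrix.norm_le_of_inner_op (by positivity) fun v w => ?_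
  -- Finitely many test vectors are expanded in an orthonormal basis f of their span. The form
  -- becomes that of the scalar matrix (ω_{ij}(x_{kl})) with x_{kl} the slice of y at f_k, f_l,
  -- which the norm of M_n(VN(K)_*) controls.
  let V : Submodule ℂ E := Submodule.span ℂ (Set.range v ∪ Set.range w)
  have hVfin : FiniteDimensional ℂ V := FiniteDimensional.span_of_finite ℂ
    ((Set.finite_range _).union (Set.finite_range _))
  obtain ⟨m, f, hf, hspan⟩ : ∃ (m : ℕ) (f : Fin m → E),
      (∀ i j, ⟪f i, f j⟫_ℂ = if i = j then ((1 : ℝ) : ℂ) else 0) ∧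
      ∀ x ∈ V, ∃ c : Fin m → ℂ, ∑ k, c k • f k = x := by
    let b := stdOrthonormalBasis ℂ V
    refine ⟨_, fun k => (b k : E), fun i j => ?_, fun x hx => ⟨fun k => b.repr ⟨x, hx⟩ k, ?_⟩⟩
    · rw [Complex.ofReal_one, ← orthonormal_iff_ite.mp b.orthonormal i j]
      rfl
    · have := congrArg Subtype.val (b.sum_repr ⟨x, hx⟩)
      simpa using this
  choose a ha using fun i => hspan (v i) (Submodule.subset_span (Or.inl ⟨i, rfl⟩))
  choose c hc using fun j => hspan (w j) (Submodule.subset_span (Or.inr ⟨j, rfl⟩))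
  let x : Fin m → Fin m → K.VN.toStarSubalgebra := fun k l => ⟨slice y (f k) (f l), hy _ _⟩
  -- The added 1 gives the strictly positive constant required for rescaling, also when y = 0.
  have hx : ‖CStarMatrix.ofMatrix (fun k l => (x k l : K.L2 →L[ℂ] K.L2))‖ ≤ ‖y‖ + 1 :=
    (norm_slice_matrix_le y hf).trans (by linarith)
  have hM := K.VN.norm_le_predualMatrixNorm ω x (by positivity) hx
  generalize hMdef : (CStarMatrix.ofMatrix fun p q =>
    (ω p.1 q.1 : StrongDual ℂ K.VN.toStarSubalgebra) (x p.2 q.2) :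
      CStarMatrix (Fin n × Fin m) (Fin n × Fin m) ℂ) = M at hM
  have hMe : ∀ i k j l, M (i, k) (j, l) = ⟪f k, rightSlice y hy (ω i j) (f l)⟫_ℂ := by
    intro i k j l
    rw [← hMdef, inner_rightSlice]
    rfl
  have hnorm : ∀ (u : PiLp 2 fun _ : Fin n => E) (d : Fin n → Fin m → ℂ),
      (∀ i, ∑ k, d i k • f k = u i) →
      ‖(WithLp.toLp 2 fun p => d p.1 p.2 : EuclideanSpace ℂ (Fin n × Fin m))‖ = ‖u‖ := by
    intro u d hd
    refine (sq_eq_sq₀ (norm_nonneg _) (norm_nonneg _)).mp ?_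
    rw [PiLp.norm_sq_eq_of_L2, PiLp.norm_sq_eq_of_L2, Fintype.sum_prod_type]
    refine Finset.sum_congr rfl fun i _ => ?_
    rw [← hd, norm_sum_smul_sq hf, one_mul]
  have h := CStarMatrix.norm_sum_le M (WithLp.toLp 2 fun p => a p.1 p.2)
    (WithLp.toLp 2 fun p => c p.1 p.2)
  rw [hnorm v a ha, hnorm w c hc] at h
  have e : ∑ i, ∑ j, ⟪v i, CStarMatrix.ofMatrix (fun i j => rightSlice y hy (ω i j)) i j
      (w j)⟫_ℂ = ∑ p, ∑ q, M p q * (star (a p.1 p.2) * c q.1 q.2) := by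
    simp only [Fintype.sum_prod_type]
    refine Finset.sum_congr rfl fun i _ => ?_
    rw [Finset.sum_comm]
    refine Finset.sum_congr rfl fun j _ => ?_
    change ⟪v i, rightSlice y hy (ω i j) (w j)⟫_ℂ = _
    rw [← ha, ← hc, map_sum, sum_inner]
    refine Finset.sum_congr rfl fun k _ => ?_
    rw [inner_sum]
    refine Finset.sum_congr rfl fun l _ => ?_
    rw [hMe, map_smul, inner_smul_left, inner_smul_right]
    change star (a i k) * _ = _
    ring
  rw [e]
  refine h.trans ?_
  gcongr

end Slices

section Components

variable {H : Type*} [NormedAddCommGroup H] [InnerProductSpace ℂ H] [CompleteSpace H]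

variable (K) in
theorem exists_rowGram_eq (μ : Irr A) : ∃ g : ℝ, 0 < g ∧ K.rowGram μ μ.idx μ.idx = g ∧
    ∀ i j, ⟪K.coeffVec μ i μ.idx, K.coeffVec μ j μ.idx⟫_ℂ = if i = j then (g : ℂ) else 0 := by
  have h := K.inner_coeffVec μ μ.idx μ.idx μ.idx μ.idx
  rw [if_pos rfl, inner_self_eq_norm_sq_to_K] at h
  have h' : K.rowGram μ μ.idx μ.idx = ((‖K.coeffVec μ μ.idx μ.idx‖ ^ 2 : ℝ) : ℂ) := by
    rw [← h, Complex.ofReal_pow]; rfl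
  refine ⟨‖K.coeffVec μ μ.idx μ.idx‖ ^ 2,
    pow_pos (norm_pos_iff.mpr (K.coeffVec_ne_zero _ _ _)) 2, h', fun i j => ?_⟩
  rw [inner_coeffVec, h']

/-- On vectors ∑ w_j ⊗ Λ((u_{j0})*), the form of T is g times that of X. The squared norms also
scale by g, so the factor cancels. -/
theorem norm_le_of_hasComponent {T : HilbertTensor H K.L2 →L[ℂ] HilbertTensor H K.L2} {μ : Irr A}
    {X : CStarMatrix (Fin μ.rep.dim) (Fin μ.rep.dim) (H →L[ℂ] H)} (hT : K.HasComponent T μ X) :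
    ‖X‖ ≤ ‖T‖ := by
  obtain ⟨g, hg, -, he⟩ := K.exists_rowGram_eq μ
  refine CStarMatrix.norm_le_of_inner_op T.opNorm_nonneg fun v w => ?_
  set e : Fin μ.rep.dim → K.L2 := fun i => K.coeffVec μ i μ.idx with hedef
  have h1 : ⟪∑ i, tmul (v i) (e i), T (∑ j, tmul (w j) (e j))⟫_ℂ =
      g * ∑ i, ∑ j, ⟪v i, X i j (w j)⟫_ℂ := by
    rw [map_sum, sum_inner, Finset.mul_sum]
    refine Finset.sum_congr rfl fun i _ => ?_
    rw [inner_sum, Finset.mul_sum]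
    refine Finset.sum_congr rfl fun j _ => ?_
    rw [hT.apply_coeffVec, inner_sum]
    simp only [inner_tmul]
    rw [Finset.sum_eq_single i]
    · rw [he, if_pos rfl, mul_comm]
    · intro m _ hm
      rw [he, if_neg hm.symm, mul_zero]
    · simp
  have h := mul_eq_of_sq_eq (norm_nonneg _) (norm_nonneg _) (norm_nonneg _) (norm_nonneg _)
    hg.le (norm_sum_tmul_sq he v) (norm_sum_tmul_sq he w)
  refine le_of_mul_le_mul_left (a := g) ?_ hg
  calc g * ‖∑ i, ∑ j, ⟪v i, X i j (w j)⟫_ℂ‖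
      = ‖⟪∑ i, tmul (v i) (e i), T (∑ j, tmul (w j) (e j))⟫_ℂ‖ := by
        rw [h1, norm_mul, Complex.norm_real, Real.norm_of_nonneg hg.le]
    _ ≤ ‖∑ i, tmul (v i) (e i)‖ * (‖T‖ * ‖∑ j, tmul (w j) (e j)‖) :=
        (norm_inner_le_norm _ _).trans (by gcongr; exact T.le_opNorm _)
    _ = ‖T‖ * (‖∑ i, tmul (v i) (e i)‖ * ‖∑ j, tmul (w j) (e j)‖) := by ring
    _ = g * (‖T‖ * ‖v‖ * ‖w‖) := by rw [h]; ring

variable (K) in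
/-- The matrix `(entry μ i j)` of normal functionals is a complete contraction. -/
theorem predualMatrixNorm_entry_le (μ : Irr A) :
    K.VN.predualMatrixNorm (fun i j => K.entry μ i j) ≤ 1 := by
  obtain ⟨g, hg, hrow, he⟩ := K.exists_rowGram_eq μ
  refine Real.sSup_le ?_ zero_le_one
  rintro _ ⟨m, x, hx, rfl⟩
  set e : Fin μ.rep.dim → K.L2 := fun i => K.coeffVec μ i μ.idx with hedef
  generalize hMdef : (CStarMatrix.ofMatrix fun p q =>
    (K.entry μ p.1 q.1 : StrongDual ℂ K.VN.toStarSubalgebra) (x p.2 q.2) :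
      CStarMatrix (Fin μ.rep.dim × Fin m) (Fin μ.rep.dim × Fin m) ℂ) = M
  have hMe : ∀ i k j l, M (i, k) (j, l) =
      (g : ℂ)⁻¹ * ⟪e i, (x k l : K.L2 →L[ℂ] K.L2) (e j)⟫_ℂ := by
    intro i k j l
    rw [← hMdef, ← hrow]
    exact entry_apply K μ i j (x k l)
  refine CStarMatrix.norm_le_of_sum zero_le_one fun v w => ?_
  -- Regrouping u ∈ ℂ^{n × m} as an m-tuple of combinations of the e_i is √g times an isometry. It
  -- exhibits the scalar matrix as g⁻¹ times a compression of x.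
  let V : EuclideanSpace ℂ (Fin μ.rep.dim × Fin m) → PiLp 2 (fun _ : Fin m => K.L2) := fun u =>
    WithLp.toLp 2 fun k => ∑ i, u (i, k) • e i
  have hV : ∀ u, ‖V u‖ ^ 2 = g * ‖u‖ ^ 2 := fun u => by
    rw [PiLp.norm_sq_eq_of_L2, PiLp.norm_sq_eq_of_L2, Fintype.sum_prod_type, Finset.sum_comm,
      Finset.mul_sum]
    exact Finset.sum_congr rfl fun k _ => norm_sum_smul_sq he fun i => u (i, k)
  have h := mul_eq_of_sq_eq (norm_nonneg _) (norm_nonneg _) (norm_nonneg _) (norm_nonneg _)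
    hg.le (hV v) (hV w)
  have h1 : ∑ p, ∑ q, M p q * (star (v p) * w q) = (g : ℂ)⁻¹ * ∑ k, ∑ l, ⟪V v k,
      CStarMatrix.ofMatrix (fun k l => (x k l : K.L2 →L[ℂ] K.L2)) k l (V w l)⟫_ℂ := by
    simp only [Fintype.sum_prod_type]
    rw [Finset.sum_comm, Finset.mul_sum]
    refine Finset.sum_congr rfl fun k _ => ?_
    rw [Finset.sum_congr rfl fun i _ => Finset.sum_comm, Finset.sum_comm, Finset.mul_sum]
    refine Finset.sum_congr rfl fun l _ => ?_
    change _ = (g : ℂ)⁻¹ * ⟪∑ i, v (i, k) • e i,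
      (x k l : K.L2 →L[ℂ] K.L2) (∑ j, w (j, l) • e j)⟫_ℂ
    rw [map_sum, sum_inner, Finset.mul_sum]
    refine Finset.sum_congr rfl fun i _ => ?_
    rw [inner_sum, Finset.mul_sum]
    refine Finset.sum_congr rfl fun j _ => ?_
    rw [hMe, map_smul, inner_smul_left, inner_smul_right]
    change _ = (g : ℂ)⁻¹ * (star (v (i, k)) * _)
    ring
  have h2 := CStarMatrix.norm_inner_op_le
    (CStarMatrix.ofMatrix (fun k l => (x k l : K.L2 →L[ℂ] K.L2))) (V v) (V w)
  rw [h1, norm_mul, norm_inv, Complex.norm_real, Real.norm_of_nonneg hg.le,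
    inv_mul_le_iff₀ hg]
  calc _ ≤ _ := h2
    _ ≤ 1 * ‖V v‖ * ‖V w‖ := by gcongr
    _ = g * (1 * ‖v‖ * ‖w‖) := by rw [one_mul, h]; ring

end Components

end CompactQuantumGroup

end MainTheorem

/-! ### Extensions of `θ` and the component bounds -/

noncomputable section Equivalences

open HilbertTensor

variable {A : Type*} [Ring A] [StarRing A] [HopfAlgebra ℂ A] [StarModule ℂ A]

namespace CompactQuantumGroup

variable {K : CompactQuantumGroup A}

theorem op_ext_Λ {f g : K.L2 →L[ℂ] K.L2} (h : ∀ a, f (K.Λ a) = g (K.Λ a)) : f = g :=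
  ContinuousLinearMap.ext_on K.dense_span_range_Λ (by rintro _ ⟨a, rfl⟩; exact h a)

theorem fourier_eq_rightSlice (ω : StrongDual ℂ K.VN.toStarSubalgebra) :
    K.fourier ω = rightSlice K.W K.slice_W_mem_VN ω :=
  ContinuousLinearMap.ext fun η => ext_inner_left ℂ fun ξ => by
    rw [inner_fourier, inner_rightSlice]; rfl

section RightSlice

variable {E : Type*} [NormedAddCommGroup E] [InnerProductSpace ℂ E] [CompleteSpace E]
  {y : HilbertTensor E K.L2 →L[ℂ] HilbertTensor E K.L2}

variable (hy : ∀ ξ η, slice y ξ η ∈ K.VN.toStarSubalgebra)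

theorem rightSlice_add (ω ω' : StrongDual ℂ K.VN.toStarSubalgebra) :
    rightSlice y hy (ω + ω') = rightSlice y hy ω + rightSlice y hy ω' :=
  ContinuousLinearMap.ext fun η => ext_inner_left ℂ fun ξ => by
    rw [add_apply, inner_add_right, inner_rightSlice hy (ω + ω'), inner_rightSlice hy ω,
      inner_rightSlice hy ω']
    rfl

theorem rightSlice_smul (c : ℂ) (ω : StrongDual ℂ K.VN.toStarSubalgebra) :
    rightSlice y hy (c • ω) = c • rightSlice y hy ω :=
  ContinuousLinearMap.ext fun η => ext_inner_left ℂ fun ξ => by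
    rw [smul_apply, inner_smul_right, inner_rightSlice hy (c • ω), inner_rightSlice hy ω]
    rfl

/-- The bounded map `ω ↦ (id ⊗ ω)(y)`. -/
def rightSliceL : StrongDual ℂ K.VN.toStarSubalgebra →L[ℂ] (E →L[ℂ] E) :=
  LinearMap.mkContinuous
    { toFun := fun ω => rightSlice y hy ω
      map_add' := rightSlice_add hy
      map_smul' := rightSlice_smul hy }
    ‖y‖ fun ω => (norm_rightSlice_le hy ω).trans (le_of_eq (mul_comm _ _))

/-- The map `ω ↦ (id ⊗ ω)(y)` on the predual. -/
def predualSlice : K.VN.predual →L[ℂ] (E →L[ℂ] E) := rightSliceL hy ∘L K.VN.predual.subtypeL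

theorem inner_predualSlice (ω : K.VN.predual) (ξ η : E) : ⟪ξ, predualSlice hy ω η⟫_ℂ =
    (ω : StrongDual ℂ K.VN.toStarSubalgebra) ⟨slice y ξ η, hy ξ η⟩ :=
  inner_rightSlice hy ω ξ η

end RightSlice

namespace DualWeight

variable {w : K.DualWeight}

theorem norm_smulInv_le (w : K.DualWeight) (ω : StrongDual ℂ K.VN.toStarSubalgebra) :
    ‖w.smulInv ω‖ ≤ ‖ω‖ * ‖w.inv‖ := by
  refine ContinuousLinearMap.opNorm_le_bound _ (by positivity) fun x => ?_
  rw [smulInv_apply]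
  calc _ ≤ ‖ω‖ * ‖x * w.inv‖ := ω.le_opNorm _
    _ ≤ ‖ω‖ * (‖x‖ * ‖w.inv‖) := by gcongr; exact norm_mul_le _ _
    _ = _ := by ring

/-- `DualWeight.fourier` as a bounded map. -/
def fourierL (w : K.DualWeight) : K.VN.predual →L[ℂ] (K.L2 →L[ℂ] K.L2) :=
  LinearMap.mkContinuous w.fourier (‖w.inv‖ * ‖K.W‖) fun ω => by
    change ‖K.fourier (w.smulInv (ω : StrongDual ℂ K.VN.toStarSubalgebra))‖ ≤ _
    rw [fourier_eq_rightSlice]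
    refine (norm_rightSlice_le _ _).trans ?_
    calc _ ≤ (‖(ω : StrongDual ℂ K.VN.toStarSubalgebra)‖ * ‖w.inv‖) * ‖K.W‖ := by
          gcongr; exact w.norm_smulInv_le _
      _ = ‖w.inv‖ * ‖K.W‖ * ‖(ω : StrongDual ℂ K.VN.toStarSubalgebra)‖ := by ring

theorem fourier_toPredual_apply (hw : w.IsCentral) (a b : A) :
    w.fourier (w.toPredual a) (K.Λ b) = K.Λ (a * b) := by
  rw [fourier_toPredual hw, CompactQuantumGroup.fourier_toPredual]

theorem fourier_toPredual_mul (hw : w.IsCentral) (a b : A) :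
    w.fourier (w.toPredual (a * b)) = w.fourier (w.toPredual a) * w.fourier (w.toPredual b) :=
  op_ext_Λ fun c => (fourier_toPredual_apply hw (a * b) c).trans
    ((congrArg K.Λ (mul_assoc a b c)).trans ((fourier_toPredual_apply hw a (b * c)).symm.trans
      (congrArg (w.fourier (w.toPredual a)) (fourier_toPredual_apply hw b c).symm)))

variable {H : Type*} [NormedAddCommGroup H] [InnerProductSpace ℂ H] [CompleteSpace H]
  {θ : A →ₙₐ[ℂ] (H →L[ℂ] H)}

/-- An operator is determined by its action on Λ(C^∞(K)), so the element of A(K,w) that acts as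
multiplication by a must be the one given by ω_a. -/
theorem Extends.apply_toPredual (hw : w.IsCentral) {T : w.beurlingFourier →ₗ[ℂ] (H →L[ℂ] H)}
    (hT : w.Extends T θ) (a : A) : T (w.toBeurlingFourier (w.toPredual a)) = θ a := by
  obtain ⟨f, hf, hTf⟩ := hT a
  rw [← hTf]
  congr 1
  exact Subtype.ext (op_ext_Λ fun b => (fourier_toPredual_apply hw a b).trans (hf b).symm)

/-- A completely bounded extension of `θ` bounds the components of `v_θ`. -/
theorem bddAbove_of_extends (hw : w.IsCentral) {T : w.beurlingFourier →ₗ[ℂ] (H →L[ℂ] H)}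
    (hcb : w.IsCompletelyBounded T) (hT : w.Extends T θ) :
    BddAbove (Set.range fun μ : Irr A => ‖vTheta θ μ‖ / w.component μ) := by
  obtain ⟨C, hC⟩ := hcb
  refine ⟨|C|, ?_⟩
  rintro _ ⟨μ, rfl⟩
  -- `entry μ i j` is the symbol of w(μ)⁻¹ u^μ_{ij}, so T applied entrywise to this matrix of
  -- functionals yields w(μ)⁻¹ v_θ^μ.
  have e : CStarMatrix.ofMatrix (fun i j => T (w.toBeurlingFourier (K.entry μ i j))) =
      ((w.component μ : ℂ))⁻¹ • vTheta θ μ := by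
    refine CStarMatrix.ext fun i j => ?_
    change T (w.toBeurlingFourier (K.entry μ i j)) = ((w.component μ : ℂ))⁻¹ • θ (μ.rep.mat i j)
    rw [← toPredual_inv_smul_coeff hw, hT.apply_toPredual hw, map_smul]
  have h := hC _ fun i j => K.entry μ i j
  have hpos := component_pos hw μ
  rw [e, norm_smul, norm_inv, Complex.norm_real, Real.norm_of_nonneg hpos.le,
    inv_mul_eq_div] at h
  -- Complete boundedness does not prescribe the sign of C, hence the bound |C|.
  refine h.trans ((le_abs_self _).trans ?_)
  rw [abs_mul, abs_of_nonneg (predualMatrixNorm_nonneg _ _)]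
  exact mul_le_of_le_one_right (abs_nonneg C) (K.predualMatrixNorm_entry_le μ)

/-- Slicing with w(μ) • `entry μ i j` reads the (i,j) entry of w(μ)⁻¹ v_θ^μ and restores the factor
w(μ). -/
theorem predualSlice_toPredual (hw : w.IsCentral)
    {S : HilbertTensor H K.L2 →L[ℂ] HilbertTensor H K.L2}
    (hS : ∀ μ : Irr A, K.HasComponent S μ ((w.component μ)⁻¹ • vTheta θ μ))
    (hy : ∀ ξ η, slice S ξ η ∈ K.VN.toStarSubalgebra) (a : A) :
    predualSlice hy (w.toPredual a) = θ a := by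
  let g : A →ₗ[ℂ] (H →L[ℂ] H) := { toFun := θ, map_add' := map_add θ, map_smul' := map_smul θ }
  refine LinearMap.congr_fun (K.linearMap_ext (f := (predualSlice hy).toLinearMap ∘ₗ w.toPredual)
    (g := g) fun μ i j => ContinuousLinearMap.ext fun η => ext_inner_left ℂ fun ξ => ?_) a
  change ⟪ξ, predualSlice hy (w.toPredual (μ.rep.mat i j)) η⟫_ℂ = ⟪ξ, θ (μ.rep.mat i j) η⟫_ℂ
  have h1 : slice S ξ η (K.coeffVec μ j μ.idx) = ∑ m,
      (((w.component μ : ℂ))⁻¹ * ⟪ξ, θ (μ.rep.mat m j) η⟫_ℂ) • K.coeffVec μ m μ.idx := by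
    rw [slice_apply, (hS μ).apply_coeffVec, map_sum]
    refine Finset.sum_congr rfl fun m _ => ?_
    rw [adjoint_ket_tmul]
    congr 1
    change ⟪ξ, (w.component μ)⁻¹ • θ (μ.rep.mat m j) η⟫_ℂ = _
    rw [← Complex.coe_smul, inner_smul_right, Complex.ofReal_inv]
  rw [inner_predualSlice, toPredual_coeff, predual_smul_apply,
    entry_eq (x := ⟨slice S ξ η, hy ξ η⟩) h1 i, mul_inv_cancel_left₀ (component_ne_zero hw μ)]

instance : CompleteSpace K.VN.predual :=
  (Submodule.isClosed_topologicalClosure _).completeSpace_coe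

/-- `A(K,w)` is closed under products, and maps that are multiplicative on `C^∞(K)` are
multiplicative on `A(K,w)`. -/
theorem exists_fourier_eq_mul (hw : w.IsCentral) {R : K.VN.predual →L[ℂ] (H →L[ℂ] H)}
    (hR : ∀ a, R (w.toPredual a) = θ a) (ω ω' : K.VN.predual) :
    ∃ r, w.fourier r = w.fourier ω * w.fourier ω' ∧ R r = R ω * R ω' := by
  -- Using both maps together ensures that one functional r represents the product in A(K,w) and has
  -- the product of the images under R.
  exact exists_apply_eq_mul w.toPredual (denseRange_toPredual hw) (norm_toPredual_mul_le hw)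
    w.fourierL R (fourier_toPredual_mul hw)
    (fun a b => (hR (a * b)).trans ((map_mul θ a b).trans
      (congrArg₂ (· * ·) (hR a).symm (hR b).symm))) ω ω'

/-- Injectivity of ω ↦ (id ⊗ w⁻¹ω)(W) lets any linear map on the predual descend to A(K,w). -/
theorem exists_comp_toBeurlingFourier (hw : w.IsCentral) (R : K.VN.predual →ₗ[ℂ] (H →L[ℂ] H)) :
    ∃ T : w.beurlingFourier →ₗ[ℂ] (H →L[ℂ] H), ∀ ω, T (w.toBeurlingFourier ω) = R ω :=
  ⟨R ∘ₗ (LinearEquiv.ofInjective w.fourier (fourier_injective hw)).symm.toLinearMap,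
    fun ω => congrArg R ((LinearEquiv.ofInjective w.fourier (fourier_injective hw)).symm_apply_apply
      ω)⟩

theorem isMultiplicative_of_comp (hw : w.IsCentral) {R : K.VN.predual →L[ℂ] (H →L[ℂ] H)}
    (hR : ∀ a, R (w.toPredual a) = θ a) {T : w.beurlingFourier →ₗ[ℂ] (H →L[ℂ] H)}
    (hT : ∀ ω, T (w.toBeurlingFourier ω) = R ω) : w.IsMultiplicative T := by
  intro f g
  obtain ⟨ω, hω⟩ := f.2
  obtain ⟨ω', hω'⟩ := g.2
  have hf : w.toBeurlingFourier ω = f := Subtype.ext hω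
  have hg : w.toBeurlingFourier ω' = g := Subtype.ext hω'
  obtain ⟨r, hr, hr'⟩ := exists_fourier_eq_mul hw hR ω ω'
  have e : R ω * R ω' = T f * T g := by rw [← hT, ← hT, hf, hg]
  have e' : w.fourier ω * w.fourier ω' =
      (f : K.L2 →L[ℂ] K.L2) * (g : K.L2 →L[ℂ] K.L2) := congrArg₂ (· * ·) hω hω'
  exact ⟨w.toBeurlingFourier r, hr.trans e', (hT r).trans (hr'.trans e)⟩

/-- An operator with components `w(μ)⁻¹ v_θ^μ` defines a completely bounded extension of `θ`. -/
theorem exists_extension (hw : w.IsCentral)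
    {S : HilbertTensor H K.L2 →L[ℂ] HilbertTensor H K.L2}
    (hS : ∀ μ : Irr A, K.HasComponent S μ ((w.component μ)⁻¹ • vTheta θ μ)) :
    ∃ T : w.beurlingFourier →ₗ[ℂ] (H →L[ℂ] H),
      w.IsMultiplicative T ∧ w.IsCompletelyBounded T ∧ w.Extends T θ := by
  have hy : ∀ ξ η, slice S ξ η ∈ K.VN.toStarSubalgebra := fun ξ η =>
    (hasBlocks_slice (fun μ => ⟨_, hS μ⟩) ξ η).mem_VN
  have hR := predualSlice_toPredual hw hS hy
  obtain ⟨T, hT⟩ := exists_comp_toBeurlingFourier hw (predualSlice hy).toLinearMap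
  refine ⟨T, isMultiplicative_of_comp hw hR hT, ⟨‖S‖ + 1, fun n ω => ?_⟩, fun a =>
    ⟨w.toBeurlingFourier (w.toPredual a), fourier_toPredual_apply hw a, (hT _).trans (hR a)⟩⟩
  have h : (fun i j => T (w.toBeurlingFourier (ω i j))) = fun i j => rightSlice S hy (ω i j) :=
    funext fun i => funext fun j => hT (ω i j)
  rw [h]
  exact norm_rightSlice_matrix_le hy ω

end DualWeight

end CompactQuantumGroup

end Equivalences

/-! ### The three equivalent conditions -/

theorem mainTheorem6 {A : Type*} [Ring A] [StarRing A] [HopfAlgebra ℂ A] [StarModule ℂ A]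
    (K : CompactQuantumGroup A) (w : K.DualWeight) (hw : w.IsCentral)
    {H : Type*} [NormedAddCommGroup H] [InnerProductSpace ℂ H] [CompleteSpace H]
    (θ : A →ₙₐ[ℂ] (H →L[ℂ] H)) :
    ((∃ T : w.beurlingFourier →ₗ[ℂ] (H →L[ℂ] H),
        w.IsMultiplicative T ∧ w.IsCompletelyBounded T ∧ w.Extends T θ) ↔
      (∃ T ∈ K.boundedTensorVN H, ∀ μ : Irr A,
        K.HasComponent T μ ((w.component μ)⁻¹ • vTheta θ μ))) ∧
    ((∃ T ∈ K.boundedTensorVN H, ∀ μ : Irr A,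
        K.HasComponent T μ ((w.component μ)⁻¹ • vTheta θ μ)) ↔
      BddAbove (Set.range fun μ : Irr A => ‖vTheta θ μ‖ / w.component μ)) := by
  have hnorm : ∀ μ : Irr A, ‖(w.component μ)⁻¹ • vTheta θ μ‖ = ‖vTheta θ μ‖ / w.component μ := by
    intro μ
    have e : (w.component μ)⁻¹ • vTheta θ μ = (((w.component μ)⁻¹ : ℝ) : ℂ) • vTheta θ μ := by
      ext i j : 2
      exact (Complex.coe_smul _ _).symm
    have hpos := CompactQuantumGroup.DualWeight.component_pos hw μ
    rw [e, norm_smul, Complex.norm_real, Real.norm_of_nonneg (inv_nonneg.mpr hpos.le),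
      inv_mul_eq_div]
  have h23 : (∃ T ∈ K.boundedTensorVN H, ∀ μ : Irr A,
      K.HasComponent T μ ((w.component μ)⁻¹ • vTheta θ μ)) →
      BddAbove (Set.range fun μ : Irr A => ‖vTheta θ μ‖ / w.component μ) := by
    rintro ⟨T, -, hT⟩
    refine ⟨‖T‖, ?_⟩
    rintro _ ⟨μ, rfl⟩
    change ‖vTheta θ μ‖ / w.component μ ≤ ‖T‖
    rw [← hnorm]
    exact CompactQuantumGroup.norm_le_of_hasComponent (hT μ)
  have h32 : BddAbove (Set.range fun μ : Irr A => ‖vTheta θ μ‖ / w.component μ) →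
      ∃ T ∈ K.boundedTensorVN H, ∀ μ : Irr A,
        K.HasComponent T μ ((w.component μ)⁻¹ • vTheta θ μ) := by
    rintro ⟨C, hC⟩
    obtain ⟨T, hT⟩ := CompactQuantumGroup.exists_hasComponent (K := K)
      (fun μ => (w.component μ)⁻¹ • vTheta θ μ) (C := C) fun μ => by
        rw [hnorm]; exact hC ⟨μ, rfl⟩
    exact ⟨T, CompactQuantumGroup.mem_boundedTensorVN_of_hasComponent fun μ => ⟨_, hT μ⟩, hT⟩
  refine ⟨⟨?_, ?_⟩, h23, h32⟩
  · rintro ⟨T, -, hcb, hext⟩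
    -- Condition 2 is reached from 1 through the uniform bound 3.
    exact h32 (CompactQuantumGroup.DualWeight.bddAbove_of_extends hw hcb hext)
  · rintro ⟨T, -, hT⟩
    exact CompactQuantumGroup.DualWeight.exists_extension hw hT
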